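/- Let $A,B\in\mathbb R$, let $f:(0,\infty)\to\mathbb R$ be differentiable with $$x f'(x)-f(x)+\tfrac12 f(x)^2=Ax+B\qquad(x>0),$$ let $F$ satisfy $F'(x)=f(x)/x$ on $(0,\infty)$, and for $\lambda\ge 0$, $x,t>0$ put $$U_\lambda(x,t)=\exp\!\Big[-\frac{\lambda\,(x+At^2/2)}{1+\lambda t}-\frac12\Big(F(x)-F\Big(\frac{x}{(1+\lambda t)^2}\Big)\Big)\Big].$$ (1) There is a function $p(x,y,t)$ that is, in the variable $y$, the inverse Laplace transform of $\lambda\mapsto U_\lambda(x,t)$ for all $x,t>0$, i.e. $p(x,\cdot,t)\in L^1(0,\infty)$ and $\int_0^\infty e^{-\lambda y}p(x,y,t)\,dy=U_\lambda(x,t)$ for all $\lambda\ge0$, if and only if $U_\lambda(x,t)\to0$ as $\lambda\to\infty$ for all $x,t>0$. (2) Let $p$ be such an inverse Laplace transform, and let $\varphi\in C^2((0,\infty))$ be bounded. Then the integral $$u(x,t)=\int_0^\infty p(x,y,t)\,\varphi(y)\,dy\qquad(x,t>0)$$ converges absolutely, and for every $0<\beta\le1$ its Wright-type transform $$u_\beta(x,t)=\int_0^\infty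 u(x,s)\,g_\beta(s;t)\,ds,\qquad g_\beta(s;t)=\frac1{t^\beta}\sum_{k=0}^\infty\frac{(-s/t^\beta)^k}{k!\,\Gamma(1-\beta-\beta k)}$$ (absolutely convergent for $\beta<1$; for $\beta=1$, $g_1(\cdot\,;t)$ is the unit mass at $t$ and $u_1=u$) is a solution of $${}_CD_t^\beta u_\beta=x\,\partial_x^2u_\beta+f(x)\,\partial_xu_\beta\quad(x,t>0),\qquad u_\beta(x,0)=\varphi(x).$$ Here ${}_CD_t^\beta v(t)=\frac1{\Gamma(1-\beta)}\int_0^t(t-\tau)^{-\beta}v'(\tau)\,d\tau$ for $0<\beta<1$ and ${}_CD_t^1v=v'$. Being a solution means that $u_\beta$ is $C^2$ in $x$ and $C^1$ in $t$ on $x,t>0$, that the integral defining the Caputo derivative (for $\beta<1$) converges absolutely, that the equation holds at all $x,t>0$, and that $u_\beta(x,t)\to\varphi(x)$ as $t\to0^+$ for every $x>0$. -/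

import Mathlib

open Real Set Filter Topology MeasureTheory

noncomputable section

/-- The Wright function `W_{a,b}(z) = ∑ z^k / (k! Γ(a k + b))`. Mathlib's `Γ` is `0` at its poles,
so the terms with `a k + b` a non-positive integer vanish, which is the usual `1 / Γ = 0` there. -/
def wright (a b z : ℝ) : ℝ :=
  ∑' k : ℕ, z ^ k / ((Nat.factorial k : ℝ) * Real.Gamma (a * k + b))

/-- The Wright-type density `g_β(s; t) = t^{-β} W_{-β, 1-β}(-s / t^β)`, for `0 < β < 1`, `t > 0`. -/
def wrightDensity (β s t : ℝ) : ℝ :=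
  (1 / t ^ β) * wright (-β) (1 - β) (-(s / t ^ β))

/-- The Wright-type transform `v_β(t) = ∫₀^∞ v(s) g_β(s; t) ds`. For `β = 1` the density
degenerates to the point mass at `s = t`, and the transform is `v` itself. -/
def wrightTransform (β : ℝ) (v : ℝ → ℝ) (t : ℝ) : ℝ :=
  if β = 1 then v t else ∫ s in Ioi (0 : ℝ), v s * wrightDensity β s t

/-- The Caputo derivative `J^{1-β} D v` of order `0 < β ≤ 1` (with `J^0` the identity). -/
def caputoDeriv (β : ℝ) (v : ℝ → ℝ) (t : ℝ) : ℝ :=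
  if β = 1 then deriv v t
  else (1 / Real.Gamma (1 - β)) * ∫ τ in (0 : ℝ)..t, (t - τ) ^ (-β) * deriv v τ

/-- `u` is a (classical) solution, on `x > 0`, `t > 0`, of the initial value problem
`_C D_t^β u = x u_xx + f(x) u_x`, `u(x, 0) = φ(x)`. -/
structure IsFracSolution (β : ℝ) (f φ : ℝ → ℝ) (u : ℝ → ℝ → ℝ) : Prop where
  contDiffOn_space : ∀ t > 0, ContDiffOn ℝ 2 (fun x => u x t) (Ioi 0)
  contDiffOn_time : ∀ x > 0, ContDiffOn ℝ 1 (fun t => u x t) (Ioi 0)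
  /-- the integral that defines the Caputo derivative converges absolutely -/
  caputo_integrable : β < 1 → ∀ x > 0, ∀ t > 0,
    IntervalIntegrable (fun τ => (t - τ) ^ (-β) * deriv (fun s => u x s) τ) volume 0 t
  equation : ∀ x > 0, ∀ t > 0,
    caputoDeriv β (fun s => u x s) t =
      x * deriv (deriv (fun z => u z t)) x + f x * deriv (fun z => u z t) x
  initial : ∀ x > 0, Tendsto (fun t => u x t) (𝓝[>] 0) (𝓝 (φ x))

/-- The function `g` on `(0, ∞)` is the inverse Laplace transform of `G`, a function on `[0, ∞)`. -/
def IsInverseLaplace (G g : ℝ → ℝ) : Prop :=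
  ∀ l ≥ 0, IntegrableOn (fun y => Real.exp (-l * y) * g y) (Ioi 0) ∧
    ∫ y in Ioi (0 : ℝ), Real.exp (-l * y) * g y = G l

/-- `U_λ(x, t)`; the parameter `λ` is written `l`. -/
def laplaceKernel (A : ℝ) (F : ℝ → ℝ) (l x t : ℝ) : ℝ :=
  Real.exp (-(l * (x + A * t ^ 2 / 2)) / (1 + l * t)
    - (1 / 2) * (F x - F (x / (1 + l * t) ^ 2)))

/-- `p(x, y, t)` is, in the variable `y`, the inverse Laplace transform of `λ ↦ U_λ(x, t)`. -/
def IsGreenKernel (A : ℝ) (F : ℝ → ℝ) (p : ℝ → ℝ → ℝ → ℝ) : Prop :=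
  ∀ x > 0, ∀ t > 0, IsInverseLaplace (fun l => laplaceKernel A F l x t) (fun y => p x y t)

/-- `u(x, t) = ∫₀^∞ p(x, y, t) φ(y) dy`. -/
def greenIntegral (p : ℝ → ℝ → ℝ → ℝ) (φ : ℝ → ℝ) (x t : ℝ) : ℝ :=
  ∫ y in Ioi (0 : ℝ), p x y t * φ y

end

/-! The substitution `f = 2 x Y' / Y`, that is `Y = exp (F / 2)`, turns the Riccati equation into
the linear equation `2 x² Y'' = (A x + B) Y`. With `s = 1 + λ t` and `c = x / t + A t / 2`, the
function `U_λ` equals `exp (-c + c / s) · Y (x / s²) / Y x`. The existence of `f` on the whole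
half-line forces `A ≥ 0` and `1 + 2 B ≥ 0` (otherwise `arctan (f - 1)` would vary by more than `π`),
so `ν = √(1 + 2 B)` is real and `Y` is built from the Frobenius solutions `x ^ ((1 ± ν) / 2) E (x)`
with `E` entire, or from a logarithmic one when `ν = 0`.

Part (1). An integrable inverse transform forces `U_λ → 0` by dominated convergence. Conversely,
decay at `x = t = 1` already gives `Y → 0` at the origin; for `ν ≥ 1` this leaves only the exponent
`(1 + ν) / 2`, and for `ν < 1` both exponents are positive. Hence `U_λ` is a finite sum of terms
`exp (-c + c / s) E (x / s²) g (s)` with `g (s) = s ^ (-(1 + μ))`, `μ > -1`, or `g (s) = log s / s`.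
Expanded in powers of `1 / s`, such a term is a double series of Laplace transforms of iterated
primitives of one function (a seed). The series converges in `L¹` after weighting by `e^{-z}`, in
the scaled variable `z = y / t`. This gives a kernel that is `C²` in `x` as an `L¹`-valued map, with
norm bounded uniformly in `t` (`hasKernel_laplaceKernel`).

Part (2), `β = 1`. The functions `U_λ` solve the equation by direct computation, so the integrated
equation holds for `φ (y) = e^{-n y}`. Polynomials in `e^{-y}` approximate every bounded continuous
`φ` boundedly and pointwise, and the integrated equation survives such limits
(`integrated_equation`). The same density gives uniqueness of the inverse transform, so any `p` may
be replaced by the constructed kernel. Evaluating the transform at `λ = 0, 1, 2` is a Chebyshev-type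
argument that yields `|u (x, t) - φ (x)| ≤ C √t` (`HasKernel.exists_parabolic`).

Part (2), `β < 1`. Put `w_n (s, t) = t ^ (-n β) ∑ (-s t ^ (-β))^k / (k! Γ (1 - (n + k) β))`; then
`w_1` is the density `g_β`, and `∂_s w_1 = -w_2`. Integral representations along a ray give decay in
`s` and the Laplace transforms in `t`, namely `p ^ (β - 1) e^{-s p^β}` and `p ^ (2 β - 1) e^{-s
p^β}`. Since `u - φ = O(√s)`, a comparison of Laplace transforms shows that the Caputo derivative of
`∫ u w_1 ds` is `∫ u w_2 ds - φ w_1 (0, t)` (`wright_transform_time`). Integration by parts in `s`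
of `∫ u_s w_1 ds` gives the same expression for the spatial operator; as `u_x` and `u_xx` are not
controlled at `s = 0` or at infinity, this is done on truncated integrals and passed to the limit in
divergence form (`exists_operator_limit`). -/

/-! ### Entire power series and the double series in `c` and `x`. -/

/-- The coefficient sequence of an entire power series. -/
def EntireSeq (e : ℕ → ℝ) : Prop := ∀ r : ℝ, Summable fun k => |e k| * |r| ^ k

/-- The coefficients of the derivative of a power series. -/
def derivSeq (e : ℕ → ℝ) (k : ℕ) : ℝ := (k + 1) * e (k + 1)

/-- The sum of a power series. -/
noncomputable def entireSum (e : ℕ → ℝ) (x : ℝ) : ℝ := ∑' k, e k * x ^ k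

/-- The factor `k + 1 ≤ 2 ^ (k + 1)` is absorbed by doubling the radius; the `+ 1` in the radius
pays for the shift from `k` to `k + 1`. -/
theorem EntireSeq.derivSeq {e : ℕ → ℝ} (he : EntireSeq e) : EntireSeq (derivSeq e) := by
  intro r
  have h1 := (summable_nat_add_iff 1).2 (he (2 * (|r| + 1)))
  refine Summable.of_nonneg_of_le (fun k => by positivity) (fun k => ?_) h1
  have h2 : ((k : ℝ) + 1) ≤ 2 ^ (k + 1) := by
    have := (Nat.lt_two_pow_self (n := k + 1)).le
    exact_mod_cast this
  have h3 : |r| ^ k ≤ (|r| + 1) ^ (k + 1) := by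
    calc |r| ^ k ≤ (|r| + 1) ^ k := by gcongr; linarith
      _ ≤ (|r| + 1) ^ (k + 1) := pow_le_pow_right₀ (by linarith [abs_nonneg r]) (by omega)
  have h4 : |2 * (|r| + 1)| = 2 * (|r| + 1) := abs_of_nonneg (by positivity)
  unfold _root_.derivSeq
  rw [h4, mul_pow, abs_mul, abs_of_nonneg (by positivity : (0 : ℝ) ≤ k + 1)]
  calc ((k : ℝ) + 1) * |e (k + 1)| * |r| ^ k
      ≤ 2 ^ (k + 1) * |e (k + 1)| * (|r| + 1) ^ (k + 1) := by gcongr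
    _ = _ := by ring

theorem EntireSeq.of_ratio {e : ℕ → ℝ} {q : ℕ → ℝ} (hq : Tendsto q atTop (𝓝 0))
    (h : ∀ k, |e (k + 1)| ≤ q k * |e k|) : EntireSeq e := by
  intro r
  have h0 : Tendsto (fun k => q k * |r|) atTop (𝓝 0) := by simpa using hq.mul_const |r|
  refine summable_of_ratio_norm_eventually_le (r := 1 / 2) (by norm_num) ?_
  filter_upwards [h0.eventually (gt_mem_nhds (by norm_num : (0 : ℝ) < 1 / 2))] with k hk
  rw [Real.norm_of_nonneg (by positivity), Real.norm_of_nonneg (by positivity), pow_succ]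
  calc |e (k + 1)| * (|r| ^ k * |r|) ≤ (q k * |e k|) * (|r| ^ k * |r|) := by
        gcongr; exact h k
    _ = (q k * |r|) * (|e k| * |r| ^ k) := by ring
    _ ≤ _ := by gcongr

section dblSeries

variable {X : Type*} [NormedAddCommGroup X] [NormedSpace ℝ X]

/-- The double series `∑ c^j / j! · e_k x^k · H_{j + 2 k}`. -/
noncomputable def dblSeries (e : ℕ → ℝ) (H : ℕ → X) (c x : ℝ) : X :=
  ∑' q : ℕ × ℕ, (c ^ q.1 / (q.1.factorial : ℝ) * (e q.2 * x ^ q.2)) • H (q.1 + 2 * q.2)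

theorem summable_exp_mul {e : ℕ → ℝ} (he : EntireSeq e) (c x : ℝ) :
    Summable fun q : ℕ × ℕ => |c| ^ q.1 / (q.1.factorial : ℝ) * (|e q.2| * |x| ^ q.2) :=
  (Real.summable_pow_div_factorial |c|).mul_of_nonneg (he x)
    (fun _ => by positivity) (fun _ => by positivity)

theorem norm_dblTerm_le {e : ℕ → ℝ} {H : ℕ → X} {N : ℝ} (hH : ∀ m, ‖H m‖ ≤ N) (c x : ℝ)
    (q : ℕ × ℕ) :
    ‖(c ^ q.1 / (q.1.factorial : ℝ) * (e q.2 * x ^ q.2)) • H (q.1 + 2 * q.2)‖ ≤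
      |c| ^ q.1 / (q.1.factorial : ℝ) * (|e q.2| * |x| ^ q.2) * N := by
  rw [norm_smul]
  refine mul_le_mul (le_of_eq ?_) (hH _) (norm_nonneg _) (by positivity)
  simp

theorem summable_dblTerm [CompleteSpace X] {e : ℕ → ℝ} (he : EntireSeq e) {H : ℕ → X} {N : ℝ}
    (hH : ∀ m, ‖H m‖ ≤ N) (c x : ℝ) :
    Summable fun q : ℕ × ℕ =>
      (c ^ q.1 / (q.1.factorial : ℝ) * (e q.2 * x ^ q.2)) • H (q.1 + 2 * q.2) :=
  Summable.of_norm_bounded ((summable_exp_mul he c x).mul_right N) (norm_dblTerm_le hH c x)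

theorem continuous_dblSeries [CompleteSpace X] {e : ℕ → ℝ} (he : EntireSeq e) {H : ℕ → X} {N : ℝ}
    (hH : ∀ m, ‖H m‖ ≤ N) : Continuous fun p : ℝ × ℝ => dblSeries e H p.1 p.2 := by
  have hN : 0 ≤ N := (norm_nonneg _).trans (hH 0)
  rw [continuous_iff_continuousAt]
  rintro ⟨c₀, x₀⟩
  set R := |c₀| + |x₀| + 1
  have hR : 0 ≤ R := by positivity
  have hnhds : (Ioo (-R) R) ×ˢ (Ioo (-R) R) ∈ 𝓝 (c₀, x₀) := by
    refine prod_mem_nhds (Ioo_mem_nhds ?_ ?_) (Ioo_mem_nhds ?_ ?_) <;>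
    simp only [R] <;>
    linarith [abs_nonneg c₀, abs_nonneg x₀, neg_abs_le c₀, le_abs_self c₀, neg_abs_le x₀,
      le_abs_self x₀]
  refine ContinuousOn.continuousAt ?_ hnhds
  refine continuousOn_tsum (u := fun q : ℕ × ℕ =>
    |R| ^ q.1 / (q.1.factorial : ℝ) * (|e q.2| * |R| ^ q.2) * N) (fun q => ?_)
    ((summable_exp_mul he R R).mul_right N) ?_
  · exact Continuous.continuousOn (by fun_prop)
  · rintro q ⟨c, x⟩ ⟨hc, hx⟩
    refine (norm_dblTerm_le hH c x q).trans ?_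
    have hc' : |c| ≤ |R| := by rw [abs_of_nonneg hR]; exact abs_le.2 ⟨hc.1.le, hc.2.le⟩
    have hx' : |x| ≤ |R| := by rw [abs_of_nonneg hR]; exact abs_le.2 ⟨hx.1.le, hx.2.le⟩
    gcongr

/-- Terms with first index `0` carry the factor `0`, so the sum may be reindexed by the successor.
This is the bookkeeping of term-by-term differentiation in `c`; `tsum_shift_snd` does the same for
`x`. -/
theorem tsum_shift_fst (a : ℕ × ℕ → X) :
    ∑' q : ℕ × ℕ, ((q.1 : ℝ)) • a q = ∑' q : ℕ × ℕ, ((q.1 : ℝ) + 1) • a (q.1 + 1, q.2) := by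
  have hinj : Function.Injective fun q : ℕ × ℕ => (q.1 + 1, q.2) := by
    rintro ⟨a, b⟩ ⟨c, d⟩ h
    simpa using h
  have := hinj.tsum_eq (f := fun q : ℕ × ℕ => ((q.1 : ℝ)) • a q) ?_
  · rw [← this]; simp
  · rintro ⟨j, k⟩ h
    rcases j with _ | j
    · simp at h
    · exact ⟨(j, k), rfl⟩

theorem tsum_shift_snd (a : ℕ × ℕ → X) :
    ∑' q : ℕ × ℕ, ((q.2 : ℝ)) • a q = ∑' q : ℕ × ℕ, ((q.2 : ℝ) + 1) • a (q.1, q.2 + 1) := by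
  have hinj : Function.Injective fun q : ℕ × ℕ => (q.1, q.2 + 1) := by
    rintro ⟨a, b⟩ ⟨c, d⟩ h
    simpa using h
  have := hinj.tsum_eq (f := fun q : ℕ × ℕ => ((q.2 : ℝ)) • a q) ?_
  · rw [← this]; simp
  · rintro ⟨j, k⟩ h
    rcases k with _ | k
    · simp at h
    · exact ⟨(j, k), rfl⟩

theorem summable_fst_mul {e : ℕ → ℝ} (he : EntireSeq e) {R : ℝ} (hR : 0 ≤ R) :
    Summable fun q : ℕ × ℕ => (q.1 : ℝ) * R ^ (q.1 - 1) / (q.1.factorial : ℝ) *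
      (|e q.2| * R ^ q.2) := by
  have h1 : Summable fun j : ℕ => (j : ℝ) * R ^ (j - 1) / (j.factorial : ℝ) := by
    rw [← summable_nat_add_iff 1]
    refine (Real.summable_pow_div_factorial R).congr fun j => ?_
    have : ((j : ℝ) + 1) ≠ 0 := by positivity
    rw [Nat.factorial_succ]
    push_cast
    try simp only [Nat.add_sub_cancel]
    field_simp
  have h2 : Summable fun k => |e k| * R ^ k := by simpa [abs_of_nonneg hR] using he R
  exact h1.mul_of_nonneg h2 (fun _ => by positivity) (fun _ => by positivity)

theorem summable_snd_mul {e : ℕ → ℝ} (he : EntireSeq e) {R : ℝ} (hR : 0 ≤ R) :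
    Summable fun q : ℕ × ℕ => R ^ q.1 / (q.1.factorial : ℝ) *
      (|e q.2| * ((q.2 : ℝ) * R ^ (q.2 - 1))) := by
  have h2 : Summable fun k : ℕ => |e k| * ((k : ℝ) * R ^ (k - 1)) := by
    rw [← summable_nat_add_iff 1]
    refine (he.derivSeq R).congr fun k => ?_
    rw [derivSeq, abs_mul, abs_of_nonneg (by positivity : (0 : ℝ) ≤ k + 1), abs_of_nonneg hR]
    push_cast
    try simp only [Nat.add_sub_cancel]
    ring
  exact (Real.summable_pow_div_factorial R).mul_of_nonneg h2
    (fun _ => by positivity) (fun _ => by positivity)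

/-- Differentiating `c ^ j / j!` shifts `j`, which moves `H` by one; differentiating `e_k x ^ k`
shifts `k`, which moves `H` by two because the index is `j + 2 k`. The derivative is therefore a
combination of series of the same kind with the same bound `N`, and the lemma can be iterated. -/
theorem hasDerivAt_dblSeries [CompleteSpace X] {e : ℕ → ℝ} (he : EntireSeq e) {H : ℕ → X} {N : ℝ}
    (hH : ∀ m, ‖H m‖ ≤ N) (a b x : ℝ) :
    HasDerivAt (fun x => dblSeries e H (a * x + b) x)
      (a • dblSeries e (fun m => H (m + 1)) (a * x + b) x +
        dblSeries (derivSeq e) (fun m => H (m + 2)) (a * x + b) x) x := by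
  have hN : 0 ≤ N := (norm_nonneg _).trans (hH 0)
  set R := |a| * (|x| + 1) + |b| + |x| + 1 with hRdef
  have hR : 0 ≤ R := by positivity
  -- The truncated exponents `q.1 - 1` and `q.2 - 1` are harmless: `A` and `B` only occur multiplied
  -- by `q.1` and `q.2`.
  let A : ℝ → ℕ × ℕ → X := fun y q =>
    ((a * y + b) ^ (q.1 - 1) / (q.1.factorial : ℝ) * (e q.2 * y ^ q.2)) • H (q.1 + 2 * q.2)
  let B : ℝ → ℕ × ℕ → X := fun y q =>
    ((a * y + b) ^ q.1 / (q.1.factorial : ℝ) * (e q.2 * y ^ (q.2 - 1))) • H (q.1 + 2 * q.2)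
  have hbd : ∀ y ∈ Ioo (-(|x| + 1)) (|x| + 1), |a * y + b| ≤ R ∧ |y| ≤ R := by
    intro y hy
    have hy' : |y| ≤ |x| + 1 := abs_le.2 ⟨hy.1.le, hy.2.le⟩
    constructor
    · calc |a * y + b| ≤ |a * y| + |b| := abs_add_le _ _
        _ = |a| * |y| + |b| := by rw [abs_mul]
        _ ≤ |a| * (|x| + 1) + |b| := by gcongr
        _ ≤ R := by rw [hRdef]; linarith [abs_nonneg x]
    · have : 0 ≤ |a| * (|x| + 1) + |b| := by positivity
      rw [hRdef]; linarith
  have hA : ∀ y ∈ Ioo (-(|x| + 1)) (|x| + 1), ∀ q : ℕ × ℕ, ‖(q.1 : ℝ) • A y q‖ ≤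
      (q.1 : ℝ) * R ^ (q.1 - 1) / (q.1.factorial : ℝ) * (|e q.2| * R ^ q.2) * N := by
    intro y hy q
    obtain ⟨h1, h2⟩ := hbd y hy
    simp only [A, norm_smul, Real.norm_eq_abs, abs_mul, abs_div, abs_pow, Nat.abs_cast]
    calc (q.1 : ℝ) * (|a * y + b| ^ (q.1 - 1) / (q.1.factorial : ℝ) * (|e q.2| * |y| ^ q.2)
          * ‖H (q.1 + 2 * q.2)‖)
        ≤ (q.1 : ℝ) * (R ^ (q.1 - 1) / (q.1.factorial : ℝ) * (|e q.2| * R ^ q.2) * N) := by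
          gcongr; exact hH _
      _ = _ := by ring
  have hB : ∀ y ∈ Ioo (-(|x| + 1)) (|x| + 1), ∀ q : ℕ × ℕ, ‖(q.2 : ℝ) • B y q‖ ≤
      R ^ q.1 / (q.1.factorial : ℝ) * (|e q.2| * ((q.2 : ℝ) * R ^ (q.2 - 1))) * N := by
    intro y hy q
    obtain ⟨h1, h2⟩ := hbd y hy
    simp only [B, norm_smul, Real.norm_eq_abs, abs_mul, abs_div, abs_pow, Nat.abs_cast]
    calc (q.2 : ℝ) * (|a * y + b| ^ q.1 / (q.1.factorial : ℝ) * (|e q.2| * |y| ^ (q.2 - 1))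
          * ‖H (q.1 + 2 * q.2)‖)
        ≤ (q.2 : ℝ) * (R ^ q.1 / (q.1.factorial : ℝ) * (|e q.2| * R ^ (q.2 - 1)) * N) := by
          gcongr; exact hH _
      _ = _ := by ring
  have hsA := (summable_fst_mul he hR).mul_right N
  have hsB := (summable_snd_mul he hR).mul_right N
  have hxm : x ∈ Ioo (-(|x| + 1)) (|x| + 1) := by
    constructor <;> linarith [neg_abs_le x, le_abs_self x]
  have key := hasDerivAt_tsum_of_isPreconnected
    (g := fun (q : ℕ × ℕ) y => ((a * y + b) ^ q.1 / (q.1.factorial : ℝ) * (e q.2 * y ^ q.2)) •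
      H (q.1 + 2 * q.2))
    (g' := fun q y => a • (q.1 : ℝ) • A y q + (q.2 : ℝ) • B y q)
    ((hsA.mul_left |a|).add hsB) isOpen_Ioo isPreconnected_Ioo (fun q y hy => ?_)
    (fun q y hy => ?_) hxm (summable_dblTerm he hH _ x) hxm
  · refine HasDerivAt.congr_deriv (f' := _) key ?_
    have sA : Summable fun q => (q.1 : ℝ) • A x q := Summable.of_norm_bounded hsA (hA x hxm)
    have sB : Summable fun q => (q.2 : ℝ) • B x q := Summable.of_norm_bounded hsB (hB x hxm)
    change (∑' n : ℕ × ℕ, (a • (n.1 : ℝ) • A x n + (n.2 : ℝ) • B x n)) = _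
    rw [(sA.const_smul a).tsum_add sB, sA.tsum_const_smul, tsum_shift_fst, tsum_shift_snd]
    congr 1
    · congr 1
      refine tsum_congr fun q => ?_
      simp only [A, smul_smul, Nat.add_sub_cancel, Nat.factorial_succ]
      rw [show q.1 + 1 + 2 * q.2 = q.1 + 2 * q.2 + 1 by ring]
      congr 1
      push_cast
      have : ((q.1 : ℝ) + 1) ≠ 0 := by positivity
      field_simp
    · refine tsum_congr fun q => ?_
      simp only [B, smul_smul, Nat.add_sub_cancel, derivSeq]
      rw [show q.1 + 2 * (q.2 + 1) = q.1 + 2 * q.2 + 2 by ring]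
      congr 1
      ring
  · have h1 : HasDerivAt (fun y : ℝ => a * y + b) a y := by
      simpa using ((hasDerivAt_id y).const_mul a).add_const b
    have h2 := ((h1.pow q.1).div_const (q.1.factorial : ℝ)).mul
      (((hasDerivAt_id y).pow q.2).const_mul (e q.2))
    refine (h2.smul_const (H (q.1 + 2 * q.2))).congr_deriv ?_
    simp only [A, B, smul_smul, ← add_smul, id]
    congr 1
    simp
    ring
  · refine (norm_add_le _ _).trans (add_le_add ?_ (hB y hy q))
    rw [norm_smul, Real.norm_eq_abs]
    exact mul_le_mul_of_nonneg_left (hA y hy q) (abs_nonneg a)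

end dblSeries

/-- For `H m = r ^ m * g` the index `j + 2 k` splits the sum into an exponential series in `c r` and
the power series at `x r²`. With `r = 1 / s` this produces the factors `exp (c / s)` and `E (x /
s²)` of `U_λ`. -/
theorem dblSeries_geometric {e : ℕ → ℝ} (he : EntireSeq e) (r g c x : ℝ) :
    dblSeries e (fun m => r ^ m * g) c x = Real.exp (c * r) * entireSum e (x * r ^ 2) * g := by
  have h1 := (Real.summable_pow_div_factorial |c * r|)
  have h2 := he (x * r ^ 2)
  have h3 : Summable fun q : ℕ × ℕ => ‖(c * r) ^ q.1 / (q.1.factorial : ℝ)‖ *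
      ‖e q.2 * (x * r ^ 2) ^ q.2‖ := by
    refine (summable_exp_mul he (c * r) (x * r ^ 2)).congr fun q => ?_
    simp [abs_mul, abs_pow]
  rw [Real.exp_eq_exp_ℝ, NormedSpace.exp_eq_tsum_div, entireSum,
    tsum_mul_tsum_of_summable_norm (f := fun j : ℕ => (c * r) ^ j / (j.factorial : ℝ))
      (by simpa [abs_mul, abs_div, abs_pow] using h1) (by simpa [abs_mul, abs_pow] using h2),
    ← tsum_mul_right]
  refine tsum_congr fun q => ?_
  simp only [smul_eq_mul]
  ring

theorem map_dblSeries {X : Type*} [NormedAddCommGroup X] [NormedSpace ℝ X] [CompleteSpace X]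
    {e : ℕ → ℝ} (he : EntireSeq e) {H : ℕ → X} {N : ℝ} (hH : ∀ m, ‖H m‖ ≤ N) (L : X →L[ℝ] ℝ)
    (c x : ℝ) : L (dblSeries e H c x) = dblSeries e (fun m => L (H m)) c x := by
  rw [dblSeries, L.map_tsum (summable_dblTerm he hH c x), dblSeries]
  simp

/-- A power series is the double series with constant `H = 1` and `c = 0`, so this is a special case
of `hasDerivAt_dblSeries`. -/
theorem hasDerivAt_entireSum {e : ℕ → ℝ} (he : EntireSeq e) (x : ℝ) :
    HasDerivAt (entireSum e) (entireSum (derivSeq e) x) x := by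
  have h := hasDerivAt_dblSeries he (H := fun _ => (1 : ℝ)) (N := 1) (by simp) 0 0 x
  have h1 : ∀ e : ℕ → ℝ, EntireSeq e → ∀ x, dblSeries e (fun _ => (1 : ℝ)) 0 x = entireSum e x := by
    intro e he x
    have := dblSeries_geometric he 1 1 0 x
    simpa using this
  have h2 : (fun x => dblSeries e (fun _ => (1 : ℝ)) (0 * x + 0) x) = entireSum e := by
    ext x; simp [h1 e he]
  rw [h2] at h
  simpa [h1 _ he.derivSeq] using h

theorem continuous_entireSum {e : ℕ → ℝ} (he : EntireSeq e) : Continuous (entireSum e) :=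
  continuous_iff_continuousAt.2 fun x => (hasDerivAt_entireSum he x).continuousAt

/-! ### Seeds: functions with a known Laplace transform, and their primitives. -/

/-- The function with Laplace transform `s ↦ s ^ (-a)`. -/
noncomputable def gammaPow (a z : ℝ) : ℝ := z ^ (a - 1) / Real.Gamma a

theorem gammaPow_nonneg {a z : ℝ} (ha : 0 < a) (hz : 0 < z) : 0 ≤ gammaPow a z :=
  div_nonneg (rpow_nonneg hz.le _) (Real.Gamma_pos_of_pos ha).le

theorem continuousOn_gammaPow (a : ℝ) : ContinuousOn (gammaPow a) (Ioi 0) := fun z hz =>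
  ((Real.continuousAt_rpow_const z (a - 1) (Or.inl (ne_of_gt hz))).div_const _).continuousWithinAt

theorem integral_exp_mul_gammaPow {a s : ℝ} (ha : 0 < a) (hs : 0 < s) :
    ∫ z in Ioi (0 : ℝ), Real.exp (-(s * z)) * gammaPow a z = s ^ (-a) := by
  have h := Real.integral_rpow_mul_exp_neg_mul_Ioi ha hs
  have hG := (Real.Gamma_pos_of_pos ha).ne'
  calc ∫ z in Ioi (0 : ℝ), Real.exp (-(s * z)) * gammaPow a z
      = ∫ z in Ioi (0 : ℝ), (z ^ (a - 1) * Real.exp (-(s * z))) / Real.Gamma a := by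
        congr 1; ext z; rw [gammaPow]; ring
    _ = s ^ (-a) := by
        rw [integral_div, h, mul_div_assoc, div_self hG, mul_one, one_div, Real.inv_rpow hs.le,
          Real.rpow_neg hs.le]

theorem integrableOn_exp_mul_gammaPow {a s : ℝ} (ha : 0 < a) (hs : 0 < s) :
    IntegrableOn (fun z => Real.exp (-(s * z)) * gammaPow a z) (Ioi 0) := by
  refine Integrable.of_integral_ne_zero ?_
  rw [integral_exp_mul_gammaPow ha hs]
  exact (Real.rpow_pos_of_pos hs _).ne'

theorem intervalIntegrable_gammaPow {a : ℝ} (ha : 0 < a) (u v : ℝ) :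
    IntervalIntegrable (gammaPow a) volume u v :=
  (intervalIntegral.intervalIntegrable_rpow' (by linarith)).div_const _

theorem integral_gammaPow {a z : ℝ} (ha : 0 < a) :
    ∫ w in (0 : ℝ)..z, gammaPow a w = gammaPow (a + 1) z := by
  unfold gammaPow
  rw [intervalIntegral.integral_div, integral_rpow (Or.inl (by linarith)), Real.Gamma_add_one ha.ne']
  have hG := (Real.Gamma_pos_of_pos ha).ne'
  rw [show a - 1 + 1 = a by ring, Real.zero_rpow ha.ne', show a + 1 - 1 = a by ring]
  field_simp
  simp

/-- `h` is continuous on the half-line, dominated by two powers, and has Laplace transform `g`. -/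
structure IsSeed (a b K : ℝ) (h g : ℝ → ℝ) : Prop where
  pos_left : 0 < a
  pos_right : 0 < b
  nonneg : 0 ≤ K
  cont : ContinuousOn h (Ioi 0)
  bound : ∀ z > 0, |h z| ≤ K * (gammaPow a z + gammaPow b z)
  laplace : ∀ s > 0, ∫ z in Ioi (0 : ℝ), Real.exp (-(s * z)) * h z = g s

/-- The primitive of `h` that vanishes at `0`. -/
noncomputable def primitive (h : ℝ → ℝ) (z : ℝ) : ℝ := ∫ w in (0 : ℝ)..z, h w

namespace IsSeed

variable {a b K : ℝ} {h g : ℝ → ℝ}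

theorem integrableOn_exp_mul (H : IsSeed a b K h g) {s : ℝ} (hs : 0 < s) :
    IntegrableOn (fun z => Real.exp (-(s * z)) * h z) (Ioi 0) := by
  have h1 := ((integrableOn_exp_mul_gammaPow H.pos_left hs).add
    (integrableOn_exp_mul_gammaPow H.pos_right hs)).const_mul K
  refine Integrable.mono' h1 ?_ ?_
  · exact ((Continuous.continuousOn (by fun_prop)).mul H.cont).aestronglyMeasurable
      measurableSet_Ioi
  · refine (ae_restrict_iff' measurableSet_Ioi).2 (ae_of_all _ fun z hz => ?_)
    rw [norm_mul, Real.norm_of_nonneg (Real.exp_pos _).le, Real.norm_eq_abs]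
    calc Real.exp (-(s * z)) * |h z|
        ≤ Real.exp (-(s * z)) * (K * (gammaPow a z + gammaPow b z)) :=
          mul_le_mul_of_nonneg_left (H.bound z hz) (Real.exp_pos _).le
      _ = _ := by simp only [Pi.add_apply]; ring

theorem intervalIntegrable (H : IsSeed a b K h g) {z : ℝ} (hz : 0 ≤ z) :
    IntervalIntegrable h volume 0 z := by
  rw [intervalIntegrable_iff_integrableOn_Ioc_of_le hz]
  have h1 := ((intervalIntegrable_gammaPow H.pos_left 0 z).add
    (intervalIntegrable_gammaPow H.pos_right 0 z)).const_mul K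
  rw [intervalIntegrable_iff_integrableOn_Ioc_of_le hz] at h1
  refine Integrable.mono' h1 ?_ ?_
  · exact (H.cont.mono fun w hw => hw.1).aestronglyMeasurable measurableSet_Ioc
  · exact (ae_restrict_iff' measurableSet_Ioc).2 (ae_of_all _ fun w hw => H.bound w hw.1)

theorem hasDerivAt_primitive (H : IsSeed a b K h g) {z : ℝ} (hz : 0 < z) :
    HasDerivAt (primitive h) (h z) z :=
  intervalIntegral.integral_hasDerivAt_right (H.intervalIntegrable hz.le)
    (H.cont.stronglyMeasurableAtFilter isOpen_Ioi z hz) (H.cont.continuousAt (Ioi_mem_nhds hz))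

theorem abs_primitive_le (H : IsSeed a b K h g) {z : ℝ} (hz : 0 ≤ z) :
    |primitive h z| ≤ K * (gammaPow (a + 1) z + gammaPow (b + 1) z) := by
  have ia := intervalIntegrable_gammaPow H.pos_left 0 z
  have ib := intervalIntegrable_gammaPow H.pos_right 0 z
  rw [← integral_gammaPow H.pos_left, ← integral_gammaPow H.pos_right,
    ← intervalIntegral.integral_add ia ib, ← intervalIntegral.integral_const_mul]
  refine intervalIntegral.norm_integral_le_of_norm_le (f := h) (μ := volume) hz ?_
    ((ia.add ib).const_mul K)
  exact ae_of_all _ fun w hw => H.bound w hw.1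

/-- Integration by parts divides the transform by `s`; the boundary terms vanish by the power
bounds. Thanks to the normalisation by `Γ`, a primitive of `gammaPow a` is `gammaPow (a + 1)`, so
the constant `K` does not change and remains the same for all iterates. -/
theorem primitive_isSeed (H : IsSeed a b K h g) :
    IsSeed (a + 1) (b + 1) K (primitive h) (fun s => s⁻¹ * g s) := by
  have hcont : ContinuousOn (primitive h) (Ioi 0) := fun z hz =>
    (H.hasDerivAt_primitive hz).continuousAt.continuousWithinAt
  have hbound : ∀ z > 0, |primitive h z| ≤ K * (gammaPow (a + 1) z + gammaPow (b + 1) z) :=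
    fun z hz => H.abs_primitive_le hz.le
  refine ⟨by linarith [H.pos_left], by linarith [H.pos_right], H.nonneg, hcont, hbound, ?_⟩
  intro s hs
  have hpa := H.pos_left
  have hpb := H.pos_right
  have i1 := H.integrableOn_exp_mul hs
  have i2 : IntegrableOn (fun z => Real.exp (-(s * z)) * primitive h z) (Ioi 0) := by
    have h1 := ((integrableOn_exp_mul_gammaPow (by linarith : 0 < a + 1) hs).add
      (integrableOn_exp_mul_gammaPow (by linarith : 0 < b + 1) hs)).const_mul K
    refine Integrable.mono' h1 ?_ ?_
    · exact ((Continuous.continuousOn (by fun_prop)).mul hcont).aestronglyMeasurable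
        measurableSet_Ioi
    · refine (ae_restrict_iff' measurableSet_Ioi).2 (ae_of_all _ fun z hz => ?_)
      rw [norm_mul, Real.norm_of_nonneg (Real.exp_pos _).le, Real.norm_eq_abs]
      refine (mul_le_mul_of_nonneg_left (hbound z hz) (Real.exp_pos _).le).trans (le_of_eq ?_)
      simp only [Pi.add_apply]; ring
  have hd : ∀ z ∈ Ioi (0 : ℝ), HasDerivAt (fun z => Real.exp (-(s * z)) * primitive h z)
      (Real.exp (-(s * z)) * h z - s * (Real.exp (-(s * z)) * primitive h z)) z := by
    intro z hz
    have h1 : HasDerivAt (fun z => Real.exp (-(s * z))) (Real.exp (-(s * z)) * -(s * 1)) z :=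
      ((hasDerivAt_id z).const_mul s).neg.exp
    refine (h1.mul (H.hasDerivAt_primitive hz)).congr_deriv ?_
    ring
  have hdom : ∀ z ≥ 0, ‖Real.exp (-(s * z)) * primitive h z‖ ≤
      K * (gammaPow (a + 1) z * Real.exp (-(s * z)) + gammaPow (b + 1) z * Real.exp (-(s * z))) := by
    intro z hz
    rw [norm_mul, Real.norm_of_nonneg (Real.exp_pos _).le, Real.norm_eq_abs]
    refine (mul_le_mul_of_nonneg_left (H.abs_primitive_le hz) (Real.exp_pos _).le).trans
      (le_of_eq ?_)
    ring
  have htop : ∀ c > 0, Tendsto (fun z => gammaPow (c + 1) z * Real.exp (-(s * z))) atTop (𝓝 0) := by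
    intro c hc
    have := (tendsto_rpow_mul_exp_neg_mul_atTop_nhds_zero c s hs).div_const (Real.Gamma (c + 1))
    simp only [zero_div] at this
    refine this.congr fun z => ?_
    rw [gammaPow]; ring_nf
  have hzero : ∀ c > 0, ContinuousAt (fun z => gammaPow (c + 1) z * Real.exp (-(s * z))) 0 := by
    intro c hc
    unfold gammaPow
    rw [show c + 1 - 1 = c by ring]
    exact ((Real.continuousAt_rpow_const 0 c (Or.inr hc.le)).div_const _).mul (by fun_prop)
  have hzero' : ∀ c > 0, Tendsto (fun z => gammaPow (c + 1) z * Real.exp (-(s * z)))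
      (𝓝[Ici 0] 0) (𝓝 0) := by
    intro c hc
    have := (hzero c hc).tendsto.mono_left (nhdsWithin_le_nhds (s := Ici 0))
    simpa [gammaPow, Real.zero_rpow hc.ne'] using this
  have hL : Tendsto (fun z => Real.exp (-(s * z)) * primitive h z) (𝓝[Ici 0] 0) (𝓝 0) := by
    refine squeeze_zero_norm' (eventually_mem_nhdsWithin.mono hdom) ?_
    simpa using ((hzero' a hpa).add (hzero' b hpb)).const_mul K
  have hR : Tendsto (fun z => Real.exp (-(s * z)) * primitive h z) atTop (𝓝 0) := by
    refine squeeze_zero_norm' ((eventually_ge_atTop 0).mono hdom) ?_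
    simpa using ((htop a hpa).add (htop b hpb)).const_mul K
  have key := integral_Ioi_of_hasDerivAt_of_tendsto
    (f := fun z => Real.exp (-(s * z)) * primitive h z) (a := 0) (m := 0) ?_ hd
    (i1.sub (i2.const_mul s)) hR
  · rw [integral_sub i1 (i2.const_mul s), integral_const_mul, H.laplace s hs] at key
    have h0 : primitive h 0 = 0 := by simp [primitive]
    rw [h0] at key
    field_simp
    linarith
  · have h0 : primitive h 0 = 0 := by simp [primitive]
    simpa [ContinuousWithinAt, h0] using hL

theorem iterate_primitive (H : IsSeed a b K h g) (m : ℕ) :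
    IsSeed (a + m) (b + m) K (primitive^[m] h) (fun s => s⁻¹ ^ m * g s) := by
  induction m with
  | zero => simpa using H
  | succ m ih =>
    rw [Function.iterate_succ_apply']
    have := ih.primitive_isSeed
    convert this using 1
    · push_cast; ring
    · push_cast; ring
    · ext s; ring

end IsSeed

theorem isSeed_gammaPow {a : ℝ} (ha : 0 < a) : IsSeed a a 1 (gammaPow a) (fun s => s ^ (-a)) where
  pos_left := ha
  pos_right := ha
  nonneg := zero_le_one
  cont := continuousOn_gammaPow a
  bound z hz := by
    have := gammaPow_nonneg ha hz
    rw [abs_of_nonneg this]; linarith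
  laplace s hs := integral_exp_mul_gammaPow ha hs

theorem abs_log_le_rpow {z : ℝ} (hz : 0 < z) :
    |Real.log z| ≤ 2 * (z ^ (-(1 / 2) : ℝ) + z ^ (1 / 2 : ℝ)) := by
  have h1 := Real.log_le_rpow_div hz.le (by norm_num : (0 : ℝ) < 1 / 2)
  have h2 := Real.log_le_rpow_div (inv_pos.2 hz).le (by norm_num : (0 : ℝ) < 1 / 2)
  rw [Real.log_inv, Real.inv_rpow hz.le, ← Real.rpow_neg hz.le] at h2
  have h3 := Real.rpow_pos_of_pos hz (-(1 / 2))
  have h4 := Real.rpow_pos_of_pos hz (1 / 2)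
  rw [abs_le]
  constructor <;> linarith

theorem one_le_rpow_add {z : ℝ} (hz : 0 < z) :
    1 ≤ z ^ (-(1 / 2) : ℝ) + z ^ (1 / 2 : ℝ) := by
  have h3 := Real.rpow_pos_of_pos hz (-(1 / 2))
  have h4 := Real.rpow_pos_of_pos hz (1 / 2)
  have h5 : z ^ (-(1 / 2) : ℝ) * z ^ (1 / 2 : ℝ) = 1 := by
    rw [← Real.rpow_add hz]; norm_num
  nlinarith [sq_nonneg (z ^ (-(1 / 2) : ℝ) - 1), sq_nonneg (z ^ (1 / 2 : ℝ) - 1)]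

/-- The powers `z ^ (-1/2)` and `z ^ (1/2)` dominate the logarithm at `0` and at infinity, and their
sum is at least `1`, which takes care of the constant. This is why `IsSeed` allows two exponents. -/
theorem abs_sub_log_le (C : ℝ) {z : ℝ} (hz : 0 < z) :
    |C - Real.log z| ≤ (|C| + 2) * (Real.Gamma (1 / 2) + Real.Gamma (3 / 2)) *
      (gammaPow (1 / 2) z + gammaPow (3 / 2) z) := by
  have h3 := Real.rpow_pos_of_pos hz (-(1 / 2))
  have h4 := Real.rpow_pos_of_pos hz (1 / 2)
  have g1 := Real.Gamma_pos_of_pos (by norm_num : (0 : ℝ) < 1 / 2)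
  have g2 := Real.Gamma_pos_of_pos (by norm_num : (0 : ℝ) < 3 / 2)
  have e1 : Real.Gamma (1 / 2) * gammaPow (1 / 2) z = z ^ (-(1 / 2) : ℝ) := by
    rw [gammaPow]; norm_num; field_simp
  have e2 : Real.Gamma (3 / 2) * gammaPow (3 / 2) z = z ^ (1 / 2 : ℝ) := by
    rw [gammaPow]; norm_num; field_simp
  have p1 := gammaPow_nonneg (by norm_num : (0 : ℝ) < 1 / 2) hz
  have p2 := gammaPow_nonneg (by norm_num : (0 : ℝ) < 3 / 2) hz
  calc |C - Real.log z| ≤ |C| + |Real.log z| := abs_sub _ _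
    _ ≤ |C| * (z ^ (-(1 / 2) : ℝ) + z ^ (1 / 2 : ℝ)) +
        2 * (z ^ (-(1 / 2) : ℝ) + z ^ (1 / 2 : ℝ)) :=
      add_le_add (le_mul_of_one_le_right (abs_nonneg _) (one_le_rpow_add hz)) (abs_log_le_rpow hz)
    _ = (|C| + 2) * (z ^ (-(1 / 2) : ℝ) + z ^ (1 / 2 : ℝ)) := by ring
    _ ≤ (|C| + 2) * ((Real.Gamma (1 / 2) + Real.Gamma (3 / 2)) *
        (gammaPow (1 / 2) z + gammaPow (3 / 2) z)) := by
      rw [← e1, ← e2]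
      gcongr
      nlinarith [mul_nonneg g1.le p2, mul_nonneg g2.le p1]
    _ = _ := by ring

/-- Substituting `w = s z` turns `log z` into `log w - log s`; the constant `C = ∫ e^{-w} log w dw`
is chosen to cancel what remains. The seed is needed for the logarithmic solution at `ν = 0`. -/
theorem isSeed_log : ∃ C K : ℝ, IsSeed (1 / 2) (3 / 2) K (fun z => C - Real.log z)
    (fun s => s⁻¹ * Real.log s) := by
  set C := ∫ w in Ioi (0 : ℝ), Real.exp (-w) * Real.log w with hC
  have hcont : ∀ c : ℝ, ContinuousOn (fun z => c - Real.log z) (Ioi 0) := fun c =>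
    continuousOn_const.sub (Real.continuousOn_log.mono fun z hz => ne_of_gt hz)
  have hint : ∀ c : ℝ, ∀ s > 0, IntegrableOn (fun z => Real.exp (-(s * z)) * (c - Real.log z))
      (Ioi 0) := by
    intro c s hs
    have h1 := ((integrableOn_exp_mul_gammaPow (by norm_num : (0 : ℝ) < 1 / 2) hs).add
      (integrableOn_exp_mul_gammaPow (by norm_num : (0 : ℝ) < 3 / 2) hs)).const_mul
      ((|c| + 2) * (Real.Gamma (1 / 2) + Real.Gamma (3 / 2)))
    refine Integrable.mono' h1 ?_ ?_
    · exact ((Continuous.continuousOn (by fun_prop)).mul (hcont c)).aestronglyMeasurable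
        measurableSet_Ioi
    · refine (ae_restrict_iff' measurableSet_Ioi).2 (ae_of_all _ fun z hz => ?_)
      rw [norm_mul, Real.norm_of_nonneg (Real.exp_pos _).le, Real.norm_eq_abs]
      refine (mul_le_mul_of_nonneg_left (abs_sub_log_le c hz) (Real.exp_pos _).le).trans
        (le_of_eq ?_)
      simp only [Pi.add_apply]; ring
  refine ⟨C, (|C| + 2) * (Real.Gamma (1 / 2) + Real.Gamma (3 / 2)), by norm_num, by norm_num, ?_,
    hcont C, fun z hz => abs_sub_log_le C hz, ?_⟩
  · have g1 := Real.Gamma_pos_of_pos (by norm_num : (0 : ℝ) < 1 / 2)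
    have g2 := Real.Gamma_pos_of_pos (by norm_num : (0 : ℝ) < 3 / 2)
    positivity
  · intro s hs
    have hexp : ∫ w in Ioi (0 : ℝ), Real.exp (-w) = 1 := by
      simpa using integral_exp_neg_Ioi 0
    have h1 := integral_comp_mul_left_Ioi
      (fun w => Real.exp (-w) * ((C + Real.log s) - Real.log w)) 0 hs
    have h2 : ∫ z in Ioi (0 : ℝ), Real.exp (-(s * z)) * (C - Real.log z) =
        ∫ z in Ioi (0 : ℝ), Real.exp (-(s * z)) * ((C + Real.log s) - Real.log (s * z)) := by
      refine setIntegral_congr_fun measurableSet_Ioi fun z hz => ?_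
      have : Real.log (s * z) = Real.log s + Real.log z := Real.log_mul hs.ne' (ne_of_gt hz)
      simp only [this]; ring
    have i0 : IntegrableOn (fun w => Real.exp (-w)) (Ioi 0) := by
      simpa using integrableOn_exp_neg_Ioi 0
    have il : IntegrableOn (fun w => Real.exp (-w) * Real.log w) (Ioi 0) := by
      have := (hint 0 1 one_pos).neg
      refine this.congr (ae_of_all _ fun z => ?_)
      simp
    rw [h2, h1, mul_zero, smul_eq_mul]
    congr 1
    have h3 : ∀ w : ℝ, Real.exp (-w) * (C + Real.log s - Real.log w) =
        (C + Real.log s) * Real.exp (-w) - Real.exp (-w) * Real.log w := fun w => by ring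
    simp only [h3]
    rw [integral_sub (i0.const_mul _) il, integral_const_mul, hexp, ← hC]
    ring

/-! ### Integrable classes, pairing with bounded functions, and classes of seeds. -/

/-- The integrable functions on the half-line. -/
noncomputable abbrev L1Half := Lp ℝ 1 (volume.restrict (Ioi (0 : ℝ)))

/-- The pairing of an integrable function with a bounded one. -/
noncomputable def pair (k : L1Half) (ψ : ℝ → ℝ) : ℝ := ∫ z in Ioi (0 : ℝ), k z * ψ z

/-- `ψ` is measurable and bounded by `M` on the half-line. -/
structure IsTest (ψ : ℝ → ℝ) (M : ℝ) : Prop where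
  meas : AEStronglyMeasurable ψ (volume.restrict (Ioi (0 : ℝ)))
  bound : ∀ z > 0, |ψ z| ≤ M

namespace IsTest

variable {ψ : ℝ → ℝ} {M : ℝ}

theorem ae_bound (hψ : IsTest ψ M) : ∀ᵐ z ∂(volume.restrict (Ioi (0 : ℝ))), ‖ψ z‖ ≤ M :=
  (ae_restrict_iff' measurableSet_Ioi).2 (ae_of_all _ hψ.bound)

theorem nonneg (hψ : IsTest ψ M) : 0 ≤ M := (abs_nonneg _).trans (hψ.bound 1 one_pos)

theorem integrable_mul (hψ : IsTest ψ M) {k : ℝ → ℝ} (hk : IntegrableOn k (Ioi 0)) :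
    IntegrableOn (fun z => k z * ψ z) (Ioi 0) :=
  Integrable.mul_bdd hk hψ.meas hψ.ae_bound

theorem integrable_pair (hψ : IsTest ψ M) (k : L1Half) :
    IntegrableOn (fun z => k z * ψ z) (Ioi 0) :=
  hψ.integrable_mul (L1.integrable_coeFn k)

theorem abs_pair_le (hψ : IsTest ψ M) (k : L1Half) : |pair k ψ| ≤ M * ‖k‖ := by
  rw [L1.norm_eq_integral_norm, ← integral_const_mul]
  refine norm_integral_le_of_norm_le (f := fun z => k z * ψ z)
    ((L1.integrable_coeFn k).norm.const_mul M) ?_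
  filter_upwards [hψ.ae_bound] with z hz
  rw [norm_mul, mul_comm]
  gcongr

/-- The pairing with a fixed bounded function as a functional. -/
noncomputable def pairCLM (hψ : IsTest ψ M) : L1Half →L[ℝ] ℝ :=
  LinearMap.mkContinuous
    { toFun := fun k => pair k ψ
      map_add' := fun k₁ k₂ => by
        unfold pair
        rw [← integral_add (hψ.integrable_pair k₁) (hψ.integrable_pair k₂)]
        refine integral_congr_ae ?_
        filter_upwards [Lp.coeFn_add k₁ k₂] with z hz
        rw [hz, Pi.add_apply, add_mul]
      map_smul' := fun c k => by
        simp only [pair, RingHom.id_apply, smul_eq_mul]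
        rw [← integral_const_mul]
        refine integral_congr_ae ?_
        filter_upwards [Lp.coeFn_smul c k] with z hz
        rw [hz, Pi.smul_apply, smul_eq_mul, mul_assoc] } M
    (fun k => hψ.abs_pair_le k)

theorem pairCLM_apply (hψ : IsTest ψ M) (k : L1Half) : hψ.pairCLM k = pair k ψ := rfl

end IsTest

theorem isTest_exp {l : ℝ} (hl : 0 ≤ l) : IsTest (fun z => Real.exp (-(l * z))) 1 where
  meas := (by fun_prop : Continuous fun z => Real.exp (-(l * z))).aestronglyMeasurable
  bound z hz := by
    rw [abs_of_pos (Real.exp_pos _), Real.exp_le_one_iff]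
    have := mul_nonneg hl hz.le
    linarith

namespace IsSeed

variable {a b K : ℝ} {h g : ℝ → ℝ}

theorem integrable_exp_iterate (H : IsSeed a b K h g) (m : ℕ) :
    IntegrableOn (fun z => Real.exp (-(1 * z)) * primitive^[m] h z) (Ioi 0) :=
  (H.iterate_primitive m).integrableOn_exp_mul one_pos

/-- The class of `e^{-z}` times the `m`-th iterated primitive of a seed. -/
noncomputable def classes (H : IsSeed a b K h g) (m : ℕ) : L1Half :=
  (H.integrable_exp_iterate m).toL1 _

theorem pair_classes (H : IsSeed a b K h g) (m : ℕ) (ψ : ℝ → ℝ) :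
    pair (H.classes m) ψ =
      ∫ z in Ioi (0 : ℝ), Real.exp (-(1 * z)) * primitive^[m] h z * ψ z := by
  refine integral_congr_ae ?_
  filter_upwards [(H.integrable_exp_iterate m).coeFn_toL1] with z hz
  rw [← hz]; rfl

/-- The weight `e^{-z}` evaluates the transform of the majorant at `s = 1`, where every `gammaPow`
has transform `1`. Hence the bound is independent of `m`, which is what the double series requires.
-/
theorem norm_classes_le (H : IsSeed a b K h g) (m : ℕ) : ‖H.classes m‖ ≤ 2 * K := by
  have Hm := H.iterate_primitive m
  have ia := integrableOn_exp_mul_gammaPow Hm.pos_left one_pos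
  have ib := integrableOn_exp_mul_gammaPow Hm.pos_right one_pos
  have e : ‖H.classes m‖ = ∫ z in Ioi (0 : ℝ), ‖Real.exp (-(1 * z)) * primitive^[m] h z‖ := by
    rw [L1.norm_eq_integral_norm]
    refine integral_congr_ae ?_
    filter_upwards [(H.integrable_exp_iterate m).coeFn_toL1] with z hz
    rw [← hz]; rfl
  rw [e]
  have h2 : ∫ z in Ioi (0 : ℝ), K * ((fun z => Real.exp (-(1 * z)) * gammaPow (a + m) z) z +
      (fun z => Real.exp (-(1 * z)) * gammaPow (b + m) z) z) = 2 * K := by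
    rw [integral_const_mul, integral_add ia ib, integral_exp_mul_gammaPow Hm.pos_left one_pos,
      integral_exp_mul_gammaPow Hm.pos_right one_pos]
    simp; ring
  rw [← h2]
  refine setIntegral_mono_on (H.integrable_exp_iterate m).norm ((ia.add ib).const_mul K)
    measurableSet_Ioi fun z hz => ?_
  rw [norm_mul, Real.norm_of_nonneg (Real.exp_pos _).le, Real.norm_eq_abs]
  refine (mul_le_mul_of_nonneg_left (Hm.bound z hz) (Real.exp_pos _).le).trans (le_of_eq ?_)
  ring

/-- The weight `e^{-z}` moves the transform variable from `l` to `1 + l`, and each primitive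
contributes a factor `(1 + l)⁻¹`: a geometric sequence in `m`, the input of `dblSeries_geometric`.
-/
theorem pair_classes_exp (H : IsSeed a b K h g) (m : ℕ) {l : ℝ} (hl : 0 ≤ l) :
    pair (H.classes m) (fun z => Real.exp (-(l * z))) = (1 + l)⁻¹ ^ m * g (1 + l) := by
  rw [H.pair_classes, ← (H.iterate_primitive m).laplace (1 + l) (by linarith)]
  congr 1
  ext z
  rw [mul_right_comm, ← Real.exp_add]
  ring_nf

end IsSeed

/-! ### Regularity in the space variable. -/

section SpaceC1

variable {X : Type*} [NormedAddCommGroup X] [NormedSpace ℝ X]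

/-- `K'` is the derivative of `K` in the first variable, and both are jointly continuous on the
quadrant. -/
structure SpaceC1 (K K' : ℝ → ℝ → X) : Prop where
  deriv : ∀ x > 0, ∀ t > 0, HasDerivAt (fun x => K x t) (K' x t) x
  cont : ContinuousOn (fun q : ℝ × ℝ => K q.1 q.2) (Ioi 0 ×ˢ Ioi 0)
  cont' : ContinuousOn (fun q : ℝ × ℝ => K' q.1 q.2) (Ioi 0 ×ˢ Ioi 0)

theorem SpaceC1.add {K K' J J' : ℝ → ℝ → X} (hK : SpaceC1 K K') (hJ : SpaceC1 J J') :
    SpaceC1 (fun x t => K x t + J x t) (fun x t => K' x t + J' x t) where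
  deriv x hx t ht := (hK.deriv x hx t ht).add (hJ.deriv x hx t ht)
  cont := hK.cont.add hJ.cont
  cont' := hK.cont'.add hJ.cont'

theorem SpaceC1.smul {b b' : ℝ → ℝ → ℝ} {K K' : ℝ → ℝ → X} (hb : SpaceC1 b b')
    (hK : SpaceC1 K K') :
    SpaceC1 (fun x t => b x t • K x t) (fun x t => b x t • K' x t + b' x t • K x t) where
  deriv x hx t ht := (hb.deriv x hx t ht).smul (hK.deriv x hx t ht)
  cont := hb.cont.smul hK.cont
  cont' := (hb.cont.smul hK.cont').add (hb.cont'.smul hK.cont)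

/-- Twice differentiable in the first variable with jointly continuous derivatives. -/
def SpaceC2 (K : ℝ → ℝ → X) : Prop := ∃ K' K'', SpaceC1 K K' ∧ SpaceC1 K' K''

theorem SpaceC2.add {K J : ℝ → ℝ → X} (hK : SpaceC2 K) (hJ : SpaceC2 J) :
    SpaceC2 (fun x t => K x t + J x t) := by
  obtain ⟨K', K'', h1, h2⟩ := hK
  obtain ⟨J', J'', h3, h4⟩ := hJ
  exact ⟨_, _, h1.add h3, h2.add h4⟩

theorem SpaceC2.smul {b : ℝ → ℝ → ℝ} {K : ℝ → ℝ → X} (hb : SpaceC2 b) (hK : SpaceC2 K) :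
    SpaceC2 (fun x t => b x t • K x t) := by
  obtain ⟨K', K'', h1, h2⟩ := hK
  obtain ⟨b', b'', h3, h4⟩ := hb
  exact ⟨_, _, h3.smul h1, (h3.smul h2).add (h4.smul h1)⟩

end SpaceC1

theorem spaceC2_of_contDiffOn {β : ℝ → ℝ} (hβ : ContDiffOn ℝ 2 β (Ioi 0)) :
    SpaceC2 (fun x (_ : ℝ) => β x) := by
  have h1 : ContDiffOn ℝ 1 (deriv β) (Ioi 0) :=
    ((contDiffOn_succ_iff_deriv_of_isOpen (n := 1) isOpen_Ioi).1
      (hβ.of_le (by norm_num))).2.2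
  have h2 : ContDiffOn ℝ 0 (deriv (deriv β)) (Ioi 0) :=
    ((contDiffOn_succ_iff_deriv_of_isOpen (n := 0) isOpen_Ioi).1
      (h1.of_le (by norm_num))).2.2
  have hc : ∀ γ : ℝ → ℝ, ContinuousOn γ (Ioi 0) →
      ContinuousOn (fun q : ℝ × ℝ => γ q.1) (Ioi 0 ×ˢ Ioi 0) := fun γ hγ =>
    hγ.comp continuousOn_fst fun q hq => hq.1
  refine ⟨fun x _ => deriv β x, fun x _ => deriv (deriv β) x, ⟨fun x hx t _ => ?_, hc _ ?_, hc _ ?_⟩,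
    ⟨fun x hx t _ => ?_, hc _ ?_, hc _ ?_⟩⟩
  · exact ((hβ.differentiableOn (by norm_num)).differentiableAt (Ioi_mem_nhds hx)).hasDerivAt
  · exact hβ.continuousOn
  · exact h1.continuousOn
  · exact ((h1.differentiableOn (by norm_num)).differentiableAt (Ioi_mem_nhds hx)).hasDerivAt
  · exact h1.continuousOn
  · exact h2.continuousOn

theorem continuousOn_inv_snd : ContinuousOn (fun q : ℝ × ℝ => q.2⁻¹) (Ioi 0 ×ˢ Ioi 0) :=
  continuousOn_snd.inv₀ fun _ hq => ne_of_gt hq.2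

theorem continuousOn_shift (A : ℝ) :
    ContinuousOn (fun q : ℝ × ℝ => q.2⁻¹ * q.1 + A * q.2 / 2) (Ioi 0 ×ˢ Ioi 0) :=
  (continuousOn_inv_snd.mul continuousOn_fst).add (Continuous.continuousOn (by fun_prop))

theorem spaceC1_inv : SpaceC1 (fun _ t : ℝ => t⁻¹) (fun _ _ => (0 : ℝ)) where
  deriv x _ t _ := hasDerivAt_const x t⁻¹
  cont := continuousOn_inv_snd
  cont' := continuousOn_const

theorem spaceC2_exp_neg (A : ℝ) :
    SpaceC2 (fun x t : ℝ => Real.exp (-(t⁻¹ * x + A * t / 2))) := by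
  have h0 : ContinuousOn (fun q : ℝ × ℝ => Real.exp (-(q.2⁻¹ * q.1 + A * q.2 / 2)))
      (Ioi 0 ×ˢ Ioi 0) := (continuousOn_shift A).neg.rexp
  have hd : ∀ x t : ℝ, HasDerivAt (fun x => Real.exp (-(t⁻¹ * x + A * t / 2)))
      (-t⁻¹ * Real.exp (-(t⁻¹ * x + A * t / 2))) x := by
    intro x t
    have h1 : HasDerivAt (fun x => -(t⁻¹ * x + A * t / 2)) (-(t⁻¹ * 1)) x :=
      (((hasDerivAt_id x).const_mul t⁻¹).add_const (A * t / 2)).neg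
    refine h1.exp.congr_deriv ?_
    ring
  have hi := continuousOn_inv_snd.neg.mul h0
  refine ⟨fun x t => -t⁻¹ * Real.exp (-(t⁻¹ * x + A * t / 2)),
    fun x t => -t⁻¹ * (-t⁻¹ * Real.exp (-(t⁻¹ * x + A * t / 2))), ⟨fun x _ t _ => hd x t, h0, hi⟩,
    ⟨fun x _ t _ => (hd x t).const_mul _, hi, continuousOn_inv_snd.neg.mul hi⟩⟩

theorem spaceC1_dblSeries {X : Type*} [NormedAddCommGroup X] [NormedSpace ℝ X] [CompleteSpace X]
    (A : ℝ) {e : ℕ → ℝ} (he : EntireSeq e) {H : ℕ → X} {N : ℝ} (hH : ∀ m, ‖H m‖ ≤ N) :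
    SpaceC1 (fun x t => dblSeries e H (t⁻¹ * x + A * t / 2) x)
      (fun x t => t⁻¹ • dblSeries e (fun m => H (m + 1)) (t⁻¹ * x + A * t / 2) x +
        dblSeries (derivSeq e) (fun m => H (m + 2)) (t⁻¹ * x + A * t / 2) x) := by
  have hc : ∀ {e : ℕ → ℝ} (_ : EntireSeq e) {H : ℕ → X} (_ : ∀ m, ‖H m‖ ≤ N),
      ContinuousOn (fun q : ℝ × ℝ => dblSeries e H (q.2⁻¹ * q.1 + A * q.2 / 2) q.1)
        (Ioi 0 ×ˢ Ioi 0) := fun he _ hH =>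
    (continuous_dblSeries he hH).comp_continuousOn ((continuousOn_shift A).prodMk continuousOn_fst)
  exact ⟨fun x _ t _ => hasDerivAt_dblSeries he hH t⁻¹ (A * t / 2) x, hc he hH,
    (continuousOn_inv_snd.smul (hc he fun m => hH (m + 1))).add
      (hc he.derivSeq fun m => hH (m + 2))⟩

theorem spaceC2_dblSeries {X : Type*} [NormedAddCommGroup X] [NormedSpace ℝ X] [CompleteSpace X]
    (A : ℝ) {e : ℕ → ℝ} (he : EntireSeq e) {H : ℕ → X} {N : ℝ} (hH : ∀ m, ‖H m‖ ≤ N) :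
    SpaceC2 (fun x t => dblSeries e H (t⁻¹ * x + A * t / 2) x) :=
  ⟨_, _, spaceC1_dblSeries A he hH,
    (spaceC1_inv.smul (spaceC1_dblSeries A he fun m => hH (m + 1))).add
      (spaceC1_dblSeries A he.derivSeq fun m => hH (m + 2))⟩

theorem EntireSeq.abs {e : ℕ → ℝ} (he : EntireSeq e) : EntireSeq (fun k => |e k|) := fun r => by
  simpa using he r

theorem abs_dblSeries_le {e : ℕ → ℝ} (he : EntireSeq e) {H H' : ℕ → ℝ} {N : ℝ}
    (h : ∀ m, |H m| ≤ H' m) (hN : ∀ m, H' m ≤ N) {c x : ℝ} (hc : 0 ≤ c) (hx : 0 ≤ x) :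
    |dblSeries e H c x| ≤ dblSeries (fun k => |e k|) H' c x := by
  have hH' : ∀ m, ‖H' m‖ ≤ N := fun m => by
    rw [Real.norm_of_nonneg ((abs_nonneg _).trans (h m))]; exact hN m
  rw [← Real.norm_eq_abs]
  refine tsum_of_norm_bounded (summable_dblTerm he.abs hH' c x).hasSum fun q => ?_
  rw [norm_smul, Real.norm_eq_abs, Real.norm_eq_abs, smul_eq_mul]
  refine mul_le_mul (le_of_eq ?_) (h _) (abs_nonneg _) (by positivity)
  rw [abs_mul, abs_div, abs_mul, abs_pow, abs_pow, abs_of_nonneg hc, abs_of_nonneg hx,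
    Nat.abs_cast]

/-- For nonnegative `c` the growth is exactly `exp c`, which the prefactor `exp (-c)` of
`seedKernel` cancels; this makes the kernel bounded uniformly in `t`. -/
theorem norm_dblSeries_le {X : Type*} [NormedAddCommGroup X] [NormedSpace ℝ X]
    {e : ℕ → ℝ} (he : EntireSeq e) {H : ℕ → X} {N : ℝ}
    (hH : ∀ m, ‖H m‖ ≤ N) {c x : ℝ} (hc : 0 ≤ c) (hx : 0 ≤ x) :
    ‖dblSeries e H c x‖ ≤ Real.exp c * entireSum (fun k => |e k|) x * N := by
  have h1 := dblSeries_geometric he.abs 1 N c x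
  simp only [one_pow, one_mul, mul_one] at h1
  rw [← h1]
  have hN : ∀ _ : ℕ, ‖N‖ ≤ N := fun _ =>
    (Real.norm_of_nonneg ((norm_nonneg _).trans (hH 0))).le
  refine tsum_of_norm_bounded (summable_dblTerm he.abs hN c x).hasSum fun q => ?_
  refine (norm_dblTerm_le hH c x q).trans (le_of_eq ?_)
  rw [abs_of_nonneg hc, abs_of_nonneg hx, smul_eq_mul]

/-! ### Kernels with uniform bounds and concentration as `t → 0`. -/

/-- `W l x t` is the Laplace transform, at `l t`, of an integrable kernel that is smooth in `x`,
bounded uniformly in `t`, and concentrates near `x` as `t → 0`. -/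
def HasKernel (W : ℝ → ℝ → ℝ → ℝ) : Prop :=
  ∃ K : ℝ → ℝ → L1Half, SpaceC2 K ∧
    (∀ x > 0, ∀ t > 0, ∀ l ≥ 0, pair (K x t) (fun z => Real.exp (-(l * t * z))) = W l x t) ∧
    (∃ N : ℝ → ℝ, ContinuousOn N (Ioi 0) ∧ ∀ x > 0, ∀ t > 0, ‖K x t‖ ≤ N x) ∧
    ∀ x > 0, ∃ C, ∀ᶠ t in 𝓝[>] (0 : ℝ), ∀ θ : ℝ → ℝ,
      AEStronglyMeasurable θ (volume.restrict (Ioi (0 : ℝ))) →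
      (∀ z > 0, |θ z| ≤ |Real.exp (-(t * z)) - Real.exp (-x)|) → |pair (K x t) θ| ≤ C * √t

theorem isTest_of_abs_le_exp_sub {θ : ℝ → ℝ} {x t : ℝ} (hx : 0 < x) (ht : 0 < t)
    (hm : AEStronglyMeasurable θ (volume.restrict (Ioi (0 : ℝ))))
    (h : ∀ z > 0, |θ z| ≤ |Real.exp (-(t * z)) - Real.exp (-x)|) : IsTest θ 1 := by
  refine ⟨hm, fun z hz => (h z hz).trans ?_⟩
  have h1 : Real.exp (-(t * z)) ≤ 1 := Real.exp_le_one_iff.2 (by nlinarith)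
  have h2 : Real.exp (-x) ≤ 1 := Real.exp_le_one_iff.2 (by linarith)
  rw [abs_le]
  constructor <;> linarith [Real.exp_pos (-(t * z)), Real.exp_pos (-x)]

/-- `Y` may be a combination of two solutions with coefficients of either sign, so its kernel is a
sum of possibly signed kernels. The concentration clause is therefore an estimate on all test
functions below `|e^{-tz} - e^{-x}|`, which is stable under sums without any positivity. -/
theorem HasKernel.add {W V : ℝ → ℝ → ℝ → ℝ} (hW : HasKernel W) (hV : HasKernel V) :
    HasKernel (fun l x t => W l x t + V l x t) := by
  obtain ⟨K, hK, hKW, ⟨N, hN, hKN⟩, hKr⟩ := hW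
  obtain ⟨J, hJ, hJV, ⟨N', hN', hJN⟩, hJr⟩ := hV
  have hadd : ∀ (k j : L1Half) (ψ : ℝ → ℝ) (M : ℝ), IsTest ψ M →
      pair (k + j) ψ = pair k ψ + pair j ψ := fun k j ψ M h => h.pairCLM.map_add k j
  refine ⟨fun x t => K x t + J x t, hK.add hJ, ?_, ⟨fun x => N x + N' x, hN.add hN', ?_⟩, ?_⟩
  · intro x hx t ht l hl
    rw [hadd _ _ _ 1 (isTest_exp (by positivity)), hKW x hx t ht l hl, hJV x hx t ht l hl]
  · exact fun x hx t ht => (norm_add_le _ _).trans (add_le_add (hKN x hx t ht) (hJN x hx t ht))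
  · intro x hx
    obtain ⟨C, hC⟩ := hKr x hx
    obtain ⟨C', hC'⟩ := hJr x hx
    refine ⟨C + C', ?_⟩
    filter_upwards [hC, hC', self_mem_nhdsWithin] with t h1 h2 ht θ hm hθ
    rw [hadd _ _ _ 1 (isTest_of_abs_le_exp_sub hx ht hm hθ), add_mul]
    exact (abs_add_le _ _).trans (add_le_add (h1 θ hm hθ) (h2 θ hm hθ))

theorem HasKernel.congr {W V : ℝ → ℝ → ℝ → ℝ} (hW : HasKernel W)
    (h : ∀ x > 0, ∀ t > 0, ∀ l ≥ 0, W l x t = V l x t) : HasKernel V := by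
  obtain ⟨K, hK, hKW, hN, hr⟩ := hW
  exact ⟨K, hK, fun x hx t ht l hl => (hKW x hx t ht l hl).trans (h x hx t ht l hl), hN, hr⟩

section termKernel

variable {a b K : ℝ} {h g : ℝ → ℝ}

/-- The kernel with Laplace transform `e^{-c + c/s} E(x/s²) g(s)`, where `c = x/t + A t/2`. -/
noncomputable def seedKernel (A : ℝ) (H : IsSeed a b K h g) (e : ℕ → ℝ) (x t : ℝ) : L1Half :=
  Real.exp (-(t⁻¹ * x + A * t / 2)) • dblSeries e H.classes (t⁻¹ * x + A * t / 2) x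

theorem spaceC2_seedKernel (A : ℝ) (H : IsSeed a b K h g) {e : ℕ → ℝ} (he : EntireSeq e) :
    SpaceC2 (seedKernel A H e) :=
  (spaceC2_exp_neg A).smul (spaceC2_dblSeries A he H.norm_classes_le)

theorem pair_seedKernel (A : ℝ) (H : IsSeed a b K h g) {e : ℕ → ℝ} (he : EntireSeq e)
    {ψ : ℝ → ℝ} {M : ℝ} (hψ : IsTest ψ M) (x t : ℝ) :
    pair (seedKernel A H e x t) ψ = Real.exp (-(t⁻¹ * x + A * t / 2)) *
      dblSeries e (fun m => pair (H.classes m) ψ) (t⁻¹ * x + A * t / 2) x := by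
  rw [← hψ.pairCLM_apply, seedKernel, map_smul, map_dblSeries he H.norm_classes_le, smul_eq_mul]
  rfl

/-- The Laplace transform of `seedKernel`. -/
noncomputable def seedTransform (A : ℝ) (e : ℕ → ℝ) (g : ℝ → ℝ) (l x t : ℝ) : ℝ :=
  Real.exp (-(l * (x + A * t ^ 2 / 2)) / (1 + l * t)) * entireSum e (x / (1 + l * t) ^ 2) *
    g (1 + l * t)

/-- With `s = 1 + l t` and `c = x / t + A t / 2` one has `-c + c / s = -l (x + A t² / 2) / s`, the
exponent of `U_λ`. -/
theorem pair_seedKernel_exp (A : ℝ) (H : IsSeed a b K h g) {e : ℕ → ℝ} (he : EntireSeq e)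
    {x t l : ℝ} (ht : 0 < t) (hl : 0 ≤ l) :
    pair (seedKernel A H e x t) (fun z => Real.exp (-(l * t * z))) = seedTransform A e g l x t := by
  have hlt : 0 ≤ l * t := by positivity
  have hs : 1 + l * t ≠ 0 := by positivity
  rw [pair_seedKernel A H he (isTest_exp hlt)]
  simp only [H.pair_classes_exp _ hlt]
  rw [dblSeries_geometric he, seedTransform, ← mul_assoc, ← mul_assoc, ← Real.exp_add]
  congr 3
  · field_simp
    ring
  · rw [inv_pow, div_eq_mul_inv]

theorem norm_seedKernel_le {A : ℝ} (hA : 0 ≤ A) (H : IsSeed a b K h g) {e : ℕ → ℝ}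
    (he : EntireSeq e) {x t : ℝ} (hx : 0 < x) (ht : 0 < t) :
    ‖seedKernel A H e x t‖ ≤ entireSum (fun k => |e k|) x * (2 * K) := by
  have hc : 0 ≤ t⁻¹ * x + A * t / 2 := by positivity
  rw [seedKernel, norm_smul, Real.norm_of_nonneg (Real.exp_pos _).le]
  refine (mul_le_mul_of_nonneg_left (norm_dblSeries_le he H.norm_classes_le hc hx.le)
    (Real.exp_pos _).le).trans (le_of_eq ?_)
  rw [Real.exp_neg]
  field_simp

/-- A majorant of `w = e^{-tz} - e^{-x}`: the arithmetic mean of `√t` and `w² / √t`. -/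
noncomputable def amgmTest (x t z : ℝ) : ℝ :=
  (√t + (Real.exp (-(2 * t * z)) - 2 * Real.exp (-x) * Real.exp (-(1 * t * z)) +
    Real.exp (-x) ^ 2 * Real.exp (-(0 * t * z))) / √t) / 2

theorem abs_le_amgmTest {x t z : ℝ} (ht : 0 < t) :
    |Real.exp (-(t * z)) - Real.exp (-x)| ≤ amgmTest x t z := by
  have hs : 0 < √t := Real.sqrt_pos.2 ht
  have e2 : Real.exp (-(2 * t * z)) = Real.exp (-(t * z)) ^ 2 := by
    rw [← Real.exp_nat_mul]; congr 1; push_cast; ring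
  rw [amgmTest, e2, one_mul, zero_mul, zero_mul, neg_zero, Real.exp_zero, mul_one, le_div_iff₀ two_pos,
    ← sub_le_iff_le_add', le_div_iff₀ hs]
  set w := |Real.exp (-(t * z)) - Real.exp (-x)| with hw
  have hw2 : w ^ 2 = (Real.exp (-(t * z)) - Real.exp (-x)) ^ 2 := sq_abs _
  have hst : √t * √t = √t ^ 2 := by ring
  nlinarith [sq_nonneg (w - √t)]

theorem isTest_amgmTest {x t : ℝ} (ht : 0 < t) :
    IsTest (amgmTest x t) ((√t + (1 + 2 * Real.exp (-x) + Real.exp (-x) ^ 2) / √t) / 2) := by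
  have hs : 0 < √t := Real.sqrt_pos.2 ht
  refine ⟨(by unfold amgmTest; fun_prop : Continuous (amgmTest x t)).aestronglyMeasurable,
    fun z hz => ?_⟩
  rw [abs_of_nonneg ((abs_nonneg _).trans (abs_le_amgmTest ht))]
  unfold amgmTest
  have h1 : Real.exp (-(2 * t * z)) ≤ 1 := Real.exp_le_one_iff.2 (by nlinarith [mul_pos ht hz])
  have h2 := Real.exp_pos (-(1 * t * z))
  have h3 := Real.exp_pos (-x)
  have h4 : Real.exp (-(0 * t * z)) = 1 := by simp
  rw [h4]
  gcongr
  · nlinarith [mul_pos h3 h2]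
  · simp

/-- The square `(e^{-tz} - e^{-x})²` expands into exponentials, so the pairing needs only the
transform at `l = 0, 1, 2`. -/
theorem pair_amgmTest (k : L1Half) {x t : ℝ} (ht : 0 < t) :
    pair k (amgmTest x t) = (√t * pair k (fun z => Real.exp (-(0 * t * z))) +
      (pair k (fun z => Real.exp (-(2 * t * z))) -
        2 * Real.exp (-x) * pair k (fun z => Real.exp (-(1 * t * z))) +
        Real.exp (-x) ^ 2 * pair k (fun z => Real.exp (-(0 * t * z)))) / √t) / 2 := by
  have hs : 0 < √t := Real.sqrt_pos.2 ht
  have i0 := (isTest_exp (by positivity : 0 ≤ 0 * t)).integrable_pair k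
  have i1 := (isTest_exp (by positivity : 0 ≤ 1 * t)).integrable_pair k
  have i2 := (isTest_exp (by positivity : 0 ≤ 2 * t)).integrable_pair k
  have e : ∀ z, k z * amgmTest x t z =
      (√t / 2 + Real.exp (-x) ^ 2 / √t / 2) * (k z * Real.exp (-(0 * t * z))) +
      (1 / √t / 2) * (k z * Real.exp (-(2 * t * z))) +
      (-(Real.exp (-x) / √t)) * (k z * Real.exp (-(1 * t * z))) := by
    intro z
    have h4 : Real.exp (-(0 * t * z)) = 1 := by simp
    rw [amgmTest, h4]
    field_simp
    ring
  have i02 : IntegrableOn (fun z => (√t / 2 + Real.exp (-x) ^ 2 / √t / 2) *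
      (k z * Real.exp (-(0 * t * z))) + (1 / √t / 2) * (k z * Real.exp (-(2 * t * z)))) (Ioi 0) :=
    (i0.const_mul _).add (i2.const_mul _)
  unfold pair
  simp only [e]
  rw [integral_add i02 (i1.const_mul _), integral_add (i0.const_mul _) (i2.const_mul _), integral_const_mul, integral_const_mul,
    integral_const_mul]
  field_simp
  ring

theorem gammaPow_iterate {a : ℝ} (ha : 0 < a) (m : ℕ) {z : ℝ} :
    primitive^[m] (gammaPow a) z = gammaPow (a + m) z := by
  induction m generalizing z with
  | zero => simp
  | succ m ih =>
    rw [Function.iterate_succ_apply']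
    have : primitive^[m] (gammaPow a) = gammaPow (a + m) := funext fun z => ih
    rw [this, primitive, integral_gammaPow (by positivity)]
    push_cast
    ring_nf

/-- A seed lies below a multiple of two powers, and so do its primitives. This replaces a signed
seed by positive ones with explicit transforms. -/
theorem IsSeed.abs_pair_classes_le (H : IsSeed a b K h g) (m : ℕ) {θ ψ : ℝ → ℝ} {M' : ℝ}
    (hψ : IsTest ψ M') (hle : ∀ z > 0, |θ z| ≤ ψ z) :
    |pair (H.classes m) θ| ≤ K * pair ((isSeed_gammaPow H.pos_left).classes m) ψ +
      K * pair ((isSeed_gammaPow H.pos_right).classes m) ψ := by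
  simp only [IsSeed.pair_classes, gammaPow_iterate H.pos_left, gammaPow_iterate H.pos_right]
  have Hm := H.iterate_primitive m
  have ia := hψ.integrable_mul (integrableOn_exp_mul_gammaPow Hm.pos_left one_pos)
  have ib := hψ.integrable_mul (integrableOn_exp_mul_gammaPow Hm.pos_right one_pos)
  rw [← integral_const_mul, ← integral_const_mul, ← integral_add (ia.const_mul K) (ib.const_mul K),
    ← Real.norm_eq_abs]
  refine norm_integral_le_of_norm_le ((ia.const_mul K).add (ib.const_mul K)) ?_
  refine (ae_restrict_iff' measurableSet_Ioi).2 (ae_of_all _ fun z hz => ?_)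
  rw [norm_mul, norm_mul, Real.norm_of_nonneg (Real.exp_pos _).le, Real.norm_eq_abs,
    Real.norm_eq_abs]
  calc Real.exp (-(1 * z)) * |primitive^[m] h z| * |θ z|
      ≤ Real.exp (-(1 * z)) * (K * (gammaPow (a + m) z + gammaPow (b + m) z)) * ψ z := by
        refine mul_le_mul (mul_le_mul_of_nonneg_left (Hm.bound z hz) (Real.exp_pos _).le)
          (hle z hz) (abs_nonneg _) ?_
        exact mul_nonneg (Real.exp_pos _).le (mul_nonneg H.nonneg
          (add_nonneg (gammaPow_nonneg Hm.pos_left hz) (gammaPow_nonneg Hm.pos_right hz)))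
    _ = _ := by ring

/-- Since `c` and `x` are nonnegative, absolute values may be taken term by term. The majorant is
again made of seed kernels, with coefficients `|e k|` and power seeds, so its pairings with
exponentials are known exactly. -/
theorem abs_pair_seedKernel_le {A : ℝ} (hA : 0 ≤ A) (H : IsSeed a b K h g) {e : ℕ → ℝ}
    (he : EntireSeq e) {x t : ℝ} (hx : 0 < x) (ht : 0 < t) {θ ψ : ℝ → ℝ} {M M' : ℝ}
    (hθ : IsTest θ M) (hψ : IsTest ψ M') (hle : ∀ z > 0, |θ z| ≤ ψ z) :
    |pair (seedKernel A H e x t) θ| ≤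
      K * pair (seedKernel A (isSeed_gammaPow H.pos_left) (fun k => |e k|) x t) ψ +
      K * pair (seedKernel A (isSeed_gammaPow H.pos_right) (fun k => |e k|) x t) ψ := by
  have hc : 0 ≤ t⁻¹ * x + A * t / 2 := by positivity
  have hpos : 0 < Real.exp (-(t⁻¹ * x + A * t / 2)) := Real.exp_pos _
  set Sa := (isSeed_gammaPow H.pos_left).classes
  set Sb := (isSeed_gammaPow H.pos_right).classes
  have hna : ∀ m, ‖Sa m‖ ≤ 2 * 1 := (isSeed_gammaPow H.pos_left).norm_classes_le
  have hnb : ∀ m, ‖Sb m‖ ≤ 2 * 1 := (isSeed_gammaPow H.pos_right).norm_classes_le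
  have hlin : ∀ k₁ k₂ : L1Half, K * pair k₁ ψ + K * pair k₂ ψ = pair (K • (k₁ + k₂)) ψ := by
    intro k₁ k₂
    rw [← hψ.pairCLM_apply (K • (k₁ + k₂)), map_smul, map_add, smul_eq_mul, mul_add]
    rfl
  have hb : ∀ m, |pair (H.classes m) θ| ≤ pair (K • (Sa m + Sb m)) ψ := fun m => by
    rw [← hlin]; exact H.abs_pair_classes_le m hψ hle
  have hnab : ∀ m, ‖K • (Sa m + Sb m)‖ ≤ K * (2 * 1 + 2 * 1) := fun m => by
    rw [norm_smul, Real.norm_of_nonneg H.nonneg]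
    exact mul_le_mul_of_nonneg_left ((norm_add_le _ _).trans (add_le_add (hna m) (hnb m))) H.nonneg
  have hN : ∀ m, pair (K • (Sa m + Sb m)) ψ ≤ M' * (K * (2 * 1 + 2 * 1)) := fun m =>
    (le_abs_self _).trans ((hψ.abs_pair_le _).trans
      (mul_le_mul_of_nonneg_left (hnab m) hψ.nonneg))
  have h1 := abs_dblSeries_le he hb hN hc hx.le
  have h2 : dblSeries (fun k => |e k|) (fun m => K • (Sa m + Sb m)) (t⁻¹ * x + A * t / 2) x =
      K • (dblSeries (fun k => |e k|) Sa (t⁻¹ * x + A * t / 2) x +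
        dblSeries (fun k => |e k|) Sb (t⁻¹ * x + A * t / 2) x) := by
    have sa := summable_dblTerm he.abs hna (t⁻¹ * x + A * t / 2) x
    have sb := summable_dblTerm he.abs hnb (t⁻¹ * x + A * t / 2) x
    unfold dblSeries
    rw [← sa.tsum_add sb, ← (sa.add sb).tsum_const_smul]
    refine tsum_congr fun q => ?_
    rw [smul_comm, smul_add, smul_add]
  rw [pair_seedKernel A H he hθ, abs_mul, abs_of_pos hpos, hlin, seedKernel, seedKernel,
    ← smul_add, smul_comm K, ← h2, ← hψ.pairCLM_apply, map_smul, map_dblSeries he.abs hnab,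
    smul_eq_mul]
  exact mul_le_mul_of_nonneg_left h1 hpos.le

/-- At `t = 0` the transform is `e^{-l x} E (x)`, so the combination equals `E (x) (e^{-2x} - 2
e^{-x} e^{-x} + e^{-2x}) = 0`; being differentiable in `t` there, it is `O(t)`. -/
theorem seedTransform_combination_le (A : ℝ) {e : ℕ → ℝ} (he : EntireSeq e) (α x : ℝ) :
    ∃ C, ∀ᶠ t in 𝓝[>] (0 : ℝ), |seedTransform A e (fun s => s ^ (-α)) 2 x t -
      2 * Real.exp (-x) * seedTransform A e (fun s => s ^ (-α)) 1 x t +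
      Real.exp (-x) ^ 2 * seedTransform A e (fun s => s ^ (-α)) 0 x t| ≤ C * t := by
  have hd : ∀ l : ℝ, DifferentiableAt ℝ (fun t => seedTransform A e (fun s => s ^ (-α)) l x t) 0 := by
    intro l
    have h1 : (1 + l * (0 : ℝ)) ≠ 0 := by simp
    have h2 : DifferentiableAt ℝ (fun t : ℝ => 1 + l * t) 0 := by fun_prop
    have h3 : DifferentiableAt ℝ (fun t : ℝ => x / (1 + l * t) ^ 2) 0 :=
      (differentiableAt_const x).div (h2.pow 2) (pow_ne_zero 2 h1)
    have h4 : DifferentiableAt ℝ (fun t : ℝ => entireSum e (x / (1 + l * t) ^ 2)) 0 :=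
      (hasDerivAt_entireSum he _).differentiableAt.comp (0 : ℝ) h3
    have h5 : DifferentiableAt ℝ (fun t : ℝ => Real.exp (-(l * (x + A * t ^ 2 / 2)) / (1 + l * t))) 0 :=
      (DifferentiableAt.div (by fun_prop) h2 h1).exp
    exact (h5.mul h4).mul (h2.rpow_const (Or.inl h1))
  set D := fun t => seedTransform A e (fun s => s ^ (-α)) 2 x t -
      2 * Real.exp (-x) * seedTransform A e (fun s => s ^ (-α)) 1 x t +
      Real.exp (-x) ^ 2 * seedTransform A e (fun s => s ^ (-α)) 0 x t with hD
  have hDd : DifferentiableAt ℝ D 0 := ((hd 2).sub ((hd 1).const_mul _)).add ((hd 0).const_mul _)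
  have hD0 : D 0 = 0 := by
    simp only [hD, seedTransform]
    have : Real.exp (-(2 * x)) = Real.exp (-x) ^ 2 := by
      rw [← Real.exp_nat_mul]; congr 1; push_cast; ring
    simp [this]
    ring
  have hO := hDd.hasDerivAt.isBigO_sub
  obtain ⟨C, hC⟩ := hO.bound
  refine ⟨C, ?_⟩
  filter_upwards [hC.filter_mono nhdsWithin_le_nhds, self_mem_nhdsWithin] with t h1 ht
  rwa [hD0, sub_zero, sub_zero, Real.norm_of_nonneg (le_of_lt ht)] at h1

/-- The two halves of `amgmTest` contribute `√t E (x)` and `O(t) / √t`, both of order `√t`. -/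
theorem pair_seedKernel_amgmTest_le {A : ℝ} {e : ℕ → ℝ} (he : EntireSeq e) {α : ℝ} (hα : 0 < α)
    {x : ℝ} : ∃ C, ∀ᶠ t in 𝓝[>] (0 : ℝ),
      pair (seedKernel A (isSeed_gammaPow hα) e x t) (amgmTest x t) ≤ C * √t := by
  obtain ⟨C, hC⟩ := seedTransform_combination_le A he α x
  refine ⟨(entireSum e x + C) / 2, ?_⟩
  filter_upwards [hC, self_mem_nhdsWithin] with t h1 ht
  have ht : 0 < t := ht
  have hs : 0 < √t := Real.sqrt_pos.2 ht
  rw [pair_amgmTest _ ht, pair_seedKernel_exp A _ he ht (by norm_num),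
    pair_seedKernel_exp A _ he ht (by norm_num), pair_seedKernel_exp A _ he ht (by norm_num)]
  have h0 : seedTransform A e (fun s => s ^ (-α)) 0 x t = entireSum e x := by
    simp [seedTransform]
  have h2 : (seedTransform A e (fun s => s ^ (-α)) 2 x t -
      2 * Real.exp (-x) * seedTransform A e (fun s => s ^ (-α)) 1 x t +
      Real.exp (-x) ^ 2 * seedTransform A e (fun s => s ^ (-α)) 0 x t) / √t ≤ C * √t := by
    rw [div_le_iff₀ hs, mul_assoc C, Real.mul_self_sqrt ht.le]
    exact (le_abs_self _).trans h1
  rw [h0] at h2 ⊢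
  linarith

theorem hasKernel_seedTransform {A : ℝ} (hA : 0 ≤ A) (H : IsSeed a b K h g) {e : ℕ → ℝ}
    (he : EntireSeq e) {β : ℝ → ℝ} (hβ : ContDiffOn ℝ 2 β (Ioi 0)) :
    HasKernel (fun l x t => β x * seedTransform A e g l x t) := by
  have hsmul : ∀ (c : ℝ) (k : L1Half) (ψ : ℝ → ℝ) (M : ℝ), IsTest ψ M →
      pair (c • k) ψ = c * pair k ψ := fun c k ψ M h => h.pairCLM.map_smul c k
  refine ⟨fun x t => β x • seedKernel A H e x t, (spaceC2_of_contDiffOn hβ).smul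
    (spaceC2_seedKernel A H he), ?_, ⟨fun x => |β x| * (entireSum (fun k => |e k|) x * (2 * K)),
      ?_, ?_⟩, ?_⟩
  · intro x hx t ht l hl
    rw [hsmul _ _ _ 1 (isTest_exp (by positivity)), pair_seedKernel_exp A H he ht hl]
  · exact hβ.continuousOn.abs.mul ((continuous_entireSum he.abs).continuousOn.mul continuousOn_const)
  · intro x hx t ht
    rw [norm_smul, Real.norm_eq_abs]
    exact mul_le_mul_of_nonneg_left (norm_seedKernel_le hA H he hx ht) (abs_nonneg _)
  · intro x hx
    obtain ⟨C₁, h₁⟩ := pair_seedKernel_amgmTest_le (A := A) he.abs H.pos_left (x := x)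
    obtain ⟨C₂, h₂⟩ := pair_seedKernel_amgmTest_le (A := A) he.abs H.pos_right (x := x)
    refine ⟨|β x| * (K * C₁ + K * C₂), ?_⟩
    filter_upwards [h₁, h₂, self_mem_nhdsWithin] with t h1 h2 ht θ hm hθ
    have hT := isTest_of_abs_le_exp_sub hx ht hm hθ
    rw [hsmul _ _ _ 1 hT, abs_mul, mul_assoc]
    refine mul_le_mul_of_nonneg_left ?_ (abs_nonneg _)
    refine (abs_pair_seedKernel_le hA H he hx ht hT (isTest_amgmTest ht)
      fun z hz => (hθ z hz).trans (abs_le_amgmTest ht)).trans ?_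
    rw [add_mul, mul_assoc, mul_assoc]
    exact add_le_add (mul_le_mul_of_nonneg_left h1 H.nonneg) (mul_le_mul_of_nonneg_left h2 H.nonneg)

end termKernel

/-! ### Approximation by exponentials and uniqueness of the Laplace transform. -/

/-- `φ` is continuous on the half-line and bounded by `M` there. -/
structure IsBoundedCont (φ : ℝ → ℝ) (M : ℝ) : Prop where
  cont : ContinuousOn φ (Ioi 0)
  bound : ∀ y > 0, |φ y| ≤ M

theorem IsBoundedCont.isTest {φ : ℝ → ℝ} {M : ℝ} (hφ : IsBoundedCont φ M) : IsTest φ M :=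
  ⟨hφ.cont.aestronglyMeasurable measurableSet_Ioi, hφ.bound⟩

theorem IsBoundedCont.comp_mul {φ : ℝ → ℝ} {M : ℝ} (hφ : IsBoundedCont φ M) {t : ℝ} (ht : 0 < t) :
    IsBoundedCont (fun z => φ (t * z)) M :=
  ⟨hφ.cont.comp (by fun_prop) fun _ hz => mul_pos ht hz, fun z hz => hφ.bound _ (mul_pos ht hz)⟩

theorem IsBoundedCont.add {φ ψ : ℝ → ℝ} {M N : ℝ} (hφ : IsBoundedCont φ M)
    (hψ : IsBoundedCont ψ N) : IsBoundedCont (fun y => φ y + ψ y) (M + N) :=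
  ⟨hφ.cont.add hψ.cont, fun y hy => (abs_add_le _ _).trans (add_le_add (hφ.bound y hy) (hψ.bound y hy))⟩

theorem IsBoundedCont.const_mul {φ : ℝ → ℝ} {M : ℝ} (c : ℝ) (hφ : IsBoundedCont φ M) :
    IsBoundedCont (fun y => c * φ y) (|c| * M) :=
  ⟨continuousOn_const.mul hφ.cont, fun y hy => by
    rw [abs_mul]; exact mul_le_mul_of_nonneg_left (hφ.bound y hy) (abs_nonneg c)⟩

theorem isBoundedCont_exp {l : ℝ} (hl : 0 ≤ l) : IsBoundedCont (fun y => Real.exp (-(l * y))) 1 :=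
  ⟨Continuous.continuousOn (by fun_prop), (isTest_exp hl).bound⟩

/-- This is the Weierstrass theorem in the variable `r = e^{-y}`. As `φ (-log r)` need not extend
continuously to `r = 0` and `r = 1`, the variable is first clamped to an interval that exhausts `(0,
1)`; at a fixed `y` the clamp is eventually inactive. -/
theorem exists_polynomial_exp_approx {φ : ℝ → ℝ} {M : ℝ} (hφ : IsBoundedCont φ M) :
    ∃ P : ℕ → Polynomial ℝ, (∀ n, ∀ y > 0, |(P n).eval (Real.exp (-y))| ≤ M + 1) ∧
      ∀ y > 0, Tendsto (fun n => (P n).eval (Real.exp (-y))) atTop (𝓝 (φ y)) := by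
  let lo : ℕ → ℝ := fun n => 1 / ((n : ℝ) + 2)
  have hlo : ∀ n, 0 < lo n := fun n => by positivity
  have hlo2 : ∀ n, lo n ≤ 1 / 2 := fun n => by
    simp only [lo]
    exact one_div_le_one_div_of_le two_pos (by linarith [(Nat.cast_nonneg n : (0 : ℝ) ≤ n)])
  let cl : ℕ → ℝ → ℝ := fun n r => max (lo n) (min r (1 - lo n))
  have hcl0 : ∀ n r, 0 < cl n r := fun n r => lt_max_of_lt_left (hlo n)
  have hcl1 : ∀ n r, cl n r < 1 := fun n r =>
    max_lt (by linarith [hlo2 n]) (lt_of_le_of_lt (min_le_right _ _) (by linarith [hlo n]))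
  let ψ : ℕ → ℝ → ℝ := fun n r => φ (-Real.log (cl n r))
  have hpos : ∀ n r, 0 < -Real.log (cl n r) := fun n r =>
    neg_pos.2 (Real.log_neg (hcl0 n r) (hcl1 n r))
  have hψc : ∀ n, Continuous (ψ n) := fun n => by
    refine hφ.cont.comp_continuous ?_ fun r => hpos n r
    refine (Continuous.log (by fun_prop) fun r => (hcl0 n r).ne').neg
  have hP : ∀ n : ℕ, ∃ p : Polynomial ℝ, ∀ r ∈ Icc (0 : ℝ) 1, |p.eval r - ψ n r| < 1 / ((n : ℝ) + 1) :=
    fun n => exists_polynomial_near_of_continuousOn 0 1 (ψ n) (hψc n).continuousOn _ (by positivity)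
  choose P hP using hP
  have hmem : ∀ y > 0, Real.exp (-y) ∈ Icc (0 : ℝ) 1 := fun y hy =>
    ⟨(Real.exp_pos _).le, Real.exp_le_one_iff.2 (by linarith)⟩
  refine ⟨P, fun n y hy => ?_, fun y hy => ?_⟩
  · have h1 := hP n _ (hmem y hy)
    have h2 : |ψ n (Real.exp (-y))| ≤ M := hφ.bound _ (hpos _ _)
    have h3 : 1 / ((n : ℝ) + 1) ≤ 1 := by
      rw [div_le_one (by positivity)]; linarith [(Nat.cast_nonneg n : (0 : ℝ) ≤ n)]
    have h4 := abs_add_le ((P n).eval (Real.exp (-y)) - ψ n (Real.exp (-y))) (ψ n (Real.exp (-y)))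
    rw [sub_add_cancel] at h4
    linarith
  · have hr0 := Real.exp_pos (-y)
    have hr1 : Real.exp (-y) < 1 := Real.exp_lt_one_iff.2 (by linarith)
    have hlim : Tendsto lo atTop (𝓝 0) := by
      have := (tendsto_const_div_atTop_nhds_zero_nat (1 : ℝ)).comp (tendsto_add_atTop_nat 2)
      refine this.congr fun n => ?_
      simp [lo]
    have hev : ∀ᶠ n in atTop, ψ n (Real.exp (-y)) = φ y := by
      filter_upwards [hlim.eventually (gt_mem_nhds hr0),
        hlim.eventually (gt_mem_nhds (sub_pos.2 hr1))] with n h1 h2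
      have : cl n (Real.exp (-y)) = Real.exp (-y) := by
        simp only [cl]
        rw [min_eq_left (by linarith), max_eq_right h1.le]
      simp only [ψ, this, Real.log_exp, neg_neg]
    have hd : Tendsto (fun n => (P n).eval (Real.exp (-y)) - ψ n (Real.exp (-y))) atTop (𝓝 0) :=
      squeeze_zero_norm (fun n => (hP n _ (hmem y hy)).le) tendsto_one_div_add_atTop_nhds_zero_nat
    have := hd.add_const (φ y)
    rw [zero_add] at this
    refine this.congr' ?_
    filter_upwards [hev] with n hn
    rw [hn]; ring

/-- A property of functions that holds for the exponentials `e^{-ny}` and is stable under linear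
combinations and bounded pointwise limits holds for all bounded continuous functions. -/
theorem IsBoundedCont.induction {p : (ℝ → ℝ) → Prop}
    (hexp : ∀ n : ℕ, p (fun y => Real.exp (-(n * y))))
    (hadd : ∀ φ ψ M N, IsBoundedCont φ M → IsBoundedCont ψ N → p φ → p ψ → p (fun y => φ y + ψ y))
    (hmul : ∀ φ M c, IsBoundedCont φ M → p φ → p (fun y => c * φ y))
    (hlim : ∀ (ψ : ℕ → ℝ → ℝ) (φ : ℝ → ℝ) M, (∀ n, IsBoundedCont (ψ n) M) → IsBoundedCont φ M →
      (∀ y > 0, Tendsto (fun n => ψ n y) atTop (𝓝 (φ y))) → (∀ n, p (ψ n)) → p φ)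
    {φ : ℝ → ℝ} {M : ℝ} (hφ : IsBoundedCont φ M) : p φ := by
  have hpoly : ∀ P : Polynomial ℝ, p (fun y => P.eval (Real.exp (-y))) ∧
      ∃ N, IsBoundedCont (fun y => P.eval (Real.exp (-y))) N := by
    intro P
    induction P using Polynomial.induction_on' with
    | add P Q hP hQ =>
      obtain ⟨h1, N, hN⟩ := hP
      obtain ⟨h2, N', hN'⟩ := hQ
      simp only [Polynomial.eval_add]
      exact ⟨hadd _ _ _ _ hN hN' h1 h2, _, hN.add hN'⟩
    | monomial n a =>
      have e : (fun y => (Polynomial.monomial n a).eval (Real.exp (-y))) =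
          fun y => a * Real.exp (-(n * y)) := by
        ext y
        rw [Polynomial.eval_monomial, ← Real.exp_nat_mul]
        congr 2; ring
      rw [e]
      have hb := isBoundedCont_exp (Nat.cast_nonneg n : (0 : ℝ) ≤ n)
      exact ⟨hmul _ _ a hb (hexp n), _, hb.const_mul a⟩
  obtain ⟨P, hb, ht⟩ := exists_polynomial_exp_approx hφ
  refine hlim (fun n y => (P n).eval (Real.exp (-y))) φ (M + 1) (fun n => ⟨?_, hb n⟩)
    ⟨hφ.cont, fun y hy => (hφ.bound y hy).trans (by linarith)⟩ ht fun n => (hpoly _).1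
  exact Continuous.continuousOn (by fun_prop)

theorem tendsto_integral_mul_of_bounded {k : ℝ → ℝ} (hk : IntegrableOn k (Ioi 0))
    {ψ : ℕ → ℝ → ℝ} {φ : ℝ → ℝ} {M : ℝ} (hψ : ∀ n, IsTest (ψ n) M)
    (h : ∀ y > 0, Tendsto (fun n => ψ n y) atTop (𝓝 (φ y))) :
    Tendsto (fun n => ∫ y in Ioi (0 : ℝ), k y * ψ n y) atTop (𝓝 (∫ y in Ioi (0 : ℝ), k y * φ y)) := by
  refine tendsto_integral_of_dominated_convergence (fun y => M * ‖k y‖)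
    (fun n => ((hψ n).integrable_mul hk).aestronglyMeasurable) (hk.norm.const_mul M)
    (fun n => ?_) ?_
  · filter_upwards [(hψ n).ae_bound] with y hy
    rw [norm_mul, mul_comm]
    gcongr
  · exact (ae_restrict_iff' measurableSet_Ioi).2
      (ae_of_all _ fun y hy => (h y hy).const_mul (k y))

/-- Both sides are continuous under bounded pointwise limits, so agreement at the natural numbers
`n` is enough. -/
theorem integral_mul_eq_of_laplace_eq {k j : ℝ → ℝ} (hk : IntegrableOn k (Ioi 0))
    (hj : IntegrableOn j (Ioi 0))
    (h : ∀ n : ℕ, ∫ y in Ioi (0 : ℝ), k y * Real.exp (-(n * y)) =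
      ∫ y in Ioi (0 : ℝ), j y * Real.exp (-(n * y)))
    {φ : ℝ → ℝ} {M : ℝ} (hφ : IsBoundedCont φ M) :
    ∫ y in Ioi (0 : ℝ), k y * φ y = ∫ y in Ioi (0 : ℝ), j y * φ y := by
  refine hφ.induction (p := fun φ => ∫ y in Ioi (0 : ℝ), k y * φ y = ∫ y in Ioi (0 : ℝ), j y * φ y)
    h ?_ ?_ ?_
  · intro φ ψ M N hφ hψ h1 h2
    simp only [mul_add]
    rw [integral_add (hφ.isTest.integrable_mul hk) (hψ.isTest.integrable_mul hk),
      integral_add (hφ.isTest.integrable_mul hj) (hψ.isTest.integrable_mul hj), h1, h2]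
  · intro φ M c hφ h1
    simp only [mul_left_comm _ c]
    rw [integral_const_mul, integral_const_mul, h1]
  · intro ψ φ M hψ hφ ht h1
    have t1 := tendsto_integral_mul_of_bounded hk (fun n => (hψ n).isTest) ht
    have t2 := tendsto_integral_mul_of_bounded hj (fun n => (hψ n).isTest) ht
    simp only [h1] at t1
    exact tendsto_nhds_unique t1 t2

/-- Uniqueness for the Laplace transform of continuous functions. -/
theorem eq_zero_of_laplace_eq_zero {D : ℝ → ℝ} (hc : ContinuousOn D (Ioi 0))
    (hi : IntegrableOn (fun t => Real.exp (-t) * D t) (Ioi 0))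
    (h : ∀ p : ℝ, 1 ≤ p → ∫ t in Ioi (0 : ℝ), Real.exp (-(p * t)) * D t = 0) {t : ℝ} (ht : 0 < t) :
    D t = 0 := by
  -- The bounded function `D / (1 + D²)` has the sign of `D`, so pairing it with `D` gives an
  -- integral of a nonnegative function that vanishes.
  have hφ : IsBoundedCont (fun t => D t / (1 + D t ^ 2)) 1 := by
    refine ⟨hc.div (continuousOn_const.add (hc.pow 2)) fun y _ => by positivity, fun y _ => ?_⟩
    rw [abs_div, abs_of_pos (by positivity : 0 < 1 + D y ^ 2), div_le_one (by positivity)]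
    nlinarith [sq_nonneg (|D y| - 1), sq_abs (D y)]
  have h0 : ∀ n : ℕ, ∫ y in Ioi (0 : ℝ), (Real.exp (-y) * D y) * Real.exp (-(n * y)) =
      ∫ y in Ioi (0 : ℝ), (fun _ => (0 : ℝ)) y * Real.exp (-(n * y)) := by
    intro n
    have := h (n + 1) (by linarith [(Nat.cast_nonneg n : (0 : ℝ) ≤ n)])
    simp only [zero_mul, integral_zero]
    refine Eq.trans ?_ this
    refine integral_congr_ae (ae_of_all _ fun y => ?_)
    simp only
    rw [mul_right_comm, ← Real.exp_add]
    ring_nf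
  have h1 : ∫ y in Ioi (0 : ℝ), Real.exp (-y) * D y * (D y / (1 + D y ^ 2)) = 0 := by
    refine (integral_mul_eq_of_laplace_eq hi (integrable_zero _ _ _) h0 hφ).trans ?_
    simp
  have hnn : ∀ y, 0 ≤ Real.exp (-y) * D y * (D y / (1 + D y ^ 2)) := fun y => by
    have : Real.exp (-y) * D y * (D y / (1 + D y ^ 2)) = Real.exp (-y) * (D y ^ 2 / (1 + D y ^ 2)) := by
      ring
    rw [this]; positivity
  rw [integral_eq_zero_iff_of_nonneg hnn (hφ.isTest.integrable_mul hi)] at h1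
  have hcont : ContinuousOn (fun y => Real.exp (-y) * D y * (D y / (1 + D y ^ 2))) (Ioi 0) :=
    ((Continuous.continuousOn (by fun_prop)).mul hc).mul hφ.cont
  have h2 := Measure.eqOn_open_of_ae_eq h1 isOpen_Ioi hcont continuousOn_const ht
  simp only [Pi.zero_apply] at h2
  have h3 := (Real.exp_pos (-t)).ne'
  have h4 : (1 + D t ^ 2) ≠ 0 := by positivity
  simpa [h3, h4] using h2

/-- The change of `K` is controlled in `L¹` norm by the bound on `φ`, while the dilation `φ (t z)`
is treated against the fixed class `K x₀ t₀` by dominated convergence; uniform continuity of `φ` is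
not available. -/
theorem IsTest.continuousOn_pair {φ : ℝ → ℝ} {M : ℝ} (hφ : IsBoundedCont φ M)
    {K : ℝ → ℝ → L1Half} (hK : ContinuousOn (fun q : ℝ × ℝ => K q.1 q.2) (Ioi 0 ×ˢ Ioi 0)) :
    ContinuousOn (fun q : ℝ × ℝ => pair (K q.1 q.2) (fun z => φ (q.2 * z))) (Ioi 0 ×ˢ Ioi 0) := by
  rintro ⟨x₀, t₀⟩ ⟨hx₀, ht₀⟩
  have hsub : ∀ (k j : L1Half) (ψ : ℝ → ℝ), IsTest ψ M → pair (k - j) ψ = pair k ψ - pair j ψ :=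
    fun k j ψ h => h.pairCLM.map_sub k j
  have h1 : Tendsto (fun q : ℝ × ℝ => pair (K q.1 q.2 - K x₀ t₀) (fun z => φ (q.2 * z)))
      (𝓝[Ioi 0 ×ˢ Ioi 0] (x₀, t₀)) (𝓝 0) := by
    have h2 : Tendsto (fun q : ℝ × ℝ => M * ‖K q.1 q.2 - K x₀ t₀‖) (𝓝[Ioi 0 ×ˢ Ioi 0] (x₀, t₀))
        (𝓝 0) := by
      have := (hK (x₀, t₀) ⟨hx₀, ht₀⟩).tendsto.sub_const (K x₀ t₀)
      simpa using this.norm.const_mul M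
    refine squeeze_zero_norm' ?_ h2
    filter_upwards [self_mem_nhdsWithin] with q hq
    exact (hφ.comp_mul hq.2).isTest.abs_pair_le _
  have h3 : Tendsto (fun q : ℝ × ℝ => pair (K x₀ t₀) (fun z => φ (q.2 * z)))
      (𝓝[Ioi 0 ×ˢ Ioi 0] (x₀, t₀)) (𝓝 (pair (K x₀ t₀) (fun z => φ (t₀ * z)))) := by
    have hk := L1.integrable_coeFn (K x₀ t₀)
    refine tendsto_integral_filter_of_dominated_convergence (fun y => M * ‖(K x₀ t₀) y‖) ?_ ?_
      (hk.norm.const_mul M) ?_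
    · filter_upwards [self_mem_nhdsWithin] with q hq
      exact ((hφ.comp_mul hq.2).isTest.integrable_mul hk).aestronglyMeasurable
    · filter_upwards [self_mem_nhdsWithin] with q hq
      filter_upwards [(hφ.comp_mul hq.2).isTest.ae_bound] with y hy
      rw [norm_mul, mul_comm]
      gcongr
    · refine (ae_restrict_iff' measurableSet_Ioi).2 (ae_of_all _ fun z hz => ?_)
      have hc : ContinuousAt φ (t₀ * z) := hφ.cont.continuousAt (Ioi_mem_nhds (mul_pos ht₀ hz))
      have ht : Tendsto (fun q : ℝ × ℝ => q.2 * z) (𝓝[Ioi 0 ×ˢ Ioi 0] (x₀, t₀)) (𝓝 (t₀ * z)) :=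
        ((continuous_snd.mul continuous_const).tendsto (x₀, t₀)).mono_left nhdsWithin_le_nhds
      exact (hc.tendsto.comp ht).const_mul _
  have h4 := h1.add h3
  rw [zero_add] at h4
  refine h4.congr' ?_
  filter_upwards [self_mem_nhdsWithin] with q hq
  rw [hsub _ _ _ (hφ.comp_mul hq.2).isTest]
  ring

theorem SpaceC1.pair {φ : ℝ → ℝ} {M : ℝ} (hφ : IsBoundedCont φ M) {K K' : ℝ → ℝ → L1Half}
    (hK : SpaceC1 K K') :
    SpaceC1 (fun x t => pair (K x t) (fun z => φ (t * z)))
      (fun x t => _root_.pair (K' x t) (fun z => φ (t * z))) where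
  deriv x hx t ht :=
    (hφ.comp_mul ht).isTest.pairCLM.hasFDerivAt.comp_hasDerivAt x (hK.deriv x hx t ht)
  cont := IsTest.continuousOn_pair hφ hK.cont
  cont' := IsTest.continuousOn_pair hφ hK.cont'

theorem ContinuousOn.slice_snd {X : Type*} [TopologicalSpace X] {K : ℝ → ℝ → X}
    (hK : ContinuousOn (fun q : ℝ × ℝ => K q.1 q.2) (Ioi 0 ×ˢ Ioi 0)) {x : ℝ} (hx : 0 < x) :
    ContinuousOn (fun t => K x t) (Ioi 0) :=
  hK.comp (f := fun t => (x, t)) (Continuous.continuousOn (by fun_prop)) fun _ ht => ⟨hx, ht⟩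

theorem ContinuousOn.slice_fst {X : Type*} [TopologicalSpace X] {K : ℝ → ℝ → X}
    (hK : ContinuousOn (fun q : ℝ × ℝ => K q.1 q.2) (Ioi 0 ×ˢ Ioi 0)) {t : ℝ} (ht : 0 < t) :
    ContinuousOn (fun x => K x t) (Ioi 0) :=
  hK.comp (f := fun x => (x, t)) (Continuous.continuousOn (by fun_prop)) fun _ hx => ⟨hx, ht⟩

theorem SpaceC1.continuousOn_operator {v v' : ℝ → ℝ → ℝ} (h : SpaceC1 v v') {x : ℝ} (hx : 0 < x)
    (c d : ℝ) : ContinuousOn (fun t => c * v' x t + d * v x t) (Ioi 0) :=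
  (continuousOn_const.mul (h.cont'.slice_snd hx)).add (continuousOn_const.mul (h.cont.slice_snd hx))

theorem intervalIntegrable_of_continuousOn_Ioi {g : ℝ → ℝ} (hg : ContinuousOn g (Ioi 0)) {a b : ℝ}
    (ha : 0 < a) (hb : 0 < b) : IntervalIntegrable g volume a b :=
  (hg.mono fun _ hx => lt_of_lt_of_le (lt_min ha hb) hx.1).intervalIntegrable

/-! ### The parabolic problem for bounded data. -/

/-- `u` solves `u_t = x u_xx + f(x) u_x` on the quadrant, with derivatives `u₁ = u_x`, `u₂ = u_xx`,
and attains the initial value `φ` at the rate `√t`. -/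
structure IsParabolic (f φ : ℝ → ℝ) (u u₁ u₂ : ℝ → ℝ → ℝ) : Prop where
  space₁ : SpaceC1 u u₁
  space₂ : SpaceC1 u₁ u₂
  time : ∀ x > 0, ∀ t > 0, HasDerivAt (u x) (x * u₂ x t + f x * u₁ x t) t
  bound : ∃ N : ℝ → ℝ, ContinuousOn N (Ioi 0) ∧ ∀ x > 0, ∀ t > 0, |u x t| ≤ N x
  rate : ∀ x > 0, ∃ C, ∀ t > 0, |u x t - φ x| ≤ C * √t

/-- For every `l`, the function `W l` solves `w_t = x w_xx + f(x) w_x` on the quadrant. -/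
def IsSolutionFamily (f : ℝ → ℝ) (W : ℝ → ℝ → ℝ → ℝ) : Prop :=
  ∀ l ≥ 0, ∃ W₁ W₂ : ℝ → ℝ → ℝ, ∀ x > 0, ∀ t > 0,
    HasDerivAt (fun x => W l x t) (W₁ x t) x ∧ HasDerivAt (fun x => W₁ x t) (W₂ x t) x ∧
      HasDerivAt (fun t => W l x t) (x * W₂ x t + f x * W₁ x t) t

theorem hasDerivAt_unique_of_pos {u v u' v' : ℝ → ℝ} {x : ℝ} (hx : 0 < x)
    (h : ∀ x > 0, u x = v x) (hu : HasDerivAt u (u' x) x) (hv : HasDerivAt v (v' x) x) :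
    u' x = v' x :=
  hu.unique (hv.congr_of_eventuallyEq ((eventually_gt_nhds hx).mono fun y hy => h y hy))

/-- Pointwise limits do not preserve a time derivative, but they preserve the equation integrated
over `[a, b]`, by dominated convergence with the `L¹` norms of `K₁` and `K₂` as majorants. The
equation holds for the exponentials `e^{-n y}` because their pairings are the functions `W n`. -/
theorem integrated_equation {f : ℝ → ℝ} {W : ℝ → ℝ → ℝ → ℝ} (hW : IsSolutionFamily f W)
    {K K₁ K₂ : ℝ → ℝ → L1Half} (h₁ : SpaceC1 K K₁) (h₂ : SpaceC1 K₁ K₂)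
    (hKW : ∀ x > 0, ∀ t > 0, ∀ l ≥ 0, pair (K x t) (fun z => Real.exp (-(l * t * z))) = W l x t)
    {φ : ℝ → ℝ} {M : ℝ} (hφ : IsBoundedCont φ M) {x a b : ℝ} (hx : 0 < x) (ha : 0 < a)
    (hb : 0 < b) :
    pair (K x b) (fun z => φ (b * z)) - pair (K x a) (fun z => φ (a * z)) =
      ∫ t in a..b, (x * pair (K₂ x t) (fun z => φ (t * z)) +
        f x * pair (K₁ x t) (fun z => φ (t * z))) := by
  have hadd : ∀ (k : L1Half) (φ ψ : ℝ → ℝ) (M N : ℝ), IsTest φ M → IsTest ψ N →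
      pair k (fun z => φ z + ψ z) = pair k φ + pair k ψ := by
    intro k φ ψ M N h1 h2
    unfold pair
    rw [← integral_add (h1.integrable_pair k) (h2.integrable_pair k)]
    simp only [mul_add]
  have hmul : ∀ (k : L1Half) (φ : ℝ → ℝ) (c : ℝ), pair k (fun z => c * φ z) = c * pair k φ := by
    intro k φ c
    unfold pair
    rw [← integral_const_mul]
    simp only [mul_left_comm]
  have hcont : ∀ {φ : ℝ → ℝ} {M : ℝ}, IsBoundedCont φ M → ContinuousOn (fun t =>
      x * pair (K₂ x t) (fun z => φ (t * z)) + f x * pair (K₁ x t) (fun z => φ (t * z)))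
      (Ioi 0) := fun hφ => (h₂.pair hφ).continuousOn_operator hx x (f x)
  refine hφ.induction (p := fun φ =>
    pair (K x b) (fun z => φ (b * z)) - pair (K x a) (fun z => φ (a * z)) =
      ∫ t in a..b, (x * pair (K₂ x t) (fun z => φ (t * z)) +
        f x * pair (K₁ x t) (fun z => φ (t * z)))) ?_ ?_ ?_ ?_
  · intro n
    obtain ⟨W₁, W₂, hd⟩ := hW n n.cast_nonneg
    have hφ := isBoundedCont_exp (Nat.cast_nonneg n : (0 : ℝ) ≤ n)
    have e0 : ∀ y > 0, ∀ t > 0, pair (K y t) (fun z => Real.exp (-(n * (t * z)))) = W n y t := by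
      intro y hy t ht
      rw [← hKW y hy t ht n n.cast_nonneg]
      simp only [mul_assoc]
    -- The kernel's `x`-derivatives paired with the exponential are the `x`-derivatives of `W n`,
    -- since the pairing and `W n` agree on the quadrant.
    have e1 : ∀ y > 0, ∀ t > 0, pair (K₁ y t) (fun z => Real.exp (-(n * (t * z)))) = W₁ y t :=
      fun y hy t ht => hasDerivAt_unique_of_pos (u' := fun y => _) (v' := fun y => W₁ y t) hy
        (fun y hy => e0 y hy t ht) ((h₁.pair hφ).deriv y hy t ht) (hd y hy t ht).1
    have e2 : ∀ y > 0, ∀ t > 0, pair (K₂ y t) (fun z => Real.exp (-(n * (t * z)))) = W₂ y t :=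
      fun y hy t ht => hasDerivAt_unique_of_pos (u' := fun y => _) (v' := fun y => W₂ y t) hy
        (fun y hy => e1 y hy t ht) ((h₂.pair hφ).deriv y hy t ht) (hd y hy t ht).2.1
    rw [e0 x hx b hb, e0 x hx a ha]
    refine (intervalIntegral.integral_eq_sub_of_hasDerivAt (fun t ht => ?_)
      (intervalIntegrable_of_continuousOn_Ioi (hcont hφ) ha hb)).symm
    have ht : 0 < t := lt_of_lt_of_le (lt_min ha hb) ht.1
    rw [e1 x hx t ht, e2 x hx t ht]
    exact (hd x hx t ht).2.2
  · intro φ ψ M N hφ hψ h1 h2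
    have hs : ∀ t > 0, ∀ k : L1Half, pair k (fun z => φ (t * z) + ψ (t * z)) =
        pair k (fun z => φ (t * z)) + pair k (fun z => ψ (t * z)) := fun t ht k =>
      hadd k _ _ M N (hφ.comp_mul ht).isTest (hψ.comp_mul ht).isTest
    rw [hs b hb, hs a ha, add_sub_add_comm, h1, h2, ← intervalIntegral.integral_add
      (intervalIntegrable_of_continuousOn_Ioi (hcont hφ) ha hb)
      (intervalIntegrable_of_continuousOn_Ioi (hcont hψ) ha hb)]
    refine intervalIntegral.integral_congr fun t ht => ?_
    have ht : 0 < t := lt_of_lt_of_le (lt_min ha hb) ht.1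
    simp only [hs t ht]
    ring
  · intro φ M c hφ h1
    simp only [hmul]
    rw [← mul_sub, h1, ← intervalIntegral.integral_const_mul]
    refine intervalIntegral.integral_congr fun t ht => ?_
    ring
  · intro ψ φ M hψ hφ hlim h1
    have hp : ∀ (k : L1Half) (t : ℝ), 0 < t → Tendsto (fun n => pair k (fun z => ψ n (t * z))) atTop
        (𝓝 (pair k (fun z => φ (t * z)))) := fun k t ht =>
      tendsto_integral_mul_of_bounded (L1.integrable_coeFn k)
        (fun n => ((hψ n).comp_mul ht).isTest) fun z hz => hlim _ (mul_pos ht hz)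
    have t1 := (hp (K x b) b hb).sub (hp (K x a) a ha)
    refine tendsto_nhds_unique t1 ?_
    simp only [h1]
    have hc1 : ContinuousOn (fun t => |x| * (M * ‖K₂ x t‖) + |f x| * (M * ‖K₁ x t‖)) (Ioi 0) :=
      (continuousOn_const.mul (continuousOn_const.mul (h₂.cont'.slice_snd hx).norm)).add
        (continuousOn_const.mul (continuousOn_const.mul (h₂.cont.slice_snd hx).norm))
    have hpos : ∀ t ∈ uIoc a b, 0 < t := fun t ht => lt_of_lt_of_le (lt_min ha hb) ht.1.le
    refine intervalIntegral.tendsto_integral_filter_of_dominated_convergence _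
      (Eventually.of_forall fun n => ?_) (Eventually.of_forall fun n => ?_)
      (intervalIntegrable_of_continuousOn_Ioi hc1 ha hb) ?_
    · exact ((hcont (hψ n)).mono hpos).aestronglyMeasurable measurableSet_uIoc
    · refine ae_of_all _ fun t ht => ?_
      have hT := ((hψ n).comp_mul (hpos t ht)).isTest
      refine (norm_add_le _ _).trans (add_le_add ?_ ?_) <;> rw [norm_mul, Real.norm_eq_abs] <;>
        exact mul_le_mul_of_nonneg_left (hT.abs_pair_le _) (abs_nonneg _)
    · exact ae_of_all _ fun t ht =>
        ((hp _ t (hpos t ht)).const_mul x).add ((hp _ t (hpos t ht)).const_mul (f x))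

/-- Near `x` the map `y ↦ e^{-y}` has nonzero derivative, so `φ y - φ x = O(|y - x|)` is also
`O(|e^{-y} - e^{-x}|)`; away from `x` the right side is bounded below and `φ` is bounded. This
brings `φ` into the form required by the concentration clause of `HasKernel`. -/
theorem abs_sub_le_exp_sub {φ : ℝ → ℝ} {M : ℝ} (hφ : ∀ y > 0, |φ y| ≤ M) {x : ℝ} (hx : 0 < x)
    (hd : DifferentiableAt ℝ φ x) :
    ∃ C > 0, ∀ y > 0, |φ y - φ x| ≤ C * |Real.exp (-y) - Real.exp (-x)| := by
  have h1 := hd.hasDerivAt.isBigO_sub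
  have he : HasDerivAt (fun y => Real.exp (-y)) (Real.exp (-x) * -1) x :=
    (hasDerivAt_id x).neg.exp
  have h2 := (HasDerivAtFilter.isTheta_sub he (by simp)).isBigO_symm
  have h2' : (fun y => y - x) =O[𝓝 x] fun y => Real.exp (-y) - Real.exp (-x) := by
    have hp : Tendsto (fun y => (y, x)) (𝓝 x) (𝓝 x ×ˢ pure x) :=
      tendsto_id.prodMk tendsto_const_pure
    exact h2.comp_tendsto hp
  obtain ⟨C, hC⟩ := (h1.trans h2').bound
  obtain ⟨δ, hδ, hball⟩ := Metric.eventually_nhds_iff.1 hC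
  have hM : 0 ≤ M := (abs_nonneg _).trans (hφ x hx)
  -- By monotonicity, `m` bounds `|e^{-y} - e^{-x}|` from below whenever `|y - x| ≥ δ`.
  set m := min (Real.exp (-x) - Real.exp (-(x + δ))) (Real.exp (-(x - δ)) - Real.exp (-x))
  have hm : 0 < m := lt_min (sub_pos.2 (Real.exp_lt_exp.2 (by linarith)))
    (sub_pos.2 (Real.exp_lt_exp.2 (by linarith)))
  refine ⟨|C| + 2 * M / m + 1, by positivity, fun y hy => ?_⟩
  have hw := abs_nonneg (Real.exp (-y) - Real.exp (-x))
  by_cases hyx : dist y x < δ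
  · have h3 := hball hyx
    rw [Real.norm_eq_abs, Real.norm_eq_abs] at h3
    refine h3.trans (mul_le_mul_of_nonneg_right ?_ hw)
    have : 0 ≤ 2 * M / m := by positivity
    linarith [le_abs_self C]
  · rw [Real.dist_eq, not_lt] at hyx
    have h4 : m ≤ |Real.exp (-y) - Real.exp (-x)| := by
      rcases le_abs.1 hyx with h | h
      · refine (min_le_left _ _).trans ?_
        have : Real.exp (-y) ≤ Real.exp (-(x + δ)) := Real.exp_le_exp.2 (by linarith)
        exact (by linarith : _ ≤ -(Real.exp (-y) - Real.exp (-x))).trans (neg_le_abs _)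
      · refine (min_le_right _ _).trans ?_
        have : Real.exp (-(x - δ)) ≤ Real.exp (-y) := Real.exp_le_exp.2 (by linarith)
        exact (by linarith : _ ≤ (Real.exp (-y) - Real.exp (-x))).trans (le_abs_self _)
    have h5 : |φ y - φ x| ≤ 2 * M := by
      have := abs_sub (φ y) (φ x)
      linarith [hφ y hy, hφ x hx]
    calc |φ y - φ x| ≤ 2 * M := h5
      _ = 2 * M / m * m := by field_simp
      _ ≤ (|C| + 2 * M / m + 1) * m := by
        refine mul_le_mul_of_nonneg_right ?_ hm.le
        linarith [abs_nonneg C]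
      _ ≤ _ := mul_le_mul_of_nonneg_left h4 (by positivity)

/-- The time derivative comes from `integrated_equation` and the fundamental theorem of calculus,
the rate from concentration for small `t` and from boundedness for large `t`. The last clause holds
because the rescaled kernel has the same transform as any given inverse `k`. -/
theorem HasKernel.exists_parabolic {f : ℝ → ℝ} {W : ℝ → ℝ → ℝ → ℝ} (hK : HasKernel W)
    (hW : IsSolutionFamily f W) (hW0 : ∀ x > 0, ∀ t > 0, W 0 x t = 1) {φ : ℝ → ℝ} {M : ℝ}
    (hφ : IsBoundedCont φ M) (hd : ∀ x > 0, DifferentiableAt ℝ φ x) :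
    ∃ u u₁ u₂, IsParabolic f φ u u₁ u₂ ∧
      ∀ k : ℝ → ℝ, ∀ x > 0, ∀ t > 0, IsInverseLaplace (fun l => W l x t) k →
        ∫ y in Ioi (0 : ℝ), k y * φ y = u x t := by
  obtain ⟨K, ⟨K₁, K₂, h₁, h₂⟩, hKW, ⟨N, hN, hKN⟩, hr⟩ := hK
  have hM : 0 ≤ M := hφ.isTest.nonneg
  refine ⟨_, _, _, ⟨h₁.pair hφ, h₂.pair hφ, ?_, ⟨fun x => M * N x, continuousOn_const.mul hN, ?_⟩,
    ?_⟩, ?_⟩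
  · intro x hx t ht
    have hcont : ContinuousOn (fun t => x * pair (K₂ x t) (fun z => φ (t * z)) +
        f x * pair (K₁ x t) (fun z => φ (t * z))) (Ioi 0) :=
      (h₂.pair hφ).continuousOn_operator hx x (f x)
    have h := intervalIntegral.integral_hasDerivAt_right
      (intervalIntegrable_of_continuousOn_Ioi hcont ht ht)
      (hcont.stronglyMeasurableAtFilter isOpen_Ioi t ht) (hcont.continuousAt (Ioi_mem_nhds ht))
    refine (h.const_add (pair (K x t) (fun z => φ (t * z)))).congr_of_eventuallyEq ?_
    filter_upwards [eventually_gt_nhds ht] with b hb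
    rw [← integrated_equation hW h₁ h₂ hKW hφ hx ht hb]
    ring
  · intro x hx t ht
    exact ((hφ.comp_mul ht).isTest.abs_pair_le _).trans
      (mul_le_mul_of_nonneg_left (hKN x hx t ht) hM)
  · intro x hx
    obtain ⟨C, hC, hle⟩ := abs_sub_le_exp_sub hφ.bound hx (hd x hx)
    obtain ⟨C', hC'⟩ := hr x hx
    -- Taking `l = 0` shows that the kernel has total mass one, so the constant `φ x` can be moved
    -- inside the pairing.
    have hsub : ∀ t > 0, pair (K x t) (fun z => φ (t * z)) - φ x =
        C * pair (K x t) (fun z => C⁻¹ * (φ (t * z) - φ x)) := by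
      intro t ht
      have h1 := hKW x hx t ht 0 le_rfl
      rw [hW0 x hx t ht] at h1
      simp only [zero_mul, neg_zero, Real.exp_zero, mul_one, pair] at h1
      have i1 := (hφ.comp_mul ht).isTest.integrable_pair (K x t)
      have i2 := L1.integrable_coeFn (K x t)
      have e : ∀ z, (K x t) z * (C⁻¹ * (φ (t * z) - φ x)) =
          C⁻¹ * ((K x t) z * φ (t * z)) - C⁻¹ * φ x * (K x t) z := fun z => by ring
      simp only [pair, e]
      rw [integral_sub (i1.const_mul _) (i2.const_mul _), integral_const_mul, integral_const_mul, h1]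
      field_simp
    obtain ⟨δ, hδ, hsmall⟩ : ∃ δ > 0, ∀ t ∈ Ioo 0 δ, |pair (K x t) (fun z => φ (t * z)) - φ x| ≤
        C * C' * √t := by
      obtain ⟨δ, hδ, h⟩ := mem_nhdsGT_iff_exists_Ioo_subset.1 hC'
      refine ⟨δ, hδ, fun t ht => ?_⟩
      rw [hsub t ht.1, abs_mul, abs_of_pos hC, mul_assoc]
      refine mul_le_mul_of_nonneg_left (h ht _ ?_ fun z hz => ?_) hC.le
      · exact ((((hφ.comp_mul ht.1).cont.sub continuousOn_const)).const_smul
          C⁻¹).aestronglyMeasurable measurableSet_Ioi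
      · rw [abs_mul, abs_of_pos (inv_pos.2 hC), inv_mul_le_iff₀ hC]
        exact hle _ (mul_pos ht.1 hz)
    have hN0 : 0 ≤ N x := (norm_nonneg _).trans (hKN x hx 1 one_pos)
    refine ⟨|C * C'| + (M * N x + M) / √δ, fun t ht => ?_⟩
    have hsδ : 0 < √δ := Real.sqrt_pos.2 hδ
    rw [add_mul]
    by_cases htδ : t < δ
    · refine (hsmall t ⟨ht, htδ⟩).trans ?_
      have h1 : C * C' * √t ≤ |C * C'| * √t :=
        mul_le_mul_of_nonneg_right (le_abs_self _) (Real.sqrt_nonneg t)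
      have h2 : 0 ≤ (M * N x + M) / √δ * √t := by positivity
      linarith
    · have h1 : √δ ≤ √t := Real.sqrt_le_sqrt (not_lt.1 htδ)
      have h2 : |pair (K x t) (fun z => φ (t * z)) - φ x| ≤ M * N x + M :=
        (abs_sub _ _).trans (add_le_add (((hφ.comp_mul ht).isTest.abs_pair_le _).trans
          (mul_le_mul_of_nonneg_left (hKN x hx t ht) hM)) (hφ.bound x hx))
      have h3 : M * N x + M ≤ (M * N x + M) / √δ * √t := by
        rw [div_mul_eq_mul_div, le_div_iff₀ hsδ]
        exact mul_le_mul_of_nonneg_left h1 (by positivity)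
      have h4 : 0 ≤ |C * C'| * √t := by positivity
      linarith
  · intro k x hx t ht hk
    have hik : IntegrableOn k (Ioi 0) := by simpa using (hk 0 le_rfl).1
    have hiK := L1.integrable_coeFn (K x t)
    have hcv := fun g : ℝ → ℝ => integral_comp_mul_left_Ioi (fun y => g y) 0 ht
    have hij : IntegrableOn (fun y => t⁻¹ * (K x t) (t⁻¹ * y)) (Ioi 0) := by
      refine Integrable.const_mul ?_ _
      have := (integrableOn_Ioi_comp_mul_left_iff (fun y => (K x t) y) 0 (inv_pos.2 ht)).2
      rw [mul_zero] at this
      exact this hiK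
    have hchange : ∀ ψ : ℝ → ℝ, ∫ y in Ioi (0 : ℝ), t⁻¹ * (K x t) (t⁻¹ * y) * ψ y =
        pair (K x t) (fun z => ψ (t * z)) := by
      intro ψ
      have := hcv (fun y => t⁻¹ * (K x t) (t⁻¹ * y) * ψ y)
      rw [mul_zero, smul_eq_mul, eq_inv_mul_iff_mul_eq₀ ht.ne', ← integral_const_mul] at this
      rw [← this, pair]
      refine integral_congr_ae (ae_of_all _ fun z => ?_)
      simp only
      rw [inv_mul_cancel_left₀ ht.ne']
      field_simp
    rw [← hchange]
    refine integral_mul_eq_of_laplace_eq hik hij (fun n => ?_) hφ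
    rw [hchange]
    have e1 := (hk n n.cast_nonneg).2
    have e2 := hKW x hx t ht n n.cast_nonneg
    simp only [mul_assoc] at e2
    rw [e2]
    refine Eq.trans ?_ e1
    refine integral_congr_ae (ae_of_all _ fun z => ?_)
    simp only
    rw [mul_comm, neg_mul]

theorem HasKernel.exists_inverseLaplace {W : ℝ → ℝ → ℝ → ℝ} (hK : HasKernel W) :
    ∃ p : ℝ → ℝ → ℝ → ℝ, ∀ x > 0, ∀ t > 0,
      IsInverseLaplace (fun l => W l x t) (fun y => p x y t) := by
  obtain ⟨K, -, hKW, -, -⟩ := hK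
  refine ⟨fun x y t => t⁻¹ * (K x t) (t⁻¹ * y), fun x hx t ht l hl => ?_⟩
  have hiK := L1.integrable_coeFn (K x t)
  have hij : IntegrableOn (fun y => t⁻¹ * (K x t) (t⁻¹ * y)) (Ioi 0) := by
    refine Integrable.const_mul ?_ _
    have := (integrableOn_Ioi_comp_mul_left_iff (fun y => (K x t) y) 0 (inv_pos.2 ht)).2
    rw [mul_zero] at this
    exact this hiK
  constructor
  · refine ((isTest_exp hl).integrable_mul hij).congr (ae_of_all _ fun y => ?_)
    simp only
    rw [neg_mul]; ring
  · have := integral_comp_mul_left_Ioi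
      (fun y => Real.exp (-l * y) * (t⁻¹ * (K x t) (t⁻¹ * y))) 0 ht
    rw [mul_zero, smul_eq_mul, eq_inv_mul_iff_mul_eq₀ ht.ne', ← integral_const_mul] at this
    rw [← this]
    refine Eq.trans ?_ (hKW x hx t ht l hl)
    refine integral_congr_ae (ae_of_all _ fun z => ?_)
    simp only
    rw [inv_mul_cancel_left₀ ht.ne']
    field_simp

/-! ### Sign conditions forced by a global solution of the Riccati equation. -/

section Riccati

variable {A B : ℝ} {f : ℝ → ℝ}

/-- Under the hypothesis `arctan (f - 1)` decreases at rate at least `ε` in the variable `log x`,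
and its total variation is less than `π`. -/
theorem log_div_lt_of_riccati (hf : ∀ x > 0, DifferentiableAt ℝ f x) {ε u v : ℝ} (hu : 0 < u)
    (huv : u ≤ v) (h : ∀ x ∈ Icc u v, x * deriv f x ≤ -ε * (1 + (f x - 1) ^ 2)) :
    ε * (Real.log v - Real.log u) < π := by
  have hd : ∀ x ∈ Icc u v, HasDerivAt (fun x => Real.arctan (f x - 1) + ε * Real.log x)
      (1 / (1 + (f x - 1) ^ 2) * deriv f x + ε * x⁻¹) x := by
    intro x hx
    have hx0 : 0 < x := hu.trans_le hx.1
    exact (((hf x hx0).hasDerivAt.sub_const 1).arctan).add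
      ((Real.hasDerivAt_log hx0.ne').const_mul ε)
  have hanti : AntitoneOn (fun x => Real.arctan (f x - 1) + ε * Real.log x) (Icc u v) := by
    refine antitoneOn_of_hasDerivWithinAt_nonpos (convex_Icc u v)
      (fun x hx => (hd x hx).continuousAt.continuousWithinAt)
      (fun x hx => (hd x (interior_subset hx)).hasDerivWithinAt) fun x hx => ?_
    have hx' := interior_subset hx
    have hx0 : 0 < x := hu.trans_le hx'.1
    have h1 := h x hx'
    have h2 : 0 < 1 + (f x - 1) ^ 2 := by positivity
    have h3 : 1 / (1 + (f x - 1) ^ 2) * deriv f x + ε * x⁻¹ =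
        (x * deriv f x + ε * (1 + (f x - 1) ^ 2)) / (x * (1 + (f x - 1) ^ 2)) := by
      field_simp
    rw [h3]
    exact div_nonpos_of_nonpos_of_nonneg (by linarith) (by positivity)
  have h1 := hanti (left_mem_Icc.2 huv) (right_mem_Icc.2 huv) huv
  simp only at h1
  have h2 := Real.arctan_lt_pi_div_two (f u - 1)
  have h3 := Real.neg_pi_div_two_lt_arctan (f v - 1)
  linarith

theorem riccati_eq (hR : ∀ x > 0, x * deriv f x - f x + (1 / 2) * f x ^ 2 = A * x + B) {x : ℝ}
    (hx : 0 < x) : x * deriv f x = (1 + 2 * B) / 2 + A * x - (f x - 1) ^ 2 / 2 := by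
  linear_combination hR x hx

/-- For negative `A` the right side of `riccati_eq` is eventually at most `-(1 + (f - 1)²) / 2`, on
intervals of arbitrary logarithmic length; length `2 π` is already too much. -/
theorem riccati_nonneg (hf : ∀ x > 0, DifferentiableAt ℝ f x)
    (hR : ∀ x > 0, x * deriv f x - f x + (1 / 2) * f x ^ 2 = A * x + B) : 0 ≤ A := by
  by_contra! hA
  -- Beyond the second entry, `(1 + 2 B) / 2 + A x ≤ -1 / 2`.
  set u := max 1 ((-1 / 2 - (1 + 2 * B) / 2) / A) with hu_def
  have hu : 0 < u := lt_max_of_lt_left one_pos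
  have huv : u ≤ u * Real.exp (2 * π) :=
    le_mul_of_one_le_right hu.le (Real.one_le_exp (by positivity))
  have h := log_div_lt_of_riccati (ε := 1 / 2) hf hu huv fun x hx => by
    have hx0 : 0 < x := hu.trans_le hx.1
    rw [riccati_eq hR hx0]
    have h1 : (-1 / 2 - (1 + 2 * B) / 2) / A ≤ x := (le_max_right _ _).trans hx.1
    rw [div_le_iff_of_neg hA] at h1
    linarith
  rw [Real.log_mul hu.ne' (Real.exp_pos _).ne', Real.log_exp] at h
  linarith

/-- The same blow-up occurs near `0`, where `A x` is negligible and intervals also have arbitrary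
logarithmic length. -/
theorem riccati_discriminant_nonneg (hf : ∀ x > 0, DifferentiableAt ℝ f x)
    (hR : ∀ x > 0, x * deriv f x - f x + (1 / 2) * f x ^ 2 = A * x + B) : 0 ≤ 1 + 2 * B := by
  by_contra! hB
  have hA := riccati_nonneg hf hR
  -- Then `(1 + 2 B) / 2 = -2 δ`; one `δ` absorbs `A x` for `x ≤ v`, the other remains. The point
  -- `u` is placed so that `ε (log v - log u)` is exactly `π`.
  set δ := -(1 + 2 * B) / 4 with hδ_def
  have hδ : 0 < δ := by rw [hδ_def]; linarith
  set ε := min δ (1 / 2)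
  have hε : 0 < ε := lt_min hδ (by norm_num)
  set v := δ / (A + 1)
  have hv : 0 < v := by positivity
  set u := v * Real.exp (-(π / ε))
  have hu : 0 < u := by positivity
  have huv : u ≤ v := mul_le_of_le_one_right hv.le (Real.exp_le_one_iff.2 (by
    have : 0 < π / ε := by positivity
    linarith))
  have h := log_div_lt_of_riccati (ε := ε) hf hu huv fun x hx => by
    have hx0 : 0 < x := hu.trans_le hx.1
    rw [riccati_eq hR hx0]
    have h1 : A * x ≤ δ := by
      have h2 : x * (A + 1) ≤ δ := (le_div_iff₀ (by linarith)).1 hx.2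
      linarith
    have h3 : ε * (1 + (f x - 1) ^ 2) ≤ δ + (f x - 1) ^ 2 / 2 := by
      have h4 := min_le_left δ (1 / 2)
      have h5 := min_le_right δ (1 / 2)
      nlinarith [sq_nonneg (f x - 1), mul_le_mul_of_nonneg_right h5 (sq_nonneg (f x - 1))]
    linarith
  rw [Real.log_mul hv.ne' (Real.exp_pos _).ne', Real.log_exp] at h
  have : ε * (Real.log v - (Real.log v + -(π / ε))) = π := by field_simp; ring
  linarith

end Riccati

/-! ### The linearised equation and its Frobenius solutions. -/

/-- `Y` solves `2 x² Y'' = (A x + B) Y` on the half-line, with derivative `Y'`. -/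
def IsEulerBessel (A B : ℝ) (Y Y' : ℝ → ℝ) : Prop :=
  ∀ x > 0, HasDerivAt Y (Y' x) x ∧ HasDerivAt Y' ((A * x + B) / (2 * x ^ 2) * Y x) x

theorem IsEulerBessel.contDiffOn {A B : ℝ} {Y Y' : ℝ → ℝ} (h : IsEulerBessel A B Y Y') :
    ContDiffOn ℝ 2 Y (Ioi 0) := by
  have hc : ContinuousOn Y (Ioi 0) := fun x hx => (h x hx).1.continuousAt.continuousWithinAt
  have h1 : ContDiffOn ℝ 1 Y' (Ioi 0) := by
    rw [show (1 : WithTop ℕ∞) = 0 + 1 by rfl, contDiffOn_succ_iff_deriv_of_isOpen isOpen_Ioi]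
    refine ⟨fun x hx => (h x hx).2.differentiableAt.differentiableWithinAt, by simp, ?_⟩
    rw [contDiffOn_zero]
    have : ContinuousOn (fun x => (A * x + B) / (2 * x ^ 2) * Y x) (Ioi 0) :=
      (ContinuousOn.div (by fun_prop) (by fun_prop) fun x hx => by
        have : (0 : ℝ) < x := hx
        positivity).mul hc
    exact this.congr fun x hx => (h x hx).2.deriv
  rw [show (2 : WithTop ℕ∞) = 1 + 1 by norm_num, contDiffOn_succ_iff_deriv_of_isOpen isOpen_Ioi]
  exact ⟨fun x hx => (h x hx).1.differentiableAt.differentiableWithinAt, by simp,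
    h1.congr fun x hx => (h x hx).1.deriv⟩

/-- With `Y' = f Y / (2 x)`, differentiating once more produces `x f' - f + f² / 2`, which the
Riccati equation replaces by `A x + B`. -/
theorem isEulerBessel_exp {A B : ℝ} {f F : ℝ → ℝ} (hf : ∀ x > 0, DifferentiableAt ℝ f x)
    (hR : ∀ x > 0, x * deriv f x - f x + (1 / 2) * f x ^ 2 = A * x + B)
    (hF : ∀ x > 0, HasDerivAt F (f x / x) x) :
    IsEulerBessel A B (fun x => Real.exp (F x / 2)) (fun x => f x / (2 * x) * Real.exp (F x / 2)) := by
  intro x hx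
  have h1 : HasDerivAt (fun x => Real.exp (F x / 2)) (Real.exp (F x / 2) * (f x / x / 2)) x :=
    ((hF x hx).div_const 2).exp
  refine ⟨h1.congr_deriv (by field_simp), ?_⟩
  have h2 : HasDerivAt (fun x : ℝ => 2 * x) (2 * 1) x := (hasDerivAt_id x).const_mul 2
  have h3 := ((hf x hx).hasDerivAt.div h2 (by positivity)).mul h1
  refine h3.congr_deriv ?_
  have h4 := hR x hx
  have h5 : deriv f x = (A * x + B + f x - (1 / 2) * f x ^ 2) / x := by
    rw [eq_div_iff hx.ne']; linarith
  rw [h5]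
  simp only [Pi.div_apply]
  field_simp
  ring

theorem constant_of_hasDerivAt_zero {W : ℝ → ℝ} (h : ∀ x > 0, HasDerivAt W 0 x) :
    ∀ x > 0, W x = W 1 := by
  intro x hx
  exact isOpen_Ioi.is_const_of_deriv_eq_zero isPreconnected_Ioi
    (fun y hy => (h y hy).differentiableAt.differentiableWithinAt) (fun y hy => (h y hy).deriv)
    hx (mem_Ioi.2 one_pos)

/-- The equation has no first-order term. -/
theorem IsEulerBessel.wronskian_const {A B : ℝ} {Y Y' Z Z' : ℝ → ℝ} (hY : IsEulerBessel A B Y Y')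
    (hZ : IsEulerBessel A B Z Z') : ∃ w, ∀ x > 0, Y x * Z' x - Y' x * Z x = w := by
  refine ⟨_, constant_of_hasDerivAt_zero (W := fun x => Y x * Z' x - Y' x * Z x) fun x hx => ?_⟩
  refine (((hY x hx).1.mul (hZ x hx).2).sub ((hY x hx).2.mul (hZ x hx).1)).congr_deriv ?_
  ring

theorem IsEulerBessel.exists_combination {A B w : ℝ} {Y Y' Z Z' V V' : ℝ → ℝ}
    (hY : IsEulerBessel A B Y Y') (hZ : IsEulerBessel A B Z Z') (hV : IsEulerBessel A B V V')
    (hw : ∀ x > 0, Z x * V' x - Z' x * V x = w) (hw0 : w ≠ 0) :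
    ∃ a b, ∀ x > 0, Y x = a * Z x + b * V x := by
  obtain ⟨α, hα⟩ := hY.wronskian_const hZ
  obtain ⟨γ, hγ⟩ := hY.wronskian_const hV
  refine ⟨γ / w, -(α / w), fun x hx => ?_⟩
  field_simp
  rw [← hα x hx, ← hγ x hx, ← hw x hx]
  ring

/-- Conjugation by a power of `x`: `x y'' + (1 + μ) y' = (A / 2) y` becomes the Euler-Bessel
equation for `x ^ ((1 + μ) / 2) y`. -/
theorem isEulerBessel_rpow_mul {A B μ : ℝ} (hμ : μ ^ 2 = 1 + 2 * B) {y y' y'' : ℝ → ℝ}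
    (h1 : ∀ x > 0, HasDerivAt y (y' x) x) (h2 : ∀ x > 0, HasDerivAt y' (y'' x) x)
    (h : ∀ x > 0, x * y'' x + (1 + μ) * y' x = A / 2 * y x) :
    IsEulerBessel A B (fun x => x ^ ((1 + μ) / 2) * y x)
      (fun x => x ^ ((1 + μ) / 2) * ((1 + μ) / 2 / x * y x + y' x)) := by
  intro x hx
  have hp : HasDerivAt (fun x : ℝ => x ^ ((1 + μ) / 2)) ((1 + μ) / 2 * (x ^ ((1 + μ) / 2) / x)) x := by
    have := Real.hasDerivAt_rpow_const (x := x) (p := (1 + μ) / 2) (Or.inl hx.ne')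
    rwa [Real.rpow_sub_one hx.ne'] at this
  refine ⟨(hp.mul (h1 x hx)).congr_deriv (by ring), ?_⟩
  have hq : HasDerivAt (fun x : ℝ => (1 + μ) / 2 / x) (-((1 + μ) / 2) / x ^ 2) x := by
    have := (hasDerivAt_const x ((1 + μ) / 2)).div (hasDerivAt_id x) hx.ne'
    refine this.congr_deriv ?_
    simp
  refine (hp.mul ((hq.mul (h1 x hx)).add (h2 x hx))).congr_deriv ?_
  have h3 : y'' x = (A / 2 * y x - (1 + μ) * y' x) / x := by
    rw [eq_div_iff hx.ne']; linarith [h x hx]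
  have hB : B = (μ ^ 2 - 1) / 2 := by linarith
  simp only [Pi.add_apply, Pi.mul_apply]
  rw [h3, hB]
  field_simp
  ring

theorem mul_entireSum_derivSeq {e : ℕ → ℝ} (he : EntireSeq e) (x : ℝ) :
    x * entireSum (derivSeq e) x = entireSum (fun k => k * e k) x ∧
      Summable fun k : ℕ => k * e k * x ^ k := by
  have hs : Summable fun k : ℕ => ‖derivSeq e k * x ^ k‖ :=
    (he.derivSeq x).congr fun k => by rw [norm_mul, norm_pow, Real.norm_eq_abs, Real.norm_eq_abs]
  have h1 : Summable fun k : ℕ => (k : ℝ) * e k * x ^ k := by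
    rw [← summable_nat_add_iff 1]
    refine (hs.of_norm.mul_left x).congr fun k => ?_
    rw [derivSeq]; push_cast; ring
  refine ⟨?_, h1⟩
  rw [entireSum, entireSum, h1.tsum_eq_zero_add, ← tsum_mul_left]
  simp only [Nat.cast_zero, zero_mul, zero_add]
  refine tsum_congr fun k => ?_
  rw [derivSeq]; push_cast; ring

theorem EntireSeq.summable {e : ℕ → ℝ} (he : EntireSeq e) (x : ℝ) :
    Summable fun k => e k * x ^ k :=
  Summable.of_norm ((he x).congr fun k => by rw [norm_mul, norm_pow, Real.norm_eq_abs, Real.norm_eq_abs])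

/-- The coefficients of the Frobenius solution of `x y'' + (1 + μ) y' = (A / 2) y`. -/
noncomputable def frobCoeff (A μ : ℝ) : ℕ → ℝ
  | 0 => 1
  | k + 1 => A / 2 / (((k : ℝ) + 1) * (k + 1 + μ)) * frobCoeff A μ k

theorem frobenius_succ {A μ : ℝ} (hμ : -1 < μ) (k : ℕ) :
    ((k : ℝ) + 1 + μ) * ((k + 1) * frobCoeff A μ (k + 1)) = A / 2 * frobCoeff A μ k := by
  have h1 : (0 : ℝ) < k + 1 + μ := by linarith [(Nat.cast_nonneg k : (0 : ℝ) ≤ k)]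
  have h2 : (0 : ℝ) < k + 1 := by positivity
  rw [frobCoeff]
  field_simp

theorem entireSeq_frobenius {A μ : ℝ} (hμ : -1 < μ) : EntireSeq (frobCoeff A μ) := by
  refine EntireSeq.of_ratio (q := fun k => |A / 2| * (1 / (1 + μ)) * (1 / ((k : ℝ) + 1))) ?_
    fun k => ?_
  · simpa using tendsto_one_div_add_atTop_nhds_zero_nat.const_mul (|A / 2| * (1 / (1 + μ)))
  · have h1 : (0 : ℝ) < 1 + μ := by linarith
    have h0 : (0 : ℝ) ≤ k := Nat.cast_nonneg k
    have h2 : (0 : ℝ) < k + 1 := by positivity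
    rw [frobCoeff, abs_mul]
    refine mul_le_mul_of_nonneg_right ?_ (abs_nonneg _)
    rw [abs_div, abs_of_pos (by nlinarith : 0 < ((k : ℝ) + 1) * (k + 1 + μ)), mul_assoc, div_eq_mul_one_div]
    refine mul_le_mul_of_nonneg_left ?_ (abs_nonneg _)
    rw [div_mul_div_comm, one_mul]
    exact one_div_le_one_div_of_le (by positivity) (by nlinarith)

theorem frobenius_nonneg {A μ : ℝ} (hA : 0 ≤ A) (hμ : -1 < μ) (k : ℕ) : 0 ≤ frobCoeff A μ k := by
  induction k with
  | zero => exact zero_le_one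
  | succ k ih =>
    have h1 : (0 : ℝ) < k + 1 + μ := by linarith [(Nat.cast_nonneg k : (0 : ℝ) ≤ k)]
    rw [frobCoeff]; positivity

theorem entireSum_frobenius_zero (A μ : ℝ) : entireSum (frobCoeff A μ) 0 = 1 := by
  rw [entireSum, tsum_eq_single 0 fun k hk => by simp [hk]]
  simp [frobCoeff]

theorem one_le_entireSum_frobenius {A μ x : ℝ} (hA : 0 ≤ A) (hμ : -1 < μ) (hx : 0 ≤ x) :
    1 ≤ entireSum (frobCoeff A μ) x := by
  have h := ((entireSeq_frobenius (A := A) hμ).summable x).le_tsum 0 fun k _ =>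
    mul_nonneg (frobenius_nonneg hA hμ k) (pow_nonneg hx k)
  simpa [frobCoeff, entireSum] using h

theorem frobenius_equation {A μ : ℝ} (hμ : -1 < μ) (x : ℝ) :
    x * entireSum (derivSeq (derivSeq (frobCoeff A μ))) x +
      (1 + μ) * entireSum (derivSeq (frobCoeff A μ)) x = A / 2 * entireSum (frobCoeff A μ) x := by
  have he := entireSeq_frobenius (A := A) hμ
  obtain ⟨h1, h2⟩ := mul_entireSum_derivSeq he.derivSeq x
  rw [h1, entireSum, entireSum, entireSum, ← tsum_mul_left, ← tsum_mul_left,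
    ← h2.tsum_add ((he.derivSeq.summable x).mul_left _)]
  refine tsum_congr fun k => ?_
  rw [← mul_assoc, ← mul_assoc (A / 2), ← frobenius_succ hμ k, derivSeq]
  ring

theorem isEulerBessel_frobenius {A B μ : ℝ} (hμ : -1 < μ) (hB : μ ^ 2 = 1 + 2 * B) :
    IsEulerBessel A B (fun x => x ^ ((1 + μ) / 2) * entireSum (frobCoeff A μ) x)
      (fun x => x ^ ((1 + μ) / 2) * ((1 + μ) / 2 / x * entireSum (frobCoeff A μ) x +
        entireSum (derivSeq (frobCoeff A μ)) x)) :=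
  have he := entireSeq_frobenius (A := A) hμ
  isEulerBessel_rpow_mul hB (fun x _ => hasDerivAt_entireSum he x)
    (fun x _ => hasDerivAt_entireSum he.derivSeq x) fun x _ => frobenius_equation hμ x

/-- The coefficients of the regular part of the logarithmic solution for `μ = 0`. -/
noncomputable def frobeniusLog (A : ℝ) (k : ℕ) : ℝ := -2 * (harmonic k : ℝ) * frobCoeff A 0 k

/-- The increment `1 / (k + 1)` of the harmonic numbers produces the term `2 (k + 1) e_{k+1}`, which
compensates the derivatives falling on `log x` in the second solution. -/
theorem frobeniusLog_succ (A : ℝ) (k : ℕ) :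
    ((k : ℝ) + 1) * ((k + 1) * frobeniusLog A (k + 1)) + 2 * ((k + 1) * frobCoeff A 0 (k + 1)) =
      A / 2 * frobeniusLog A k := by
  have h := frobenius_succ (A := A) (μ := 0) (by norm_num) k
  have h2 : ((k : ℝ) + 1) ≠ 0 := by positivity
  rw [add_zero] at h
  simp only [frobeniusLog, harmonic_succ]
  push_cast
  have h3 : A / 2 * (-2 * (harmonic k : ℝ) * frobCoeff A 0 k) =
      -2 * (harmonic k : ℝ) * (A / 2 * frobCoeff A 0 k) := by ring
  rw [h3, ← h]
  field_simp
  ring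

theorem entireSeq_frobeniusLog (A : ℝ) : EntireSeq (frobeniusLog A) := by
  have he := entireSeq_frobenius (A := A) (μ := 0) (by norm_num)
  intro r
  refine Summable.of_nonneg_of_le (fun k => by positivity) (fun k => ?_)
    ((he (2 * |r|)).mul_left 2)
  have h1 : (harmonic k : ℝ) ≤ k := by
    have : harmonic k ≤ k := by
      induction k with
      | zero => simp
      | succ k ih =>
        rw [harmonic_succ]
        push_cast
        have : ((k : ℚ) + 1)⁻¹ ≤ 1 := inv_le_one_of_one_le₀ (by
          linarith [(Nat.cast_nonneg k : (0 : ℚ) ≤ k)])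
        linarith
    exact_mod_cast this
  have h0 : (0 : ℝ) ≤ harmonic k := by
    rw [harmonic]; push_cast; positivity
  have h2 : (k : ℝ) ≤ 2 ^ k := by exact_mod_cast (Nat.lt_two_pow_self (n := k)).le
  rw [frobeniusLog, abs_mul, abs_mul, abs_of_nonneg h0, abs_neg, abs_two, abs_of_nonneg (by positivity : 0 ≤ 2 * |r|), mul_pow]
  calc 2 * (harmonic k : ℝ) * |frobCoeff A 0 k| * |r| ^ k
      ≤ 2 * 2 ^ k * |frobCoeff A 0 k| * |r| ^ k := by gcongr; exact h1.trans h2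
    _ = _ := by ring

theorem frobeniusLog_equation (A x : ℝ) :
    x * entireSum (derivSeq (derivSeq (frobeniusLog A))) x +
      entireSum (derivSeq (frobeniusLog A)) x + 2 * entireSum (derivSeq (frobCoeff A 0)) x =
        A / 2 * entireSum (frobeniusLog A) x := by
  have he := entireSeq_frobenius (A := A) (μ := 0) (by norm_num)
  have hp := entireSeq_frobeniusLog A
  obtain ⟨h1, h2⟩ := mul_entireSum_derivSeq hp.derivSeq x
  rw [h1, entireSum, entireSum, entireSum, entireSum, ← tsum_mul_left, ← tsum_mul_left,
    ← h2.tsum_add (hp.derivSeq.summable x),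
    ← (h2.add (hp.derivSeq.summable x)).tsum_add ((he.derivSeq.summable x).mul_left _)]
  refine tsum_congr fun k => ?_
  rw [← mul_assoc (A / 2), ← frobeniusLog_succ, derivSeq, derivSeq]
  ring

theorem isEulerBessel_log {A B : ℝ} (hB : 1 + 2 * B = 0) :
    IsEulerBessel A B
      (fun x => x ^ ((1 + (0 : ℝ)) / 2) *
        (entireSum (frobCoeff A 0) x * Real.log x + entireSum (frobeniusLog A) x))
      (fun x => x ^ ((1 + (0 : ℝ)) / 2) * ((1 + 0) / 2 / x *
        (entireSum (frobCoeff A 0) x * Real.log x + entireSum (frobeniusLog A) x) +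
        (entireSum (derivSeq (frobCoeff A 0)) x * Real.log x + entireSum (frobCoeff A 0) x * x⁻¹ +
          entireSum (derivSeq (frobeniusLog A)) x))) := by
  have he := entireSeq_frobenius (A := A) (μ := 0) (by norm_num)
  have hp := entireSeq_frobeniusLog A
  refine isEulerBessel_rpow_mul (μ := 0) (by rw [hB]; norm_num) (fun x hx => ?_) (y'' := fun x =>
    entireSum (derivSeq (derivSeq (frobCoeff A 0))) x * Real.log x +
      entireSum (derivSeq (frobCoeff A 0)) x * x⁻¹ +
      (entireSum (derivSeq (frobCoeff A 0)) x * x⁻¹ + entireSum (frobCoeff A 0) x * (-(x ^ 2)⁻¹)) +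
      entireSum (derivSeq (derivSeq (frobeniusLog A))) x) (fun x hx => ?_) fun x hx => ?_
  · have hl := Real.hasDerivAt_log (ne_of_gt hx)
    exact ((hasDerivAt_entireSum he x).mul hl).add (hasDerivAt_entireSum hp x)
  · have hl := Real.hasDerivAt_log (ne_of_gt hx)
    have hi := hasDerivAt_inv (ne_of_gt hx)
    exact (((hasDerivAt_entireSum he.derivSeq x).mul hl).add
      ((hasDerivAt_entireSum he x).mul hi)).add (hasDerivAt_entireSum hp.derivSeq x)
  · have h1 := frobenius_equation (A := A) (μ := 0) (by norm_num) x
    have h2 := frobeniusLog_equation A x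
    have hx' : x ≠ 0 := ne_of_gt hx
    field_simp
    linear_combination 2 * x * Real.log x * h1 + 2 * x * h2

/-- It serves to compute a constant Wronskian by evaluating its continuous extension at the origin.
-/
theorem eq_of_continuous_of_const {g : ℝ → ℝ} (hg : Continuous g) {w : ℝ} (h : ∀ x > 0, g x = w) :
    g 0 = w := by
  have h1 : Tendsto g (𝓝[>] 0) (𝓝 (g 0)) := hg.continuousAt.tendsto.mono_left nhdsWithin_le_nhds
  refine tendsto_nhds_unique h1 (tendsto_const_nhds.congr' ?_)
  filter_upwards [self_mem_nhdsWithin] with x hx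
  exact (h x hx).symm

/-- The powers in the Wronskian multiply to `x`, and the remaining expression is continuous with
value `-ν` at `0`; so the two solutions are independent. The condition `ν < 1` keeps the recursion
for `-ν` free of zero denominators. -/
theorem IsEulerBessel.exists_frobenius_combination {A B ν : ℝ} (h0 : 0 < ν) (h1 : ν < 1)
    (hB : ν ^ 2 = 1 + 2 * B) {Y Y' : ℝ → ℝ} (hY : IsEulerBessel A B Y Y') :
    ∃ a b, ∀ x > 0, Y x = a * (x ^ ((1 + ν) / 2) * entireSum (frobCoeff A ν) x) +
      b * (x ^ ((1 + -ν) / 2) * entireSum (frobCoeff A (-ν)) x) := by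
  have hZ := isEulerBessel_frobenius (A := A) (B := B) (μ := ν) (by linarith) hB
  have hV := isEulerBessel_frobenius (A := A) (B := B) (μ := -ν) (by linarith) (by rw [neg_sq, hB])
  obtain ⟨w, hw⟩ := hZ.wronskian_const hV
  refine hY.exists_combination hZ hV hw ?_
  have e₁ := entireSeq_frobenius (A := A) (μ := ν) (by linarith)
  have e₂ := entireSeq_frobenius (A := A) (μ := -ν) (by linarith)
  have c₁ := continuous_entireSum e₁
  have c₂ := continuous_entireSum e₂
  have d₁ := continuous_entireSum e₁.derivSeq
  have d₂ := continuous_entireSum e₂.derivSeq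
  have h := eq_of_continuous_of_const (g := fun x =>
    -ν * (entireSum (frobCoeff A ν) x * entireSum (frobCoeff A (-ν)) x) +
      x * (entireSum (frobCoeff A ν) x * entireSum (derivSeq (frobCoeff A (-ν))) x -
        entireSum (derivSeq (frobCoeff A ν)) x * entireSum (frobCoeff A (-ν)) x))
    (by fun_prop) (w := w) fun x hx => ?_
  · simp only [entireSum_frobenius_zero] at h
    rw [← h]
    simp [h0.ne']
  · rw [← hw x hx]
    have hp : x ^ ((1 + -ν) / 2) = x / x ^ ((1 + ν) / 2) := by
      rw [eq_div_iff (Real.rpow_pos_of_pos hx _).ne', ← Real.rpow_add hx]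
      rw [show (1 + -ν) / 2 + (1 + ν) / 2 = 1 by ring, Real.rpow_one]
    have hq := (Real.rpow_pos_of_pos hx ((1 + ν) / 2)).ne'
    have hx' : x ≠ 0 := ne_of_gt hx
    rw [hp]
    field_simp
    ring

/-- Here the Wronskian extends continuously to `0` with value `1`. -/
theorem exists_log_combination {A B : ℝ} (hB : 1 + 2 * B = 0)
    {Y Y' : ℝ → ℝ} (hY : IsEulerBessel A B Y Y') :
    ∃ a b, ∀ x > 0, Y x = a * (x ^ ((1 + (0 : ℝ)) / 2) * entireSum (frobCoeff A 0) x) +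
      b * (x ^ ((1 + (0 : ℝ)) / 2) *
        (entireSum (frobCoeff A 0) x * Real.log x + entireSum (frobeniusLog A) x)) := by
  have hZ := isEulerBessel_frobenius (A := A) (B := B) (μ := 0) (by norm_num) (by rw [hB]; norm_num)
  have hV := isEulerBessel_log (A := A) hB
  obtain ⟨w, hw⟩ := hZ.wronskian_const hV
  refine hY.exists_combination hZ hV hw ?_
  have e₁ := entireSeq_frobenius (A := A) (μ := 0) (by norm_num)
  have e₂ := entireSeq_frobeniusLog A
  have c₁ := continuous_entireSum e₁
  have c₂ := continuous_entireSum e₂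
  have d₁ := continuous_entireSum e₁.derivSeq
  have d₂ := continuous_entireSum e₂.derivSeq
  have h := eq_of_continuous_of_const (g := fun x =>
    entireSum (frobCoeff A 0) x ^ 2 +
      x * (entireSum (frobCoeff A 0) x * entireSum (derivSeq (frobeniusLog A)) x -
        entireSum (derivSeq (frobCoeff A 0)) x * entireSum (frobeniusLog A) x))
    (by fun_prop) (w := w) fun x hx => ?_
  · simp only [entireSum_frobenius_zero] at h
    rw [← h]
    simp
  · rw [← hw x hx]
    have hp : x ^ ((1 + (0 : ℝ)) / 2) * x ^ ((1 + (0 : ℝ)) / 2) = x := by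
      rw [← Real.rpow_add hx]; norm_num
    have hx' : x ≠ 0 := ne_of_gt hx
    generalize x ^ ((1 + (0 : ℝ)) / 2) = q at hp
    field_simp
    linear_combination (-2) * (x * (entireSum (frobCoeff A 0) x * entireSum (derivSeq (frobeniusLog A)) x -
      entireSum (derivSeq (frobCoeff A 0)) x * entireSum (frobeniusLog A) x) +
      entireSum (frobCoeff A 0) x ^ 2) * hp

/-- For `ν ≥ 1` one has `B ≥ 0`, so the positive solution `Y` is convex. As `Y → 0`, its derivative
is nonnegative and bounded near `0`. Since the Frobenius solution vanishes at `0` and its derivative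
stays bounded there, the Wronskian of the two tends to `0`; being constant, it is zero, and the
quotient is constant. This avoids constructing the second solution, which may contain logarithms for
integral `ν`. -/
theorem eq_mul_frobenius_of_tendsto_zero {A B ν : ℝ} (hA : 0 ≤ A) (h1 : 1 ≤ ν)
    (hB : ν ^ 2 = 1 + 2 * B) {Y Y' : ℝ → ℝ} (hY : IsEulerBessel A B Y Y') (hpos : ∀ x > 0, 0 < Y x)
    (hlim : Tendsto Y (𝓝[>] 0) (𝓝 0)) :
    ∃ a, ∀ x > 0, Y x = a * (x ^ ((1 + ν) / 2) * entireSum (frobCoeff A ν) x) := by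
  have hB0 : 0 ≤ B := by nlinarith
  have hZ := isEulerBessel_frobenius (A := A) (B := B) (μ := ν) (by linarith) hB
  have e₁ := entireSeq_frobenius (A := A) (μ := ν) (by linarith)
  have hmono : MonotoneOn Y' (Ioi 0) := by
    refine monotoneOn_of_hasDerivWithinAt_nonneg (convex_Ioi 0)
      (fun x hx => (hY x hx).2.continuousAt.continuousWithinAt)
      (fun x hx => (hY x (interior_subset hx)).2.hasDerivWithinAt) fun x hx => ?_
    have hx : 0 < x := interior_subset hx
    have := hpos x hx
    positivity
  have hY'0 : ∀ x > 0, 0 ≤ Y' x := by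
    intro x hx
    by_contra! hneg
    have hanti : AntitoneOn Y (Ioc 0 x) := by
      refine antitoneOn_of_hasDerivWithinAt_nonpos (f' := Y') (convex_Ioc 0 x)
        (fun y hy => (hY y hy.1).1.continuousAt.continuousWithinAt)
        (fun y hy => (hY y (interior_subset hy).1).1.hasDerivWithinAt) fun y hy => ?_
      have hy' := interior_subset hy
      exact (hmono hy'.1 hx hy'.2).trans hneg.le
    have h2 : Y x ≤ 0 := by
      refine ge_of_tendsto hlim ?_
      filter_upwards [Ioc_mem_nhdsGT hx] with y hy
      exact hanti hy ⟨hx, le_rfl⟩ hy.2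
    exact absurd (hpos x hx) (not_lt.2 h2)
  obtain ⟨w, hw⟩ := hY.wronskian_const hZ
  have hw0 : w = 0 := by
    have c₁ := continuous_entireSum e₁
    have d₁ := continuous_entireSum e₁.derivSeq
    have hρ1 : Continuous fun x : ℝ => x ^ ((1 + ν) / 2 - 1) :=
      Real.continuous_rpow_const (by linarith)
    have hρ : Continuous fun x : ℝ => x ^ ((1 + ν) / 2) :=
      Real.continuous_rpow_const (by linarith)
    have t1 : Tendsto (fun x : ℝ => (1 + ν) / 2 * x ^ ((1 + ν) / 2 - 1) * entireSum (frobCoeff A ν) x +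
        x ^ ((1 + ν) / 2) * entireSum (derivSeq (frobCoeff A ν)) x) (𝓝[>] 0)
        (𝓝 ((1 + ν) / 2 * 0 ^ ((1 + ν) / 2 - 1) * entireSum (frobCoeff A ν) 0 +
        0 ^ ((1 + ν) / 2) * entireSum (derivSeq (frobCoeff A ν)) 0)) :=
      (Continuous.tendsto (by fun_prop) _).mono_left nhdsWithin_le_nhds
    have t2 : Tendsto (fun x : ℝ => Y' x * (x ^ ((1 + ν) / 2) * entireSum (frobCoeff A ν) x)) (𝓝[>] 0)
        (𝓝 0) := by
      have t3 : Tendsto (fun x : ℝ => Y' 1 * |x ^ ((1 + ν) / 2) * entireSum (frobCoeff A ν) x|)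
          (𝓝[>] 0) (𝓝 0) := by
        have : Tendsto (fun x : ℝ => Y' 1 * |x ^ ((1 + ν) / 2) * entireSum (frobCoeff A ν) x|)
            (𝓝 0) (𝓝 (Y' 1 * |0 ^ ((1 + ν) / 2) * entireSum (frobCoeff A ν) 0|)) :=
          Continuous.tendsto (by fun_prop) _
        rw [Real.zero_rpow (by linarith : (1 + ν) / 2 ≠ 0)] at this
        simpa using this.mono_left nhdsWithin_le_nhds
      refine squeeze_zero_norm' ?_ t3
      filter_upwards [Ioc_mem_nhdsGT one_pos] with x hx
      rw [norm_mul, Real.norm_of_nonneg (hY'0 x hx.1), Real.norm_eq_abs]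
      exact mul_le_mul_of_nonneg_right (hmono hx.1 (mem_Ioi.2 one_pos) hx.2) (abs_nonneg _)
    have t4 := (hlim.mul t1).sub t2
    rw [zero_mul, sub_zero] at t4
    refine tendsto_nhds_unique (tendsto_const_nhds.congr' ?_) t4
    filter_upwards [self_mem_nhdsWithin] with x hx
    have hx : 0 < x := hx
    rw [← hw x hx, Real.rpow_sub_one hx.ne']
    field_simp
  have hZpos : ∀ x > 0, 0 < x ^ ((1 + ν) / 2) * entireSum (frobCoeff A ν) x := fun x hx =>
    mul_pos (Real.rpow_pos_of_pos hx _)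
      (one_pos.trans_le (one_le_entireSum_frobenius hA (by linarith) hx.le))
  have hc := constant_of_hasDerivAt_zero
    (W := fun x => Y x / (x ^ ((1 + ν) / 2) * entireSum (frobCoeff A ν) x)) fun x hx => by
      refine ((hY x hx).1.div (hZ x hx).1 (hZpos x hx).ne').congr_deriv ?_
      rw [div_eq_zero_iff]
      left
      linarith [hw x hx]
  refine ⟨Y 1 / (1 ^ ((1 + ν) / 2) * entireSum (frobCoeff A ν) 1), fun x hx => ?_⟩
  rw [← hc x hx, div_mul_cancel₀ _ (hZpos x hx).ne']

/-! ### The kernel of `U_λ` and the equation it satisfies. -/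

theorem laplaceKernel_eq (A : ℝ) (F : ℝ → ℝ) (l x t : ℝ) :
    laplaceKernel A F l x t = Real.exp (-(l * (x + A * t ^ 2 / 2)) / (1 + l * t)) *
      Real.exp (F (x / (1 + l * t) ^ 2) / 2) * (Real.exp (F x / 2))⁻¹ := by
  rw [laplaceKernel, ← Real.exp_neg, ← Real.exp_add, ← Real.exp_add]
  congr 1
  ring

theorem div_sq_rpow {x s μ : ℝ} (hx : 0 < x) (hs : 0 < s) :
    (x / s ^ 2) ^ ((1 + μ) / 2) = x ^ ((1 + μ) / 2) * s ^ (-(1 + μ)) := by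
  rw [Real.div_rpow hx.le (by positivity), ← Real.rpow_natCast s 2, ← Real.rpow_mul hs.le,
    Real.rpow_neg hs.le, div_eq_mul_inv]
  congr 3
  push_cast; ring

theorem contDiffOn_rpow_const_Ioi (ρ : ℝ) : ContDiffOn ℝ 2 (fun x : ℝ => x ^ ρ) (Ioi 0) :=
  fun _ hx => (Real.contDiffAt_rpow_const_of_ne (ne_of_gt hx)).contDiffWithinAt

/-- `λ ↦ U_λ` is the Laplace transform of a kernel as soon as `exp (F / 2)` vanishes at `0`. -/
theorem hasKernel_laplaceKernel {A B : ℝ} {f F : ℝ → ℝ} (hf : ∀ x > 0, DifferentiableAt ℝ f x)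
    (hR : ∀ x > 0, x * deriv f x - f x + (1 / 2) * f x ^ 2 = A * x + B)
    (hF : ∀ x > 0, HasDerivAt F (f x / x) x)
    (h0 : Tendsto (fun x => Real.exp (F x / 2)) (𝓝[>] 0) (𝓝 0)) :
    HasKernel (laplaceKernel A F) := by
  have hA := riccati_nonneg hf hR
  have hD := riccati_discriminant_nonneg hf hR
  have hY := isEulerBessel_exp hf hR hF
  set Y := fun x => Real.exp (F x / 2) with hYdef
  have hYpos : ∀ x, 0 < Y x := fun x => Real.exp_pos _
  have hYinv : ContDiffOn ℝ 2 (fun x => (Y x)⁻¹) (Ioi 0) :=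
    hY.contDiffOn.inv fun x _ => (hYpos x).ne'
  have hlog : ContDiffOn ℝ 2 Real.log (Ioi 0) := fun x hx =>
    (Real.contDiffAt_log.2 (ne_of_gt hx)).contDiffWithinAt
  have hterm : ∀ {μ : ℝ}, -1 < μ → ∀ c : ℝ, HasKernel (fun l x t =>
      (c * x ^ ((1 + μ) / 2) * (Y x)⁻¹) *
        seedTransform A (frobCoeff A μ) (fun s => s ^ (-(1 + μ))) l x t) := fun {μ} hμ c =>
    hasKernel_seedTransform hA (isSeed_gammaPow (by linarith)) (entireSeq_frobenius hμ)
      ((contDiffOn_const.mul (contDiffOn_rpow_const_Ioi _)).mul hYinv)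
  set ν := √(1 + 2 * B) with hν
  have hν0 : 0 ≤ ν := Real.sqrt_nonneg _
  have hν2 : ν ^ 2 = 1 + 2 * B := Real.sq_sqrt hD
  have hsq : ∀ {x t l : ℝ}, 0 < x → 0 < t → 0 ≤ l → 0 < 1 + l * t ∧ 0 < x / (1 + l * t) ^ 2 := by
    intro x t l hx ht hl
    have : 0 < 1 + l * t := by positivity
    exact ⟨this, by positivity⟩
  -- The hypothesis on `Y` at `0` is needed only for `1 ≤ ν`; for `ν < 1` any combination of the two
  -- basic solutions has a kernel.
  by_cases h1 : 1 ≤ ν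
  · obtain ⟨a, ha⟩ := eq_mul_frobenius_of_tendsto_zero hA h1 hν2 hY (fun x _ => hYpos x) h0
    refine (hterm (μ := ν) (by linarith) a).congr fun x hx t ht l hl => ?_
    obtain ⟨hs, hr⟩ := hsq hx ht hl
    have h2 := ha _ hr
    rw [div_sq_rpow hx hs] at h2
    rw [laplaceKernel_eq, seedTransform]
    change _ = _ * Y _ * _
    rw [h2]
    ring
  · rcases hν0.lt_or_eq with hpos | hzero
    · obtain ⟨a, b, hab⟩ := IsEulerBessel.exists_frobenius_combination hpos (not_le.1 h1) hν2 hY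
      refine ((hterm (μ := ν) (by linarith) a).add
        (hterm (μ := -ν) (by linarith [not_le.1 h1]) b)).congr fun x hx t ht l hl => ?_
      obtain ⟨hs, hr⟩ := hsq hx ht hl
      have h2 := hab _ hr
      rw [div_sq_rpow hx hs, div_sq_rpow hx hs] at h2
      rw [laplaceKernel_eq, seedTransform, seedTransform]
      change _ = _ * Y _ * _
      rw [h2]
      ring
    · have hB : 1 + 2 * B = 0 := by rw [← hν2, ← hzero]; norm_num
      obtain ⟨a, b, hab⟩ := exists_log_combination hB hY
      obtain ⟨C, K, hseed⟩ := isSeed_log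
      -- Since `log (x / s²) = log x - 2 log s`, the logarithmic solution splits: `log x` joins the
      -- coefficient in `x`, and `log s` is supplied by the logarithmic seed.
      have hk1 := hterm (μ := 0) (by norm_num) a
      have hk2 : HasKernel (fun l x t =>
          (b * x ^ ((1 + (0 : ℝ)) / 2) * (Y x)⁻¹ * Real.log x) *
            seedTransform A (frobCoeff A 0) (fun s => s ^ (-(1 + (0 : ℝ)))) l x t) :=
        hasKernel_seedTransform hA (isSeed_gammaPow (by norm_num))
          (entireSeq_frobenius (by norm_num))
          (((contDiffOn_const.mul (contDiffOn_rpow_const_Ioi _)).mul hYinv).mul hlog)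
      have hk3 : HasKernel (fun l x t =>
          (b * x ^ ((1 + (0 : ℝ)) / 2) * (Y x)⁻¹) *
            seedTransform A (frobeniusLog A) (fun s => s ^ (-(1 + (0 : ℝ)))) l x t) :=
        hasKernel_seedTransform hA (isSeed_gammaPow (by norm_num))
          (entireSeq_frobeniusLog A)
          ((contDiffOn_const.mul (contDiffOn_rpow_const_Ioi _)).mul hYinv)
      have hk4 : HasKernel (fun l x t =>
          (-2 * b * x ^ ((1 + (0 : ℝ)) / 2) * (Y x)⁻¹) *
            seedTransform A (frobCoeff A 0) (fun s => s⁻¹ * Real.log s) l x t) :=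
        hasKernel_seedTransform hA hseed
          (entireSeq_frobenius (by norm_num))
          ((contDiffOn_const.mul (contDiffOn_rpow_const_Ioi _)).mul hYinv)
      refine (((hk1.add hk2).add hk3).add hk4).congr fun x hx t ht l hl => ?_
      obtain ⟨hs, hr⟩ := hsq hx ht hl
      have h2 := hab _ hr
      have h3 : Real.log (x / (1 + l * t) ^ 2) = Real.log x - 2 * Real.log (1 + l * t) := by
        rw [Real.log_div hx.ne' (by positivity), Real.log_pow]; push_cast; ring
      have h4 : (1 + l * t) ^ (-(1 + (0 : ℝ))) = (1 + l * t)⁻¹ := by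
        rw [add_zero, Real.rpow_neg_one]
      rw [div_sq_rpow hx hs, h3, h4] at h2
      rw [laplaceKernel_eq, seedTransform, seedTransform, seedTransform, h4]
      change _ = _ * Y _ * _
      rw [h2]
      ring

theorem laplaceKernel_zero (A : ℝ) (F : ℝ → ℝ) (x t : ℝ) : laplaceKernel A F 0 x t = 1 := by
  simp [laplaceKernel]

/-- The Riccati equation, used at `x` and at `ξ = x / (1 + l t)²`, eliminates `f'` at both points;
what remains is an algebraic identity in the two values of `f`. -/
theorem isSolutionFamily_laplaceKernel {A B : ℝ} {f F : ℝ → ℝ}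
    (hf : ∀ x > 0, DifferentiableAt ℝ f x)
    (hR : ∀ x > 0, x * deriv f x - f x + (1 / 2) * f x ^ 2 = A * x + B)
    (hF : ∀ x > 0, HasDerivAt F (f x / x) x) : IsSolutionFamily f (laplaceKernel A F) := by
  intro l hl
  let Φ₁ : ℝ → ℝ → ℝ := fun x t => -l / (1 + l * t) - (f x - f (x / (1 + l * t) ^ 2)) / (2 * x)
  let Φ₂ : ℝ → ℝ → ℝ := fun x t =>
    -((deriv f x - deriv f (x / (1 + l * t) ^ 2) / (1 + l * t) ^ 2) * (2 * x) -
      (f x - f (x / (1 + l * t) ^ 2)) * 2) / (2 * x) ^ 2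
  refine ⟨fun x t => Φ₁ x t * laplaceKernel A F l x t,
    fun x t => (Φ₂ x t + Φ₁ x t ^ 2) * laplaceKernel A F l x t, fun x hx t ht => ?_⟩
  have hs : 0 < 1 + l * t := by positivity
  have hξ : 0 < x / (1 + l * t) ^ 2 := by positivity
  have dξ : HasDerivAt (fun x => x / (1 + l * t) ^ 2) (1 / (1 + l * t) ^ 2) x :=
    (hasDerivAt_id x).div_const _
  have hU : HasDerivAt (fun x => laplaceKernel A F l x t) (Φ₁ x t * laplaceKernel A F l x t) x := by
    have h1 : HasDerivAt (fun x => -(l * (x + A * t ^ 2 / 2)) / (1 + l * t)) (-(l * 1) / (1 + l * t)) x :=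
      ((((hasDerivAt_id x).add_const (A * t ^ 2 / 2)).const_mul l).neg).div_const _
    have h2 := ((hF x hx).sub ((hF _ hξ).comp x dξ)).const_mul (1 / 2)
    refine (h1.sub h2).exp.congr_deriv ?_
    rw [laplaceKernel, mul_comm]
    congr 1
    simp only [Φ₁]
    field_simp
  have hΦ : HasDerivAt (fun x => Φ₁ x t) (Φ₂ x t) x := by
    have h1 := (hf x hx).hasDerivAt.sub ((hf _ hξ).hasDerivAt.comp x dξ)
    have h2 : HasDerivAt (fun x : ℝ => 2 * x) (2 * 1) x := (hasDerivAt_id x).const_mul 2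
    refine ((h1.div h2 (by positivity)).const_sub (-l / (1 + l * t))).congr_deriv ?_
    simp only [Φ₂, Pi.sub_apply, Function.comp]
    field_simp
  refine ⟨hU, (hΦ.mul hU).congr_deriv (by ring), ?_⟩
  have ds : HasDerivAt (fun t => 1 + l * t) (l * 1) t := ((hasDerivAt_id t).const_mul l).const_add 1
  have h1 : HasDerivAt (fun t => -(l * (x + A * t ^ 2 / 2)) / (1 + l * t))
      ((-(l * (A * (2 * t) / 2)) * (1 + l * t) - -(l * (x + A * t ^ 2 / 2)) * (l * 1)) /
        (1 + l * t) ^ 2) t := by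
    have h2 : HasDerivAt (fun t : ℝ => t ^ 2) (2 * t) t := by
      simpa using hasDerivAt_pow 2 t
    exact ((((h2.const_mul A).div_const 2).const_add x).const_mul l).neg.div ds hs.ne'
  have h3 : HasDerivAt (fun t => x / (1 + l * t) ^ 2)
      (-(x * (2 * (1 + l * t) * (l * 1))) / ((1 + l * t) ^ 2) ^ 2) t := by
    have h4 : HasDerivAt (fun t => (1 + l * t) ^ 2) (2 * (1 + l * t) * (l * 1)) t := by
      exact (ds.pow 2).congr_deriv (by simp)
    refine ((hasDerivAt_const t x).div h4 (by positivity)).congr_deriv ?_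
    ring
  have h5 := (((hF _ hξ).comp t h3).const_sub (F x)).const_mul (1 / 2)
  refine (h1.sub h5).exp.congr_deriv ?_
  change laplaceKernel A F l x t * _ = _
  have ha := hR x hx
  have hb := hR _ hξ
  have ha' : deriv f x = (A * x + B + f x - (1 / 2) * f x ^ 2) / x := by
    rw [eq_div_iff hx.ne']; linarith
  have hb' : deriv f (x / (1 + l * t) ^ 2) = (A * (x / (1 + l * t) ^ 2) + B +
      f (x / (1 + l * t) ^ 2) - (1 / 2) * f (x / (1 + l * t) ^ 2) ^ 2) / (x / (1 + l * t) ^ 2) := by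
    rw [eq_div_iff hξ.ne']; linarith
  have key : ∀ U : ℝ, x * ((Φ₂ x t + Φ₁ x t ^ 2) * U) + f x * (Φ₁ x t * U) =
      U * (x * Φ₂ x t + x * Φ₁ x t ^ 2 + f x * Φ₁ x t) := fun U => by ring
  rw [key]
  congr 1
  simp only [Φ₁, Φ₂]
  rw [ha', hb']
  generalize f (x / (1 + l * t) ^ 2) = b
  generalize f x = a
  field_simp
  ring

/-! ### Contour shifts and the Gamma integral along a ray. -/

/-- Shifting the line of integration of a holomorphic function in a strip. -/
theorem integral_strip_eq {H : ℂ → ℂ} {θ : ℝ} {g : ℝ → ℝ}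
    (hc : ContinuousOn H {w | w.im ∈ uIcc 0 θ})
    (hd : ∀ w : ℂ, w.im ∈ Ioo (min 0 θ) (max 0 θ) → DifferentiableAt ℂ H w)
    (hg : Integrable g) (hbot : Tendsto g atBot (𝓝 0)) (htop : Tendsto g atTop (𝓝 0))
    (hb : ∀ w : ℂ, w.im ∈ uIcc 0 θ → ‖H w‖ ≤ g w.re) :
    ∫ x : ℝ, H x = ∫ x : ℝ, H (x + θ * Complex.I) := by
  have hline : ∀ y ∈ uIcc 0 θ, Integrable fun x : ℝ => H (x + y * Complex.I) := by
    intro y hy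
    refine hg.mono' (Continuous.aestronglyMeasurable ?_) (Eventually.of_forall fun x => ?_)
    · exact hc.comp_continuous (by fun_prop) fun x => by simpa using hy
    · simpa using hb (x + y * Complex.I) (by simpa using hy)
  have h0 := hline 0 left_mem_uIcc
  have h1 := hline θ right_mem_uIcc
  simp only [Complex.ofReal_zero, zero_mul, add_zero] at h0
  have hside : ∀ {l : Filter ℝ}, Tendsto g l (𝓝 0) →
      Tendsto (fun R : ℝ => ∫ y in (0 : ℝ)..θ, H (R + y * Complex.I)) l (𝓝 0) := by
    intro l hl
    refine squeeze_zero_norm (a := fun R => g R * |θ - 0|) (fun R => ?_) (by simpa using hl.mul_const _)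
    refine intervalIntegral.norm_integral_le_of_norm_le_const fun y hy => ?_
    simpa using hb (R + y * Complex.I) (by simpa using uIoc_subset_uIcc hy)
  have key : ∀ R : ℝ, (∫ x in (-R)..R, H x) - (∫ x in (-R)..R, H (x + θ * Complex.I)) =
      Complex.I * (∫ y in (0 : ℝ)..θ, H ((-R : ℝ) + y * Complex.I)) -
        Complex.I * ∫ y in (0 : ℝ)..θ, H (R + y * Complex.I) := by
    intro R
    have h := Complex.integral_boundary_rect_eq_zero_of_continuousOn_of_differentiableOn H
      (⟨-R, 0⟩ : ℂ) ⟨R, θ⟩ (hc.mono fun w hw => hw.2)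
      (fun w hw => (hd w hw.2).differentiableWithinAt)
    simp only [Complex.ofReal_zero, zero_mul, add_zero, smul_eq_mul] at h
    linear_combination h
  have t1 := (intervalIntegral_tendsto_integral h0 tendsto_neg_atTop_atBot tendsto_id).sub
    (intervalIntegral_tendsto_integral h1 tendsto_neg_atTop_atBot tendsto_id)
  have t2 := (((hside hbot).comp tendsto_neg_atTop_atBot).const_mul Complex.I).sub
    ((hside htop).const_mul Complex.I)
  simp only [id, mul_zero, sub_zero] at t1 t2
  exact sub_eq_zero.1 (tendsto_nhds_unique (t1.congr key) t2)

theorem integral_comp_exp_real {E : Type*} [NormedAddCommGroup E] [NormedSpace ℝ E] (g : ℝ → E) :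
    ∫ x : ℝ, Real.exp x • g (Real.exp x) = ∫ y in Ioi (0 : ℝ), g y := by
  have h := integral_image_eq_integral_abs_deriv_smul (s := univ) (f := Real.exp) (f' := Real.exp)
    MeasurableSet.univ (fun x _ => (Real.hasDerivAt_exp x).hasDerivWithinAt)
    (Real.exp_injective.injOn) g
  rw [image_univ, Real.range_exp] at h
  rw [h]
  simp

theorem integrable_comp_exp_real {E : Type*} [NormedAddCommGroup E] [NormedSpace ℝ E] (g : ℝ → E) :
    Integrable (fun x : ℝ => Real.exp x • g (Real.exp x)) ↔ IntegrableOn g (Ioi 0) := by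
  have h := integrableOn_image_iff_integrableOn_abs_deriv_smul (s := univ) (f := Real.exp)
    (f' := Real.exp) MeasurableSet.univ (fun x _ => (Real.hasDerivAt_exp x).hasDerivWithinAt)
    (Real.exp_injective.injOn) g
  rw [image_univ, Real.range_exp] at h
  rw [h]
  simp

theorem integrableOn_rpow_mul_exp_neg_mul {a c : ℝ} (ha : 0 < a) (hc : 0 < c) :
    IntegrableOn (fun ρ => ρ ^ (a - 1) * Real.exp (-(c * ρ))) (Ioi 0) := by
  have := integrableOn_rpow_mul_exp_neg_mul_rpow (p := 1) (s := a - 1) (b := c) (by linarith)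
    one_pos hc
  simpa [neg_mul] using this

/-- The Gamma integral along a ray in the right half-plane. -/
theorem integral_rpow_mul_cexp_neg_mul {a r φ : ℝ} (ha : 0 < a) (hr : 0 < r)
    (hφ : |φ| < π / 2) :
    ∫ ρ in Ioi (0 : ℝ), ((ρ ^ (a - 1) : ℝ) : ℂ) *
        Complex.exp (-(r * Complex.exp (φ * Complex.I) * ρ)) =
      Complex.exp (-(a * φ * Complex.I)) * (r ^ (-a) * Real.Gamma a : ℝ) := by
  have hcos : 0 < Real.cos φ := Real.cos_pos_of_mem_Ioo ⟨by linarith [(abs_lt.1 hφ).1], (abs_lt.1 hφ).2⟩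
  have hval : ∫ ρ in Ioi (0 : ℝ), ρ ^ (a - 1) * Real.exp (-(r * ρ)) = r ^ (-a) * Real.Gamma a := by
    rw [Real.integral_rpow_mul_exp_neg_mul_Ioi ha hr, one_div, Real.inv_rpow hr.le,
      Real.rpow_neg hr.le]
  have hpow : ∀ x : ℝ, Real.exp x * Real.exp x ^ (a - 1) = Real.exp (a * x) := by
    intro x
    rw [← Real.exp_mul, ← Real.exp_add]
    ring_nf
  -- After `ρ = e^w`, rotating the ray by `φ` becomes translating the real line by `i φ`.
  let H : ℂ → ℂ := fun w => Complex.exp (a * w) * Complex.exp (-(r * Complex.exp w))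
  let g : ℝ → ℝ := fun x => Real.exp (a * x) * Real.exp (-(r * Real.cos φ * Real.exp x))
  have hH : Differentiable ℂ H := by fun_prop
  have h := integral_strip_eq (H := H) (θ := φ) (g := g) hH.continuous.continuousOn
    (fun w _ => hH w) ?_ ?_ ?_ ?_
  · have e1 : ∫ x : ℝ, H x = (r ^ (-a) * Real.Gamma a : ℝ) := by
      rw [← hval, ← integral_comp_exp_real, ← integral_complex_ofReal]
      refine integral_congr_ae (Eventually.of_forall fun x => ?_)
      simp only [smul_eq_mul, ← mul_assoc, hpow, H]
      push_cast
      ring_nf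
    have e2 : ∫ x : ℝ, H (x + φ * Complex.I) = Complex.exp (a * φ * Complex.I) *
        ∫ ρ in Ioi (0 : ℝ), ((ρ ^ (a - 1) : ℝ) : ℂ) *
          Complex.exp (-(r * Complex.exp (φ * Complex.I) * ρ)) := by
      rw [← integral_comp_exp_real, ← integral_const_mul]
      refine integral_congr_ae (Eventually.of_forall fun x => ?_)
      simp only [H, Complex.real_smul, ← mul_assoc]
      rw [mul_assoc (Complex.exp _) (Real.exp x : ℂ), ← Complex.ofReal_mul (Real.exp x), hpow]
      rw [mul_add, Complex.exp_add, Complex.exp_add]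
      push_cast
      ring_nf
    rw [← e1, h, e2, ← mul_assoc, ← Complex.exp_add]
    simp
  · have := (integrable_comp_exp_real _).2 (integrableOn_rpow_mul_exp_neg_mul ha (mul_pos hr hcos))
    refine this.congr (Eventually.of_forall fun x => ?_)
    simp only [smul_eq_mul, ← mul_assoc, hpow, g]
  · have t1 : Tendsto (fun x : ℝ => Real.exp (a * x)) atBot (𝓝 0) :=
      Real.tendsto_exp_atBot.comp (tendsto_id.const_mul_atBot ha)
    refine squeeze_zero (fun x => by positivity) (fun x => ?_) t1
    exact mul_le_of_le_one_right (Real.exp_pos _).le (Real.exp_le_one_iff.2 (by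
      have := Real.exp_pos x
      have : 0 ≤ r * Real.cos φ * Real.exp x := by positivity
      linarith))
  · refine ((tendsto_rpow_mul_exp_neg_mul_atTop_nhds_zero a _ (mul_pos hr hcos)).comp
      Real.tendsto_exp_atTop).congr fun x => ?_
    simp only [Function.comp, g, ← Real.exp_mul, neg_mul]
    rw [mul_comm x a]
  · intro w hw
    simp only [H, g, norm_mul, Complex.norm_exp]
    have e3 : ((a : ℂ) * w).re = a * w.re := by simp
    have e4 : (-((r : ℂ) * Complex.exp w)).re = -(r * (Real.exp w.re * Real.cos w.im)) := by
      simp [Complex.exp_re]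
    rw [e3, e4]
    refine mul_le_mul_of_nonneg_left (Real.exp_le_exp.2 (neg_le_neg ?_)) (Real.exp_pos _).le
    have : Real.cos φ ≤ Real.cos w.im := by
      rw [← Real.cos_abs φ, ← Real.cos_abs w.im]
      refine Real.cos_le_cos_of_nonneg_of_le_pi (abs_nonneg _) (by linarith [Real.pi_pos]) ?_
      rcases le_total 0 φ with h0 | h0
      · rw [uIcc_of_le h0] at hw
        rw [abs_of_nonneg hw.1, abs_of_nonneg h0]; exact hw.2
      · rw [uIcc_of_ge h0] at hw
        rw [abs_of_nonpos hw.2, abs_of_nonpos h0]; linarith [hw.1]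
    have := mul_le_mul_of_nonneg_left this (mul_pos hr (Real.exp_pos w.re)).le
    linarith

/-- This is the reflection formula, which also holds at the poles of `Γ (1 - w)`: there `Γ` has the
default value `0`, and the sine vanishes. -/
theorem inv_Gamma_one_sub {w : ℝ} (hw : 0 < w) :
    (Real.Gamma (1 - w))⁻¹ = Real.Gamma w * Real.sin (π * w) / π := by
  have h := Real.Gamma_mul_Gamma_one_sub w
  have hG := Real.Gamma_pos_of_pos hw
  rcases eq_or_ne (Real.Gamma (1 - w)) 0 with h0 | h0
  · rw [h0, mul_zero, eq_comm, div_eq_zero_iff] at h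
    rcases h with h | h
    · exact absurd h Real.pi_ne_zero
    · simp [h0, h]
  · have hs : Real.sin (π * w) ≠ 0 := by
      intro hc
      rw [hc, div_zero, mul_eq_zero] at h
      exact h.elim hG.ne' h0
    rw [eq_div_iff hs] at h
    rw [inv_eq_iff_eq_inv, inv_div, eq_div_iff (mul_ne_zero hG.ne' hs)]
    linarith

/-! ### The Wright functions: convergence, ray representation, decay. -/

/-- The coefficients of the series `∑ (-r)^k / (k! Γ(1 - (n + k) β))`. -/
noncomputable def wrightCoeff (β : ℝ) (n k : ℕ) : ℝ :=
  (-1) ^ k / ((k.factorial : ℝ) * Real.Gamma (1 - (n + k) * β))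

/-- Log-convexity gives `Γ (w + β) ≤ Γ (w) w ^ β`, so the ratio of consecutive coefficients is at
most a constant times `(k + 1) ^ (β - 1)`, which tends to `0`. -/
theorem entireSeq_Gamma {β : ℝ} (h0 : 0 < β) (h1 : β < 1) {n : ℕ} (hn : 1 ≤ n) :
    EntireSeq fun k => Real.Gamma ((n + k) * β) / (k.factorial : ℝ) := by
  have hn' : (1 : ℝ) ≤ n := by exact_mod_cast hn
  refine EntireSeq.of_ratio (q := fun k => (n * β) ^ β * ((k : ℝ) + 1) ^ (-(1 - β))) ?_ fun k => ?_
  · have h2 := (tendsto_rpow_neg_atTop (y := 1 - β) (by linarith)).comp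
      (tendsto_natCast_atTop_atTop.atTop_add (tendsto_const_nhds (x := (1 : ℝ))))
    simpa [Function.comp_def] using h2.const_mul ((n * β) ^ β)
  · set w := ((n : ℝ) + k) * β with hw
    have hw0 : 0 < w := by positivity
    have hG := Real.Gamma_pos_of_pos hw0
    have h2 : Real.Gamma (w + β) ≤ Real.Gamma w * w ^ β := by
      have := Real.Gamma_mul_add_mul_le_rpow_Gamma_mul_rpow_Gamma hw0 (t := w + 1) (by linarith)
        (a := 1 - β) (b := β) (by linarith) h0 (by ring)
      rw [Real.Gamma_add_one hw0.ne', Real.mul_rpow hw0.le hG.le] at this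
      calc _ = Real.Gamma ((1 - β) * w + β * (w + 1)) := by ring_nf
        _ ≤ _ := this
        _ = (Real.Gamma w ^ (1 - β) * Real.Gamma w ^ β) * w ^ β := by ring
        _ = _ := by rw [← Real.rpow_add hG]; norm_num
    have h3 : w ^ β ≤ (n * β) ^ β * ((k : ℝ) + 1) ^ β := by
      rw [← Real.mul_rpow (by positivity) (by positivity)]
      refine Real.rpow_le_rpow hw0.le ?_ h0.le
      have : (k : ℝ) ≤ n * k := le_mul_of_one_le_left (by positivity) hn'
      rw [hw]
      nlinarith
    have e1 : ((n : ℝ) + (k + 1 : ℕ)) * β = w + β := by rw [hw]; push_cast; ring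
    rw [e1, abs_of_nonneg (by have := Real.Gamma_pos_of_pos (show 0 < w + β by linarith); positivity),
      abs_of_nonneg (by positivity)]
    have e2 : ((k : ℝ) + 1) ^ (-(1 - β)) = ((k : ℝ) + 1) ^ β / (k + 1) := by
      rw [show -(1 - β) = β - 1 by ring, Real.rpow_sub_one (by positivity)]
    rw [e2, Nat.factorial_succ]
    push_cast
    rw [div_le_iff₀ (by positivity)]
    calc _ ≤ Real.Gamma w * w ^ β := h2
      _ ≤ Real.Gamma w * ((n * β) ^ β * ((k : ℝ) + 1) ^ β) := by gcongr
      _ = _ := by field_simp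

theorem wrightCoeff_eq {β : ℝ} (h0 : 0 < β) {n : ℕ} (hn : 1 ≤ n) (k : ℕ) : wrightCoeff β n k =
    (-1) ^ k * (Real.Gamma ((n + k) * β) / (k.factorial : ℝ)) *
      (Real.sin (π * ((n + k) * β)) / π) := by
  rw [wrightCoeff, div_eq_mul_inv, mul_inv, inv_Gamma_one_sub (by positivity)]
  ring

theorem entireSeq_wrightCoeff {β : ℝ} (h0 : 0 < β) (h1 : β < 1) {n : ℕ} (hn : 1 ≤ n) :
    EntireSeq (wrightCoeff β n) := by
  intro r
  refine Summable.of_nonneg_of_le (fun k => by positivity) (fun k => ?_) (entireSeq_Gamma h0 h1 hn r)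
  refine mul_le_mul_of_nonneg_right ?_ (by positivity)
  rw [wrightCoeff_eq h0 hn, abs_mul, abs_mul, abs_pow, abs_neg, abs_one, one_pow, one_mul]
  refine mul_le_of_le_one_right (abs_nonneg _) ?_
  rw [abs_div, abs_of_pos Real.pi_pos, div_le_one Real.pi_pos]
  exact (Real.abs_sin_le_one _).trans (by linarith [Real.pi_gt_three])

/-- `∑ (-r)^k / (k! Γ(1 - (n + k) β))`. -/
noncomputable def wrightM (β : ℝ) (n : ℕ) (r : ℝ) : ℝ := entireSum (wrightCoeff β n) r

/-- Only the sum `n + k` enters the Gamma factor, so the shift of `k` under differentiation is a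
shift of `n`. This is the reason for introducing the whole family. -/
theorem hasDerivAt_wrightM {β : ℝ} (h0 : 0 < β) (h1 : β < 1) {n : ℕ} (hn : 1 ≤ n) (r : ℝ) :
    HasDerivAt (wrightM β n) (-wrightM β (n + 1) r) r := by
  refine (hasDerivAt_entireSum (entireSeq_wrightCoeff h0 h1 hn) r).congr_deriv ?_
  rw [wrightM, entireSum, entireSum, ← tsum_neg]
  refine tsum_congr fun k => ?_
  rw [derivSeq, wrightCoeff, wrightCoeff, Nat.factorial_succ]
  push_cast
  rw [show (1 : ℝ) - (n + (k + 1)) * β = 1 - (n + 1 + k) * β by ring, pow_succ]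
  have : (k : ℝ) + 1 ≠ 0 := by positivity
  have : (k.factorial : ℝ) ≠ 0 := by positivity
  rcases eq_or_ne (Real.Gamma (1 - (n + 1 + k) * β)) 0 with h | h
  · simp [h]
  · field_simp

theorem continuous_wrightM {β : ℝ} (h0 : 0 < β) (h1 : β < 1) {n : ℕ} (hn : 1 ≤ n) :
    Continuous (wrightM β n) := continuous_entireSum (entireSeq_wrightCoeff h0 h1 hn)

theorem wrightM_one_zero (β : ℝ) : wrightM β 1 0 = (Real.Gamma (1 - β))⁻¹ := by
  rw [wrightM, entireSum, tsum_eq_single 0 (fun k hk => by simp [hk])]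
  simp [wrightCoeff]

theorem wrightDensity_eq (β s : ℝ) {t : ℝ} (ht : 0 < t) :
    wrightDensity β s t = t ^ (-β) * wrightM β 1 (s / t ^ β) := by
  rw [wrightDensity, wright, wrightM, entireSum, one_div, Real.rpow_neg ht.le]
  congr 1
  refine tsum_congr fun k => ?_
  rw [wrightCoeff, neg_pow, show -β * k + (1 - β) = 1 - ((1 : ℕ) + k) * β by push_cast; ring]
  ring

/-- The integrand of the representation of `wrightM` by an integral along a ray. -/
noncomputable def rayIntegrand (β θ : ℝ) (n : ℕ) (s t ρ : ℝ) : ℂ :=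
  Complex.exp (n * (β * θ) * Complex.I) * ((ρ ^ (n * β - 1) : ℝ) : ℂ) *
    Complex.exp (t * Complex.exp (θ * Complex.I) * ρ) *
    Complex.exp (-(s * Complex.exp (β * θ * Complex.I) * (ρ ^ β : ℝ)))

/-- Expanding the last exponential gives Gamma integrals along a ray of angle `θ - π`, convergent
because `θ > π / 2`. Each contributes the phase `exp (i π (n + k) β)`, and its imaginary part turns
`Γ ((n + k) β)` into a reciprocal Gamma value by reflection. -/
theorem im_integral_rayIntegrand {β θ : ℝ} (h0 : 0 < β) (h1 : β < 1) (hθ : π / 2 < θ) (hθ' : θ < π)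
    {n : ℕ} (hn : 1 ≤ n) (s : ℝ) {t : ℝ} (ht : 0 < t) :
    (∫ ρ in Ioi (0 : ℝ), rayIntegrand β θ n s t ρ).im =
      π * (t ^ (-(n * β)) * wrightM β n (s / t ^ β)) := by
  have hn' : (1 : ℝ) ≤ n := by exact_mod_cast hn
  set c := -(t * Real.cos θ) with hc
  have hc0 : 0 < c := by
    have := Real.cos_neg_of_pi_div_two_lt_of_lt hθ (by linarith)
    rw [hc]; nlinarith
  let T : ℕ → ℝ → ℂ := fun k ρ =>
    (Complex.exp (n * (β * θ) * Complex.I) * ((-s) ^ k * Complex.exp (k * (β * θ) * Complex.I) /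
      (k.factorial : ℝ))) * (((ρ ^ ((n + k) * β - 1) : ℝ) : ℂ) *
        Complex.exp (-(t * Complex.exp ((θ - π : ℝ) * Complex.I) * ρ)))
  have hexp : Complex.exp ((θ - π : ℝ) * Complex.I) = -Complex.exp (θ * Complex.I) := by
    push_cast
    rw [sub_mul, Complex.exp_sub_pi_mul_I]
  have hw : ∀ k : ℕ, 0 < ((n : ℝ) + k) * β := fun k => by positivity
  have hnorm : ∀ k ρ, 0 < ρ → ‖T k ρ‖ = |s| ^ k / (k.factorial : ℝ) *
      (ρ ^ ((n + k) * β - 1) * Real.exp (-(c * ρ))) := by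
    intro k ρ hρ
    have e1 : ‖Complex.exp (n * (β * θ) * Complex.I)‖ = 1 := by
      simp [Complex.norm_exp]
    have e2 : ‖Complex.exp (k * (β * θ) * Complex.I)‖ = 1 := by
      simp [Complex.norm_exp]
    have e3 : (-((t : ℂ) * Complex.exp ((θ - π : ℝ) * Complex.I) * ρ)).re = -(c * ρ) := by
      rw [hexp, hc]
      simp [Complex.exp_re]
    simp only [T]
    rw [norm_mul, norm_mul, norm_div, norm_mul, norm_mul, norm_pow, norm_neg, e1, e2,
      Complex.norm_exp, e3, Complex.norm_real, Complex.norm_real, Complex.norm_real,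
      Real.norm_of_nonneg (Real.rpow_nonneg hρ.le _), Real.norm_of_nonneg (Nat.cast_nonneg _)]
    simp
  have hI : ∀ k : ℕ, IntegrableOn (fun ρ => ρ ^ (((n : ℝ) + k) * β - 1) * Real.exp (-(c * ρ))) (Ioi 0) :=
    fun k => integrableOn_rpow_mul_exp_neg_mul (hw k) hc0
  have hmeas : ∀ k, AEStronglyMeasurable (T k) (volume.restrict (Ioi 0)) := by
    intro k
    refine ContinuousOn.aestronglyMeasurable (fun ρ hρ => ?_) measurableSet_Ioi
    have : ContinuousAt (fun ρ : ℝ => ρ ^ (((n : ℝ) + k) * β - 1)) ρ :=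
      Real.continuousAt_rpow_const _ _ (Or.inl (ne_of_gt hρ))
    refine ContinuousAt.continuousWithinAt ?_
    refine continuousAt_const.mul (ContinuousAt.mul ?_ (by fun_prop))
    exact Complex.continuous_ofReal.continuousAt.comp this
  have hTi : ∀ k, Integrable (T k) (volume.restrict (Ioi 0)) := fun k =>
    ((hI k).const_mul (|s| ^ k / (k.factorial : ℝ))).mono' (hmeas k)
      ((ae_restrict_iff' measurableSet_Ioi).2 (Eventually.of_forall fun ρ hρ => (hnorm k ρ hρ).le))
  have hTs : Summable fun k => ∫ ρ in Ioi (0 : ℝ), ‖T k ρ‖ := by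
    refine ((entireSeq_Gamma h0 h1 hn (|s| / c ^ β)).mul_left (c ^ (-(n * β)))).congr fun k => ?_
    rw [setIntegral_congr_fun measurableSet_Ioi (fun ρ hρ => hnorm k ρ hρ), integral_const_mul,
      Real.integral_rpow_mul_exp_neg_mul_Ioi (hw k) hc0,
      abs_of_nonneg (div_nonneg (Real.Gamma_pos_of_pos (hw k)).le (Nat.cast_nonneg _)),
      abs_of_nonneg (by positivity : 0 ≤ |s| / c ^ β), one_div, Real.inv_rpow hc0.le,
      ← Real.rpow_neg hc0.le, add_mul, neg_add, Real.rpow_add hc0, div_pow, ← Real.rpow_natCast (c ^ β),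
      ← Real.rpow_mul hc0.le, mul_comm β, Real.rpow_neg hc0.le (k * β)]
    ring
  have hsum := hasSum_integral_of_summable_integral_norm hTi hTs
  have hS : ∫ ρ in Ioi (0 : ℝ), ∑' k, T k ρ = ∫ ρ in Ioi (0 : ℝ), rayIntegrand β θ n s t ρ := by
    refine setIntegral_congr_fun measurableSet_Ioi fun ρ hρ => ?_
    have hρ : 0 < ρ := hρ
    simp only [rayIntegrand]
    have hz : ∀ z : ℂ, Complex.exp z = ∑' k : ℕ, z ^ k / (k.factorial : ℂ) := fun z => by
      rw [Complex.exp_eq_exp_ℂ, NormedSpace.exp_eq_tsum_div]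
    rw [hz (-(s * Complex.exp (β * θ * Complex.I) * (ρ ^ β : ℝ))), ← tsum_mul_left]
    refine tsum_congr fun k => ?_
    simp only [T]
    have e1 : ρ ^ (((n : ℝ) + k) * β - 1) = ρ ^ (n * β - 1) * (ρ ^ β) ^ k := by
      rw [← Real.rpow_natCast, ← Real.rpow_mul hρ.le, ← Real.rpow_add hρ]
      ring_nf
    have e2 : Complex.exp (k * (β * θ) * Complex.I) = Complex.exp (β * θ * Complex.I) ^ k := by
      rw [← Complex.exp_nat_mul]; ring_nf
    rw [hexp, e1, e2, show -((t : ℂ) * -Complex.exp (θ * Complex.I) * ρ) =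
      t * Complex.exp (θ * Complex.I) * ρ by ring,
      show -((s : ℂ) * Complex.exp (β * θ * Complex.I) * (ρ ^ β : ℝ)) =
        -s * Complex.exp (β * θ * Complex.I) * (ρ ^ β : ℝ) by ring, mul_pow, mul_pow]
    push_cast
    ring
  rw [hS] at hsum
  have him := Complex.imCLM.hasSum hsum
  simp only [Complex.imCLM_apply] at him
  rw [← him.tsum_eq, wrightM, entireSum, ← tsum_mul_left, ← tsum_mul_left]
  refine tsum_congr fun k => ?_
  have hθπ : |θ - π| < π / 2 := by rw [abs_lt]; constructor <;> linarith
  simp only [T]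
  rw [integral_const_mul, integral_rpow_mul_cexp_neg_mul (hw k) ht hθπ]
  have e1 : Complex.exp (n * (β * θ) * Complex.I) * ((-s) ^ k * Complex.exp (k * (β * θ) * Complex.I) /
      (k.factorial : ℝ)) * (Complex.exp (-((((n : ℝ) + k) * β : ℝ) * (θ - π : ℝ) * Complex.I)) *
        (t ^ (-(((n : ℝ) + k) * β)) * Real.Gamma ((n + k) * β) : ℝ)) =
      (((-s) ^ k / (k.factorial : ℝ) * (t ^ (-(((n : ℝ) + k) * β)) * Real.Gamma ((n + k) * β)) : ℝ) : ℂ) *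
        Complex.exp ((π * ((n + k) * β) : ℝ) * Complex.I) := by
    have : Complex.exp ((π * ((n + k) * β) : ℝ) * Complex.I) = Complex.exp (n * (β * θ) * Complex.I) *
        Complex.exp (k * (β * θ) * Complex.I) *
        Complex.exp (-((((n : ℝ) + k) * β : ℝ) * (θ - π : ℝ) * Complex.I)) := by
      rw [← Complex.exp_add, ← Complex.exp_add]
      push_cast
      ring_nf
    rw [this]
    push_cast
    ring
  have e2 : t ^ (-(((n : ℝ) + k) * β)) = t ^ (-(n * β)) * ((t ^ β) ^ k)⁻¹ := by
    rw [← Real.rpow_natCast, ← Real.rpow_mul ht.le, ← Real.rpow_neg ht.le, ← Real.rpow_add ht]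
    ring_nf
  rw [e1, Complex.im_ofReal_mul, Complex.exp_ofReal_mul_I_im, wrightCoeff_eq h0 hn, e2, neg_pow, div_pow]
  have := Real.pi_ne_zero
  field_simp

/-- The factor of `rayIntegrand` that does not depend on `t`. -/
noncomputable def rayKernel (β θ : ℝ) (n : ℕ) (s ρ : ℝ) : ℂ :=
  Complex.exp (n * (β * θ) * Complex.I) * ((ρ ^ (n * β - 1) : ℝ) : ℂ) *
    Complex.exp (-(s * Complex.exp (β * θ * Complex.I) * (ρ ^ β : ℝ)))

theorem rayIntegrand_eq (β θ : ℝ) (n : ℕ) (s t ρ : ℝ) : rayIntegrand β θ n s t ρ =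
    rayKernel β θ n s ρ * Complex.exp (t * Complex.exp (θ * Complex.I) * ρ) := by
  rw [rayIntegrand, rayKernel]
  ring

theorem norm_rayKernel (β θ : ℝ) (n : ℕ) (s : ℝ) {ρ : ℝ} (hρ : 0 < ρ) :
    ‖rayKernel β θ n s ρ‖ = ρ ^ (n * β - 1) * Real.exp (-(s * Real.cos (β * θ)) * ρ ^ β) := by
  have e1 : ‖Complex.exp (n * (β * θ) * Complex.I)‖ = 1 := by simp [Complex.norm_exp]
  have e3 : (-((s : ℂ) * Complex.exp (β * θ * Complex.I) * (ρ ^ β : ℝ))).re =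
      -(s * Real.cos (β * θ)) * ρ ^ β := by
    simp [Complex.exp_re]
  rw [rayKernel, norm_mul, norm_mul, e1, Complex.norm_exp, e3, Complex.norm_real,
    Real.norm_of_nonneg (Real.rpow_nonneg hρ.le _), one_mul]

theorem continuousOn_rayKernel (β θ : ℝ) (n : ℕ) (s : ℝ) :
    ContinuousOn (rayKernel β θ n s) (Ioi 0) := by
  have h : ∀ a : ℝ, ContinuousOn (fun ρ : ℝ => ((ρ ^ a : ℝ) : ℂ)) (Ioi 0) := fun a =>
    Complex.continuous_ofReal.comp_continuousOn fun ρ hρ =>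
      (Real.continuousAt_rpow_const _ _ (Or.inl (ne_of_gt hρ))).continuousWithinAt
  exact (continuousOn_const.mul (h _)).mul
    (Complex.continuous_exp.comp_continuousOn ((continuousOn_const.mul (h β)).neg))

theorem integrableOn_rayKernel {β θ : ℝ} (h0 : 0 < β) (hθ : |β * θ| < π / 2) {n : ℕ} (hn : 1 ≤ n)
    {s : ℝ} (hs : 0 < s) : IntegrableOn (rayKernel β θ n s) (Ioi 0) := by
  have hn' : (1 : ℝ) ≤ n := by exact_mod_cast hn
  have hcos : 0 < Real.cos (β * θ) :=
    Real.cos_pos_of_mem_Ioo ⟨by linarith [(abs_lt.1 hθ).1], (abs_lt.1 hθ).2⟩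
  have h := integrableOn_rpow_mul_exp_neg_mul_rpow (p := β) (s := n * β - 1)
    (b := s * Real.cos (β * θ)) (by nlinarith) h0 (mul_pos hs hcos)
  exact h.mono' ((continuousOn_rayKernel β θ n s).aestronglyMeasurable measurableSet_Ioi)
    ((ae_restrict_iff' measurableSet_Ioi).2 (Eventually.of_forall fun ρ hρ =>
      (norm_rayKernel β θ n s hρ).le))

/-- In the variable `ρ ^ β` this is a Gamma integral along a ray of angle `β θ`, whose phase is
cancelled by the prefactor. Being real, it can be subtracted from the ray representation without
changing the imaginary part. -/
theorem im_integral_rayKernel {β θ : ℝ} (h0 : 0 < β) (hθ : |β * θ| < π / 2) {n : ℕ} (hn : 1 ≤ n)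
    {s : ℝ} (hs : 0 < s) : (∫ ρ in Ioi (0 : ℝ), rayKernel β θ n s ρ).im = 0 := by
  have hn' : (0 : ℝ) < n := by exact_mod_cast hn
  have h1 := integral_rpow_mul_cexp_neg_mul hn' hs hθ
  rw [← integral_comp_rpow_Ioi_of_pos h0] at h1
  have h2 : ∫ ρ in Ioi (0 : ℝ), rayKernel β θ n s ρ =
      Complex.exp (n * (β * θ) * Complex.I) / β * (Complex.exp (-((n : ℝ) * (β * θ : ℝ) * Complex.I)) *
        (s ^ (-(n : ℝ)) * Real.Gamma n : ℝ)) := by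
    rw [← h1, ← integral_const_mul]
    refine setIntegral_congr_fun measurableSet_Ioi fun ρ hρ => ?_
    have hρ : 0 < ρ := hρ
    have e1 : ρ ^ ((n : ℝ) * β - 1) = ρ ^ (β - 1) * (ρ ^ β) ^ ((n : ℝ) - 1) := by
      rw [← Real.rpow_mul hρ.le, ← Real.rpow_add hρ]
      ring_nf
    have : (β : ℂ) ≠ 0 := by exact_mod_cast h0.ne'
    simp only [rayKernel, Complex.real_smul]
    rw [e1]
    push_cast
    field_simp
  rw [h2]
  have : Complex.exp (n * (β * θ) * Complex.I) / β * (Complex.exp (-((n : ℝ) * (β * θ : ℝ) * Complex.I)) *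
        (s ^ (-(n : ℝ)) * Real.Gamma n : ℝ)) = ((s ^ (-(n : ℝ)) * Real.Gamma n / β : ℝ) : ℂ) := by
    have : Complex.exp (n * (β * θ) * Complex.I) * Complex.exp (-((n : ℝ) * (β * θ : ℝ) * Complex.I)) = 1 := by
      rw [← Complex.exp_add, Complex.exp_eq_one_iff]
      exact ⟨0, by push_cast; ring⟩
    push_cast at this ⊢
    linear_combination ((s ^ (-(n : ℝ)) : ℝ) * (Real.Gamma n : ℝ) / β : ℂ) * this
  rw [this, Complex.ofReal_im]

theorem norm_exp_ray_sub_one_le {θ t ρ : ℝ} (hθ : Real.cos θ ≤ 0) (ht : 0 ≤ t) (hρ : 0 ≤ ρ) :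
    ‖Complex.exp (t * Complex.exp (θ * Complex.I) * ρ) - 1‖ ≤ 2 * (t * ρ) ∧
      ‖Complex.exp (t * Complex.exp (θ * Complex.I) * ρ)‖ ≤ 1 := by
  have hre : ((t : ℂ) * Complex.exp (θ * Complex.I) * ρ).re ≤ 0 := by
    simp [Complex.exp_re]
    nlinarith [mul_nonneg ht hρ]
  have hn : ‖(t : ℂ) * Complex.exp (θ * Complex.I) * ρ‖ = t * ρ := by
    simp [Complex.norm_exp, abs_of_nonneg ht, abs_of_nonneg hρ]
  have h1 : ‖Complex.exp (t * Complex.exp (θ * Complex.I) * ρ)‖ ≤ 1 := by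
    rw [Complex.norm_exp]; exact Real.exp_le_one_iff.2 hre
  refine ⟨?_, h1⟩
  rcases le_total (t * ρ) 1 with h | h
  · have := Complex.norm_exp_sub_one_le (x := (t : ℂ) * Complex.exp (θ * Complex.I) * ρ) (by rw [hn]; exact h)
    rwa [hn] at this
  · calc _ ≤ ‖Complex.exp (t * Complex.exp (θ * Complex.I) * ρ)‖ + ‖(1 : ℂ)‖ := norm_sub_le _ _
      _ ≤ 1 + 1 := by rw [norm_one]; linarith
      _ ≤ _ := by linarith

/-- The angle must make `exp (t e^{iθ} ρ)` decay, which needs `θ > π / 2`, and also `exp (-s e^{iβθ}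
ρ ^ β)`, which needs `β θ < π / 2`. Both are possible exactly because `β < 1`. -/
theorem exists_ray_angle {β : ℝ} (h0 : 0 < β) (h1 : β < 1) :
    ∃ θ, π / 2 < θ ∧ θ < π ∧ |β * θ| < π / 2 := by
  have hπ := Real.pi_pos
  obtain ⟨θ, h2, h3⟩ := exists_between (show π / 2 < min π (π / (2 * β)) from
    lt_min (by linarith) (by rw [div_lt_div_iff₀ (by norm_num) (by positivity)]; nlinarith))
  refine ⟨θ, h2, h3.trans_le (min_le_left _ _), ?_⟩
  have h4 := h3.trans_le (min_le_right _ _)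
  rw [lt_div_iff₀ (by positivity)] at h4
  rw [abs_of_nonneg (mul_nonneg h0.le (by linarith))]
  linarith

/-- Subtracting the real integral of `rayKernel` replaces `exp (e^{iθ} ρ)` by its difference from
`1`, which is at most `2 ρ`. The additional power of `ρ` improves the decay from `r ^ (-n)` to `r ^
(-(n + 1 / β))`. -/
theorem exists_abs_wrightM_le_rpow {β : ℝ} (h0 : 0 < β) (h1 : β < 1) {n : ℕ} (hn : 1 ≤ n) :
    ∃ C, ∀ r > 0, |wrightM β n r| ≤ C * r ^ (-((n * β + 1) / β)) := by
  obtain ⟨θ, hθ, hθ', hα⟩ := exists_ray_angle h0 h1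
  have hn' : (1 : ℝ) ≤ n := by exact_mod_cast hn
  have hcos : 0 < Real.cos (β * θ) :=
    Real.cos_pos_of_mem_Ioo ⟨by linarith [(abs_lt.1 hα).1], (abs_lt.1 hα).2⟩
  have hcosθ : Real.cos θ ≤ 0 := (Real.cos_neg_of_pi_div_two_lt_of_lt hθ (by linarith)).le
  refine ⟨2 * (Real.cos (β * θ) ^ (-((n * β + 1) / β)) * (1 / β) * Real.Gamma ((n * β + 1) / β)),
    fun r hr => ?_⟩
  have hb : 0 < r * Real.cos (β * θ) := mul_pos hr hcos
  have hK := integrableOn_rayKernel h0 hα hn hr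
  have hbound : ∀ ρ ∈ Ioi (0 : ℝ), ‖rayIntegrand β θ n r 1 ρ - rayKernel β θ n r ρ‖ ≤
      2 * (ρ ^ (n * β) * Real.exp (-(r * Real.cos (β * θ)) * ρ ^ β)) := by
    intro ρ hρ
    have hρ : 0 < ρ := hρ
    rw [rayIntegrand_eq, ← mul_sub_one, norm_mul, norm_rayKernel β θ n r hρ]
    refine (mul_le_mul_of_nonneg_left (norm_exp_ray_sub_one_le hcosθ zero_le_one hρ.le).1
      (by positivity)).trans_eq ?_
    rw [Real.rpow_sub_one hρ.ne']
    field_simp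
  have hB : IntegrableOn (fun ρ => 2 * (ρ ^ (n * β) * Real.exp (-(r * Real.cos (β * θ)) * ρ ^ β)))
      (Ioi 0) :=
    (integrableOn_rpow_mul_exp_neg_mul_rpow (by nlinarith) h0 hb).const_mul 2
  have hR : IntegrableOn (rayIntegrand β θ n r 1) (Ioi 0) := by
    refine hK.norm.mono' ?_ ?_
    · refine ContinuousOn.aestronglyMeasurable ?_ measurableSet_Ioi
      have : rayIntegrand β θ n r 1 = fun ρ => rayKernel β θ n r ρ *
        Complex.exp ((1 : ℝ) * Complex.exp (θ * Complex.I) * ρ) := funext (rayIntegrand_eq β θ n r 1)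
      rw [this]
      exact (continuousOn_rayKernel β θ n r).mul (by fun_prop)
    · refine (ae_restrict_iff' measurableSet_Ioi).2 (Eventually.of_forall fun ρ hρ => ?_)
      rw [rayIntegrand_eq, norm_mul]
      exact mul_le_of_le_one_right (norm_nonneg _)
        (norm_exp_ray_sub_one_le hcosθ zero_le_one (le_of_lt hρ)).2
  have h2 := im_integral_rayIntegrand h0 h1 hθ hθ' hn r one_pos
  rw [Real.one_rpow, Real.one_rpow, one_mul, div_one] at h2
  have h3 : π * |wrightM β n r| ≤
      ∫ ρ in Ioi (0 : ℝ), 2 * (ρ ^ (n * β) * Real.exp (-(r * Real.cos (β * θ)) * ρ ^ β)) := by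
    have h5 : π * wrightM β n r =
        (∫ ρ in Ioi (0 : ℝ), (rayIntegrand β θ n r 1 ρ - rayKernel β θ n r ρ)).im := by
      rw [integral_sub hR hK, Complex.sub_im, h2, im_integral_rayKernel h0 hα hn hr, sub_zero]
    nth_rewrite 1 [← abs_of_pos Real.pi_pos]
    rw [← abs_mul, h5]
    exact (Complex.abs_im_le_norm _).trans (norm_integral_le_of_norm_le hB
      ((ae_restrict_iff' measurableSet_Ioi).2 (Eventually.of_forall hbound)))
  rw [integral_const_mul, integral_rpow_mul_exp_neg_mul_rpow h0 (by nlinarith) hb,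
    Real.mul_rpow hr.le hcos.le] at h3
  have h4 : |wrightM β n r| ≤ π * |wrightM β n r| :=
    le_mul_of_one_le_left (abs_nonneg _) (by linarith [Real.pi_gt_three])
  refine h4.trans (h3.trans_eq ?_)
  rw [neg_div]
  ring

/-- For `r ≥ 1` use `n + 1 / β ≥ n + 1`; on `[0, 1]` use continuity. The exponent `n + 1` makes
moments of every order below `n` finite. -/
theorem exists_abs_wrightM_le {β : ℝ} (h0 : 0 < β) (h1 : β < 1) {n : ℕ} (hn : 1 ≤ n) :
    ∃ C, ∀ r ≥ 0, |wrightM β n r| ≤ C / (1 + r) ^ (n + 1) := by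
  obtain ⟨C, hC⟩ := exists_abs_wrightM_le_rpow h0 h1 hn
  obtain ⟨D, hD⟩ := isCompact_Icc.exists_bound_of_continuousOn (s := Icc (0 : ℝ) 1)
    (continuous_wrightM h0 h1 hn).continuousOn
  refine ⟨(|C| + |D|) * 2 ^ (n + 1), fun r hr => ?_⟩
  rw [le_div_iff₀ (by positivity)]
  rcases le_total r 1 with h | h
  · have h2 : |wrightM β n r| ≤ |C| + |D| :=
      (hD r ⟨hr, h⟩).trans ((le_abs_self _).trans (by linarith [abs_nonneg C]))
    gcongr
    linarith
  · have hr0 : 0 < r := by linarith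
    have h3 : r ^ (-((n * β + 1) / β)) ≤ (r ^ (n + 1))⁻¹ := by
      rw [← Real.rpow_natCast, ← Real.rpow_neg hr0.le]
      refine Real.rpow_le_rpow_of_exponent_le h ?_
      rw [neg_le_neg_iff, le_div_iff₀ h0]
      push_cast
      linarith
    calc |wrightM β n r| * (1 + r) ^ (n + 1) ≤ (|C| * (r ^ (n + 1))⁻¹) * (2 * r) ^ (n + 1) := by
          have h2 := (hC r hr0).trans (mul_le_mul (le_abs_self C) h3 (by positivity) (abs_nonneg _))
          gcongr
          linarith
      _ = |C| * 2 ^ (n + 1) := by rw [mul_pow]; field_simp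
      _ ≤ _ := by gcongr; linarith [abs_nonneg D]

/-! ### The Laplace transform of the Wright density in time. -/

/-- `t^{-nβ} ∑ (-s t^{-β})^k / (k! Γ(1 - (n + k) β))`. -/
noncomputable def wrightScaled (β : ℝ) (n : ℕ) (s t : ℝ) : ℝ :=
  t ^ (-(n * β)) * wrightM β n (s / t ^ β)

theorem wrightDensity_eq_wrightScaled (β s : ℝ) {t : ℝ} (ht : 0 < t) :
    wrightDensity β s t = wrightScaled β 1 s t := by
  rw [wrightDensity_eq β s ht, wrightScaled, Nat.cast_one, one_mul]

theorem continuousOn_wrightScaled {β : ℝ} (h0 : 0 < β) (h1 : β < 1) {n : ℕ} (hn : 1 ≤ n) :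
    ContinuousOn (fun q : ℝ × ℝ => wrightScaled β n q.1 q.2) (univ ×ˢ Ioi 0) := by
  have h : ∀ a : ℝ, ContinuousOn (fun q : ℝ × ℝ => q.2 ^ a) (univ ×ˢ Ioi 0) := fun a q hq =>
    ((Real.continuousAt_rpow_const q.2 a (Or.inl (ne_of_gt hq.2))).comp
      continuousAt_snd).continuousWithinAt
  refine (h _).mul ((continuous_wrightM h0 h1 hn).comp_continuousOn
    (continuous_fst.continuousOn.div (h β) fun q hq => (Real.rpow_pos_of_pos hq.2 _).ne'))

theorem continuousOn_wrightScaled_right {β : ℝ} (h0 : 0 < β) (h1 : β < 1) {n : ℕ} (hn : 1 ≤ n)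
    (s : ℝ) : ContinuousOn (wrightScaled β n s) (Ioi 0) :=
  (continuousOn_wrightScaled h0 h1 hn).comp (f := fun t => (s, t)) (by fun_prop)
    fun t ht => ⟨mem_univ _, ht⟩

theorem continuous_wrightScaled_left {β : ℝ} (h0 : 0 < β) (h1 : β < 1) {n : ℕ} (hn : 1 ≤ n)
    (t : ℝ) : Continuous fun s => wrightScaled β n s t :=
  continuous_const.mul ((continuous_wrightM h0 h1 hn).comp (continuous_id.div_const _))

/-- Fubini applies because `Re e^{iθ} ≤ 0`, and the integral of `exp (-(1 - e^{iθ} ρ) t)` over `t`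
is the stated denominator. -/
theorem integral_wrightScaled_eq_ray {β θ : ℝ} (h0 : 0 < β) (h1 : β < 1) (hθ : π / 2 < θ)
    (hθ' : θ < π) (hα : |β * θ| < π / 2) {q : ℝ} (hq : 0 < q) :
    π * ∫ t in Ioi (0 : ℝ), Real.exp (-t) * wrightScaled β 1 q t =
      (∫ ρ in Ioi (0 : ℝ), rayKernel β θ 1 q ρ / (1 - Complex.exp (θ * Complex.I) * ρ)).im := by
  have hcosθ : Real.cos θ ≤ 0 := (Real.cos_neg_of_pi_div_two_lt_of_lt hθ (by linarith)).le
  let G : ℝ × ℝ → ℂ := fun z => rayKernel β θ 1 q z.2 *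
    Complex.exp (-(1 - Complex.exp (θ * Complex.I) * z.2) * z.1)
  have hexp : ∀ t ρ : ℝ, Complex.exp (-(1 - Complex.exp (θ * Complex.I) * ρ) * t) =
      (Real.exp (-t) : ℝ) * Complex.exp (t * Complex.exp (θ * Complex.I) * ρ) := by
    intro t ρ
    rw [Complex.ofReal_exp, ← Complex.exp_add]
    push_cast
    ring_nf
  have hG : Integrable G ((volume.restrict (Ioi 0)).prod (volume.restrict (Ioi 0))) := by
    have h2 : IntegrableOn (fun t : ℝ => Real.exp (-t)) (Ioi 0) := by
      simpa using exp_neg_integrableOn_Ioi 0 one_pos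
    refine (h2.mul_prod (integrableOn_rayKernel h0 hα le_rfl hq).norm).mono' ?_ ?_
    · rw [Measure.prod_restrict]
      refine ContinuousOn.aestronglyMeasurable ?_ (measurableSet_Ioi.prod measurableSet_Ioi)
      exact ((continuousOn_rayKernel β θ 1 q).comp continuousOn_snd fun z hz => hz.2).mul (by fun_prop)
    · rw [Measure.prod_restrict]
      refine (ae_restrict_iff' (measurableSet_Ioi.prod measurableSet_Ioi)).2
        (Eventually.of_forall fun z hz => ?_)
      simp only [G]
      rw [hexp, norm_mul, norm_mul, Complex.norm_real, Real.norm_of_nonneg (Real.exp_pos _).le,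
        mul_comm]
      refine mul_le_mul_of_nonneg_right ?_ (norm_nonneg _)
      exact mul_le_of_le_one_right (Real.exp_pos _).le
        (norm_exp_ray_sub_one_le hcosθ (le_of_lt hz.1) (le_of_lt hz.2)).2
  have hinner : ∀ t ∈ Ioi (0 : ℝ), π * (Real.exp (-t) * wrightScaled β 1 q t) =
      Complex.imCLM (∫ ρ in Ioi (0 : ℝ), G (t, ρ)) := by
    intro t ht
    have : ∫ ρ in Ioi (0 : ℝ), G (t, ρ) =
        (Real.exp (-t) : ℝ) * ∫ ρ in Ioi (0 : ℝ), rayIntegrand β θ 1 q t ρ := by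
      rw [← integral_const_mul]
      refine integral_congr_ae (Eventually.of_forall fun ρ => ?_)
      simp only [G]
      rw [hexp, rayIntegrand_eq]
      ring
    rw [this, Complex.imCLM_apply, Complex.im_ofReal_mul,
      im_integral_rayIntegrand h0 h1 hθ hθ' le_rfl q ht, wrightScaled]
    ring
  rw [← integral_const_mul, setIntegral_congr_fun measurableSet_Ioi hinner,
    Complex.imCLM.integral_comp_comm hG.integral_prod_left, Complex.imCLM_apply]
  congr 1
  have hswap := integral_integral_swap (f := fun t ρ => G (t, ρ)) hG
  rw [hswap]
  refine setIntegral_congr_fun measurableSet_Ioi fun ρ hρ => ?_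
  have hρ : 0 < ρ := hρ
  simp only [G]
  rw [integral_const_mul, integral_exp_mul_complex_Ioi]
  · rw [Complex.ofReal_zero, mul_zero, Complex.exp_zero, neg_div_neg_eq, mul_one_div]
  · simp [Complex.exp_re]
    nlinarith

theorem one_le_norm_one_sub_ray {θ ρ : ℝ} (hθ : Real.cos θ ≤ 0) (hρ : 0 ≤ ρ) :
    1 ≤ ‖1 - Complex.exp (θ * Complex.I) * ρ‖ := by
  refine le_trans ?_ (Complex.re_le_norm _)
  simp [Complex.exp_re]
  nlinarith

/-- The substitution `ρ = e^x` turns the ray into the horizontal line of height `θ`, in preparation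
for shifting it down to the real axis. -/
theorem integral_ray_eq_line {β θ : ℝ} (h0 : 0 < β) (hθ : Real.cos θ ≤ 0)
    (hα : |β * θ| < π / 2) {q : ℝ} (hq : 0 < q) :
    ∫ ρ in Ioi (0 : ℝ), rayKernel β θ 1 q ρ / (1 - Complex.exp (θ * Complex.I) * ρ) =
        ∫ x : ℝ, (Complex.exp (β * (x + θ * Complex.I)) *
          Complex.exp (-(q * Complex.exp (β * (x + θ * Complex.I)))) /
            (1 - Complex.exp (x + θ * Complex.I))) ∧
      Integrable fun x : ℝ => (Complex.exp (β * (x + θ * Complex.I)) *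
          Complex.exp (-(q * Complex.exp (β * (x + θ * Complex.I)))) /
            (1 - Complex.exp (x + θ * Complex.I))) := by
  have hne : ∀ ρ : ℝ, 0 < ρ → 1 - Complex.exp (θ * Complex.I) * ρ ≠ 0 := fun ρ hρ h => by
    have := one_le_norm_one_sub_ray hθ hρ.le
    rw [h, norm_zero] at this
    linarith
  have hint : IntegrableOn (fun ρ : ℝ => rayKernel β θ 1 q ρ / (1 - Complex.exp (θ * Complex.I) * ρ))
      (Ioi 0) := by
    refine (integrableOn_rayKernel h0 hα le_rfl hq).norm.mono' ?_ ?_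
    · refine ContinuousOn.aestronglyMeasurable ?_ measurableSet_Ioi
      exact (continuousOn_rayKernel β θ 1 q).div (by fun_prop) fun ρ hρ => hne ρ hρ
    · refine (ae_restrict_iff' measurableSet_Ioi).2 (Eventually.of_forall fun ρ hρ => ?_)
      rw [norm_div]
      exact div_le_self (norm_nonneg _) (one_le_norm_one_sub_ray hθ (le_of_lt hρ))
  have heq : (fun x : ℝ => (Complex.exp (β * (x + θ * Complex.I)) *
          Complex.exp (-(q * Complex.exp (β * (x + θ * Complex.I)))) /
            (1 - Complex.exp (x + θ * Complex.I)))) = fun x : ℝ => Real.exp x •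
        (rayKernel β θ 1 q (Real.exp x) / (1 - Complex.exp (θ * Complex.I) * (Real.exp x : ℝ))) := by
    funext x
    have e1 : (Real.exp x : ℂ) * ((Real.exp x ^ (((1 : ℕ) : ℝ) * β - 1) : ℝ) : ℂ) = Complex.exp (β * x) := by
      rw [← Complex.ofReal_mul, ← Real.exp_mul, ← Real.exp_add, Complex.ofReal_exp]
      congr 1
      push_cast
      ring
    have e2 : ((Real.exp x ^ β : ℝ) : ℂ) = Complex.exp (β * x) := by
      rw [← Real.exp_mul, Complex.ofReal_exp]; push_cast; ring_nf
    have e3 : Complex.exp (β * (x + θ * Complex.I)) = Complex.exp (β * x) * Complex.exp (β * θ * Complex.I) := by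
      rw [← Complex.exp_add]; ring_nf
    rw [Complex.real_smul, rayKernel, e2, e3, ← e1, Complex.exp_add (x : ℂ), ← Complex.ofReal_exp, e1]
    rw [show Complex.exp (((1 : ℕ) : ℂ) * (β * θ) * Complex.I) = Complex.exp (β * θ * Complex.I) by
      simp, mul_comm (Real.exp x : ℂ) (Complex.exp (θ * Complex.I))]
    rw [← e1]
    ring_nf
  rw [heq]
  exact ⟨(integral_comp_exp_real _).symm, (integrable_comp_exp_real _).2 hint⟩

theorem integrable_exp_neg_mul_abs {δ : ℝ} (hδ : 0 < δ) : Integrable fun x : ℝ => Real.exp (-(δ * |x|)) := by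
  rw [← integrableOn_univ, ← Iic_union_Ioi (a := (0 : ℝ))]
  refine IntegrableOn.union ?_ ?_
  · refine (integrableOn_exp_mul_Iic hδ 0).congr_fun (fun x hx => ?_) measurableSet_Iic
    simp only [abs_of_nonpos (show x ≤ 0 from hx)]
    ring_nf
  · refine (integrableOn_exp_mul_Ioi (neg_neg_of_pos hδ) 0).congr_fun (fun x hx => ?_) measurableSet_Ioi
    simp only [abs_of_pos (show 0 < x from hx)]
    ring_nf

theorem one_sub_exp_ne_zero {w : ℂ} (h0 : 0 ≤ w.im) (h1 : w.im < π) (hw : w ≠ 0) :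
    1 - Complex.exp w ≠ 0 := by
  intro h
  obtain ⟨n, hn⟩ := Complex.exp_eq_one_iff.1 (sub_eq_zero.1 h).symm
  have him : w.im = n * (2 * π) := by rw [hn]; simp
  have hπ := Real.pi_pos
  have h2 : (n : ℝ) < 1 := by
    by_contra! hc
    nlinarith
  have h3 : (0 : ℝ) ≤ n := by
    by_contra! hc
    nlinarith
  have : n = 0 := by
    have : n < 1 := by exact_mod_cast h2
    have : 0 ≤ n := by exact_mod_cast h3
    omega
  exact hw (by rw [hn, this]; simp)

/-- The difference of two Laplace integrals has no contribution from the pole at the origin. -/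
theorem im_line_integral_eq_zero {β θ : ℝ} (h0 : 0 < β) (h1 : β < 1) (hθ0 : 0 < θ) (hθ' : θ < π)
    (hα : β * θ < π / 2) {q q' : ℝ} (hq : 0 < q) (hq' : 0 < q') :
    (∫ x : ℝ, Complex.exp (β * (x + θ * Complex.I)) *
      (Real.exp q * Complex.exp (-(q * Complex.exp (β * (x + θ * Complex.I)))) -
        Real.exp q' * Complex.exp (-(q' * Complex.exp (β * (x + θ * Complex.I))))) /
      (1 - Complex.exp (x + θ * Complex.I))).im = 0 := by
  let N : ℂ → ℂ := fun w => Real.exp q * Complex.exp (-(q * Complex.exp (β * w))) -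
    Real.exp q' * Complex.exp (-(q' * Complex.exp (β * w)))
  let D : ℂ → ℂ := fun w => 1 - Complex.exp w
  have hN : Differentiable ℂ N := by fun_prop
  have hD : Differentiable ℂ D := by fun_prop
  have hN0 : N 0 = 0 := by
    simp only [N, mul_zero, Complex.exp_zero, mul_one, Complex.ofReal_exp, ← Complex.exp_add]
    simp
  have hD0 : D 0 = 0 := by simp [D]
  -- Both `N` and `D` vanish at `0`; the two terms of `N` equal `1` there. The quotient of slopes is
  -- the holomorphic extension of `N / D` across the removable singularity.
  let H : ℂ → ℂ := fun w => Complex.exp (β * w) * (dslope N 0 w / dslope D 0 w)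
  have hDne : ∀ w : ℂ, 0 ≤ w.im → w.im < π → dslope D 0 w ≠ 0 := by
    intro w hw hw'
    rcases eq_or_ne w 0 with rfl | hne
    · rw [dslope_same]
      have : HasDerivAt D (-1) 0 := by
        simpa using (Complex.hasDerivAt_exp 0).const_sub 1
      rw [this.deriv]
      norm_num
    · rw [dslope_of_ne _ hne, slope_def_field, hD0, sub_zero, sub_zero]
      exact div_ne_zero (one_sub_exp_ne_zero hw hw' hne) hne
  have hHeq : ∀ w : ℂ, w ≠ 0 → H w = Complex.exp (β * w) * N w / D w := by
    intro w hw
    simp only [H]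
    rw [dslope_of_ne _ hw, dslope_of_ne _ hw, slope_def_field, slope_def_field, hN0, hD0, sub_zero,
      sub_zero, sub_zero, div_div_div_cancel_right₀ hw, mul_div_assoc]
  have hcd : ∀ f : ℂ → ℂ, Differentiable ℂ f → Continuous (dslope f 0) := by
    intro f hf
    rw [← continuousOn_univ]
    exact (continuousOn_dslope univ_mem).2 ⟨hf.continuous.continuousOn, hf 0⟩
  have hIcc : uIcc 0 θ = Icc 0 θ := uIcc_of_le hθ0.le
  have hcH : ContinuousOn H {w | w.im ∈ uIcc 0 θ} := by
    rw [hIcc]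
    refine ContinuousOn.mul (by fun_prop) ((hcd N hN).continuousOn.div (hcd D hD).continuousOn ?_)
    exact fun w hw => hDne w hw.1 (hw.2.trans_lt hθ')
  -- The integrand decays like `e^{β x}` at `-∞` and like `e^{(β - 1) x}` at `+∞`.
  set δ := min β (1 - β) with hδ
  have hδ0 : 0 < δ := lt_min h0 (by linarith)
  have hδβ : δ ≤ β := min_le_left _ _
  have hδβ' : δ ≤ 1 - β := min_le_right _ _
  set c := Real.exp q + Real.exp q' with hc
  have hNb : ∀ w : ℂ, w.im ∈ Icc 0 θ → ‖N w‖ ≤ c := by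
    intro w hw
    have hcos : 0 ≤ Real.cos (β * w.im) := Real.cos_nonneg_of_mem_Icc
      ⟨by have := mul_nonneg h0.le hw.1; linarith [Real.pi_pos],
        (mul_le_mul_of_nonneg_left hw.2 h0.le).trans hα.le⟩
    have h2 : ∀ a : ℝ, 0 < a → ‖(Real.exp a : ℂ) * Complex.exp (-(a * Complex.exp (β * w)))‖ ≤ Real.exp a := by
      intro a ha
      rw [norm_mul, Complex.norm_real, Real.norm_of_nonneg (Real.exp_pos _).le, Complex.norm_exp]
      refine mul_le_of_le_one_right (Real.exp_pos _).le (Real.exp_le_one_iff.2 ?_)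
      have : (-((a : ℂ) * Complex.exp (β * w))).re = -(a * (Real.exp (β * w.re) * Real.cos (β * w.im))) := by
        simp [Complex.exp_re]
      rw [this]
      have := Real.exp_pos (β * w.re)
      have : 0 ≤ a * (Real.exp (β * w.re) * Real.cos (β * w.im)) := by positivity
      linarith
    exact (norm_sub_le _ _).trans (add_le_add (h2 q hq) (h2 q' hq'))
  obtain ⟨K, hK⟩ := (isCompact_Icc (a := (-1 : ℝ)) (b := 1)).reProdIm (isCompact_Icc (a := 0) (b := θ))
    |>.exists_bound_of_continuousOn (f := H) (hcH.mono fun w hw => by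
      rw [hIcc]; exact hw.2)
  have hK0 : 0 ≤ K := (norm_nonneg _).trans (hK 0 ⟨by simp, by simp [hθ0.le]⟩)
  have hc0 : 0 < c := by positivity
  let C := K * Real.exp 1 + 4 * c
  have hC0 : 0 ≤ C := by positivity
  have hbound : ∀ w : ℂ, w.im ∈ uIcc 0 θ → ‖H w‖ ≤ C * Real.exp (-(δ * |w.re|)) := by
    intro w hw
    rw [hIcc] at hw
    have hfar : ∀ a b : ℝ, w ≠ 0 → 0 < a → a ≤ ‖D w‖ → Real.exp (β * w.re) ≤ b * a →
        ‖H w‖ ≤ c * b := by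
      intro a b hne ha hD' hb
      rw [hHeq w hne, norm_div, norm_mul, Complex.norm_exp]
      rw [div_le_iff₀ (ha.trans_le hD')]
      have : ((β : ℂ) * w).re = β * w.re := by simp
      rw [this]
      have hb0 : 0 ≤ b := by
        by_contra! hb0
        have := Real.exp_pos (β * w.re)
        nlinarith
      calc _ ≤ (b * a) * c := mul_le_mul hb (hNb w hw) (norm_nonneg _) ((Real.exp_pos _).le.trans hb)
        _ ≤ (b * ‖D w‖) * c := by gcongr
        _ = _ := by ring
    have hmono : ∀ x : ℝ, c * (4 * Real.exp x) ≤ C * Real.exp x := fun x => by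
      have := Real.exp_pos x
      have h3 : 0 ≤ K * Real.exp 1 * Real.exp x := by positivity
      simp only [C]
      linarith
    have he : (2 : ℝ) ≤ Real.exp 1 := by linarith [Real.add_one_le_exp 1]
    have hnorm : ‖Complex.exp w‖ = Real.exp w.re := Complex.norm_exp w
    rcases le_or_gt 1 w.re with h | h
    · have hne : w ≠ 0 := by rintro rfl; simp at h; linarith
      have h4 : 2 ≤ Real.exp w.re := he.trans (Real.exp_le_exp.2 h)
      refine (hfar (Real.exp w.re / 2) (4 * Real.exp (-(δ * |w.re|))) hne (by positivity) ?_ ?_).trans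
        (hmono _)
      · have := norm_sub_norm_le (Complex.exp w) 1
        rw [norm_sub_rev, norm_one, hnorm] at this
        simp only [D]
        linarith
      · rw [abs_of_pos (by linarith)]
        have : Real.exp (β * w.re) ≤ Real.exp (-(δ * w.re)) * Real.exp w.re := by
          rw [← Real.exp_add]
          exact Real.exp_le_exp.2 (by nlinarith)
        have := Real.exp_pos (β * w.re)
        nlinarith
    · rcases le_or_gt w.re (-1) with h' | h'
      · have hne : w ≠ 0 := by rintro rfl; simp at h'; linarith
        have h4 : Real.exp w.re ≤ 1 / 2 := by
          refine (Real.exp_le_exp.2 h').trans ?_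
          rw [Real.exp_neg, one_div]
          exact inv_anti₀ (by norm_num) he
        refine (hfar (1 / 2) (4 * Real.exp (-(δ * |w.re|))) hne (by positivity) ?_ ?_).trans (hmono _)
        · have := norm_sub_norm_le 1 (Complex.exp w)
          rw [norm_one, hnorm] at this
          simp only [D]
          linarith
        · rw [abs_of_neg (by linarith)]
          have : Real.exp (β * w.re) ≤ Real.exp (-(δ * -w.re)) := Real.exp_le_exp.2 (by nlinarith)
          have := Real.exp_pos (β * w.re)
          linarith
      · refine (hK w ⟨⟨h'.le, h.le⟩, hw⟩).trans ?_
        have h5 : |w.re| ≤ 1 := abs_le.2 ⟨h'.le, h.le⟩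
        have h6 : 1 ≤ Real.exp 1 * Real.exp (-(δ * |w.re|)) := by
          rw [← Real.exp_add]
          refine Real.one_le_exp ?_
          nlinarith [abs_nonneg w.re]
        have := Real.exp_pos (-(δ * |w.re|))
        simp only [C]
        nlinarith
  have hlim : ∀ {l : Filter ℝ}, Tendsto (fun x : ℝ => |x|) l atTop →
      Tendsto (fun x : ℝ => C * Real.exp (-(δ * |x|))) l (𝓝 0) := by
    intro l hl
    simpa using (Real.tendsto_exp_atBot.comp
      (tendsto_neg_atTop_atBot.comp (hl.const_mul_atTop hδ0))).const_mul C
  have hstrip := integral_strip_eq (H := H) (θ := θ) hcH (fun w hw => ?_)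
    ((integrable_exp_neg_mul_abs hδ0).const_mul C) (hlim tendsto_abs_atBot_atTop)
    (hlim tendsto_abs_atTop_atTop) hbound
  · have hreal : ∀ x : ℝ, x ≠ 0 → H x = ((Real.exp (β * x) *
        (Real.exp q * Real.exp (-(q * Real.exp (β * x))) -
          Real.exp q' * Real.exp (-(q' * Real.exp (β * x)))) / (1 - Real.exp x) : ℝ) : ℂ) := by
      intro x hx
      rw [hHeq x (by exact_mod_cast hx)]
      simp only [N, D]
      push_cast
      ring
    have e1 : ∫ x : ℝ, H x = ((∫ x : ℝ, Real.exp (β * x) *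
        (Real.exp q * Real.exp (-(q * Real.exp (β * x))) -
          Real.exp q' * Real.exp (-(q' * Real.exp (β * x)))) / (1 - Real.exp x) : ℝ) : ℂ) := by
      rw [← integral_complex_ofReal]
      refine integral_congr_ae ?_
      filter_upwards [compl_mem_ae_iff.2 (measure_singleton (0 : ℝ))] with x hx
      exact hreal x hx
    have e2 : ∫ x : ℝ, Complex.exp (β * (x + θ * Complex.I)) *
      (Real.exp q * Complex.exp (-(q * Complex.exp (β * (x + θ * Complex.I)))) -
        Real.exp q' * Complex.exp (-(q' * Complex.exp (β * (x + θ * Complex.I))))) /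
      (1 - Complex.exp (x + θ * Complex.I)) = ∫ x : ℝ, H (x + θ * Complex.I) := by
      refine integral_congr_ae (Eventually.of_forall fun x => ?_)
      beta_reduce
      rw [hHeq _ fun h => ?_]
      have := congrArg Complex.im h
      simp at this
      exact hθ0.ne' this
    rw [e2, ← hstrip, e1, Complex.ofReal_im]
  · rw [min_eq_left hθ0.le, max_eq_right hθ0.le] at hw
    have hne : w ≠ 0 := by
      rintro rfl
      simp at hw
    refine DifferentiableAt.mul (by fun_prop) (DifferentiableAt.div ?_ ?_
      (hDne w hw.1.le (hw.2.trans hθ')))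
    · exact (differentiableAt_dslope_of_ne hne).2 (hN w)
    · exact (differentiableAt_dslope_of_ne hne).2 (hD w)

theorem exists_abs_wrightScaled_le {β : ℝ} (h0 : 0 < β) (h1 : β < 1) {n : ℕ}
    (hn : 1 ≤ n) : ∃ C, 0 ≤ C ∧ ∀ s ≥ 0, ∀ t > 0,
    |wrightScaled β n s t| ≤ C * (t ^ (-(n * β)) / (1 + s / t ^ β) ^ (n + 1)) := by
  obtain ⟨C, hC⟩ := exists_abs_wrightM_le h0 h1 hn
  have hC0 : 0 ≤ C := by simpa using (abs_nonneg _).trans (hC 0 le_rfl)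
  refine ⟨C, hC0, fun s hs t ht => ?_⟩
  rw [wrightScaled, abs_mul, abs_of_nonneg (Real.rpow_nonneg ht.le _)]
  refine (mul_le_mul_of_nonneg_left (hC (s / t ^ β) (by positivity))
    (Real.rpow_nonneg ht.le _)).trans_eq ?_
  ring

theorem exists_abs_wrightScaled_le_rpow {β : ℝ} (h0 : 0 < β) (h1 : β < 1) {n : ℕ}
    (hn : 1 ≤ n) : ∃ C, 0 ≤ C ∧ ∀ s ≥ 0, ∀ t > 0,
    |wrightScaled β n s t| ≤ C * t ^ (-(n * β)) := by
  obtain ⟨C, hC0, hC⟩ := exists_abs_wrightScaled_le h0 h1 hn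
  refine ⟨C, hC0, fun s hs t ht => (hC s hs t ht).trans (mul_le_mul_of_nonneg_left ?_ hC0)⟩
  exact div_le_self (Real.rpow_nonneg ht.le _) (one_le_pow₀ (by
    have : 0 ≤ s / t ^ β := by positivity
    linarith))

/-- The powers of `t` cancel, so the bound is uniform in `t`; it dominates the differentiation under
the integral in `laplace_wrightScaled_two`. -/
theorem exists_abs_wrightScaled_le_inv_pow {β : ℝ} (h0 : 0 < β) (h1 : β < 1) {n : ℕ}
    (hn : 1 ≤ n) : ∃ C, 0 ≤ C ∧ ∀ s > 0, ∀ t > 0,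
    |wrightScaled β n s t| ≤ C * (s ^ n)⁻¹ := by
  obtain ⟨C, hC0, hC⟩ := exists_abs_wrightScaled_le h0 h1 hn
  refine ⟨C, hC0, fun s hs t ht => (hC s hs.le t ht).trans (mul_le_mul_of_nonneg_left ?_ hC0)⟩
  have hq : 0 < t ^ β := by positivity
  have e1 : t ^ (-(n * β)) = ((t ^ β) ^ n)⁻¹ := by
    rw [← Real.rpow_natCast, ← Real.rpow_mul ht.le, ← Real.rpow_neg ht.le]
    ring_nf
  rw [e1, div_le_iff₀ (by positivity), ← div_le_iff₀' (by positivity), div_inv_eq_mul]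
  calc ((t ^ β) ^ n)⁻¹ * s ^ n = (s / t ^ β) ^ n := by rw [div_pow]; ring
    _ ≤ (1 + s / t ^ β) ^ n := by gcongr; linarith
    _ ≤ _ := pow_le_pow_right₀ (by
      have : 0 ≤ s / t ^ β := by positivity
      linarith) (Nat.le_succ n)

theorem exists_abs_wrightScaled_le_on_Icc {β : ℝ} (h0 : 0 < β) (h1 : β < 1) {n : ℕ}
    (hn : 1 ≤ n) {a b : ℝ} (ha : 0 < a) (hb : 0 < b) : ∃ C, 0 ≤ C ∧
    ∀ s ≥ 0, ∀ t ∈ Icc a b, |wrightScaled β n s t| ≤ C * (1 + s) ^ (-((n : ℝ) + 1)) := by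
  obtain ⟨C, hC0, hC⟩ := exists_abs_wrightScaled_le h0 h1 hn
  set c := min 1 (b ^ β)⁻¹ with hc
  have hc0 : 0 < c := lt_min one_pos (by positivity)
  refine ⟨C * (a ^ (-(n * β)) / c ^ (n + 1)), by positivity, fun s hs t ht => ?_⟩
  have ht0 : 0 < t := ha.trans_le ht.1
  refine (hC s hs t ht0).trans ?_
  rw [mul_assoc]
  refine mul_le_mul_of_nonneg_left ?_ hC0
  have e1 : (1 + s) ^ (-((n : ℝ) + 1)) = ((1 + s) ^ (n + 1))⁻¹ := by
    rw [Real.rpow_neg (by positivity), ← Real.rpow_natCast]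
    push_cast
    rfl
  have h2 : t ^ (-(n * β)) ≤ a ^ (-(n * β)) :=
    Real.rpow_le_rpow_of_nonpos ha ht.1 (neg_nonpos.2 (by positivity))
  have h3 : c * (1 + s) ≤ 1 + s / t ^ β := by
    have h4 : c ≤ 1 := min_le_left _ _
    have h5 : c ≤ (t ^ β)⁻¹ := (min_le_right _ _).trans
      (inv_anti₀ (by positivity) (Real.rpow_le_rpow ht0.le ht.2 h0.le))
    rw [mul_add, mul_one, div_eq_mul_inv, mul_comm s]
    exact add_le_add h4 (mul_le_mul_of_nonneg_right h5 hs)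
  rw [e1]
  calc t ^ (-(n * β)) / (1 + s / t ^ β) ^ (n + 1) ≤ a ^ (-(n * β)) / (c * (1 + s)) ^ (n + 1) := by
        gcongr
    _ = _ := by rw [mul_pow]; field_simp

theorem hasDerivAt_wrightScaled_left {β : ℝ} (h0 : 0 < β) (h1 : β < 1) {n : ℕ}
    (hn : 1 ≤ n) (s : ℝ) {t : ℝ} (ht : 0 < t) :
    HasDerivAt (fun s => wrightScaled β n s t) (-wrightScaled β (n + 1) s t) s := by
  have h := ((hasDerivAt_wrightM h0 h1 hn (s / t ^ β)).comp s ((hasDerivAt_id s).div_const _)).const_mul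
    (t ^ (-(n * β)))
  refine h.congr_deriv ?_
  rw [wrightScaled]
  have : t ^ (-(((n + 1 : ℕ) : ℝ) * β)) = t ^ (-(n * β)) / t ^ β := by
    rw [← Real.rpow_sub ht]
    push_cast
    ring_nf
  rw [this]
  ring

/-- The moments converge because `a < n` and the decay has order `n + 1`; the power of `t` is
dictated by scaling `s` with `t ^ β`. -/
theorem exists_integral_rpow_mul_wrightScaled_le {β : ℝ} (h0 : 0 < β) (h1 : β < 1) {n : ℕ}
    (hn : 1 ≤ n) {a : ℝ} (ha : 0 ≤ a) (han : a < n) :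
    ∃ C, 0 ≤ C ∧ ∀ t > 0, IntegrableOn (fun s => s ^ a * |wrightScaled β n s t|) (Ioi 0) ∧
      ∫ s in Ioi (0 : ℝ), s ^ a * |wrightScaled β n s t| ≤ C * t ^ ((a + 1 - n) * β) := by
  obtain ⟨C, hC0, hC⟩ := exists_abs_wrightScaled_le h0 h1 hn
  let k : ℝ → ℝ := fun r => r ^ a / (1 + r) ^ (n + 1)
  have hk0 : ∀ r ∈ Ioi (0 : ℝ), 0 ≤ k r := fun r hr => by
    have : (0 : ℝ) < r := hr
    positivity
  have hk : IntegrableOn k (Ioi 0) := by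
    have h2 := (integrable_one_add_norm (E := ℝ) (μ := volume) (r := n + 1 - a)
      (by simp; linarith)).integrableOn (s := Ioi 0)
    refine h2.mono' ?_ ?_
    · refine ContinuousOn.aestronglyMeasurable (ContinuousOn.div (fun r hr => ?_) (by fun_prop)
        fun r hr => ?_) measurableSet_Ioi
      · exact (Real.continuousAt_rpow_const _ _ (Or.inl (ne_of_gt hr))).continuousWithinAt
      · have : (0 : ℝ) < r := hr
        positivity
    · refine (ae_restrict_iff' measurableSet_Ioi).2 (Eventually.of_forall fun r hr => ?_)
      have hr' : (0 : ℝ) < r := hr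
      rw [Real.norm_of_nonneg (hk0 r hr), Real.norm_of_nonneg hr'.le]
      simp only [k]
      rw [show -((n : ℝ) + 1 - a) = a - ((n + 1 : ℕ) : ℝ) by push_cast; ring,
        Real.rpow_sub (by positivity), Real.rpow_natCast]
      gcongr
      linarith
  have hI0 : 0 ≤ ∫ r in Ioi (0 : ℝ), k r := setIntegral_nonneg measurableSet_Ioi hk0
  refine ⟨C * ∫ r in Ioi (0 : ℝ), k r, by positivity, fun t ht => ?_⟩
  have hq : 0 < (t ^ β)⁻¹ := by positivity
  have hb : ∀ s ∈ Ioi (0 : ℝ), s ^ a * |wrightScaled β n s t| ≤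
      C * t ^ ((a - n) * β) * k ((t ^ β)⁻¹ * s) := by
    intro s hs
    have hs : 0 < s := hs
    refine (mul_le_mul_of_nonneg_left (hC s hs.le t ht) (by positivity)).trans_eq ?_
    simp only [k]
    have e1 : t ^ ((a - n) * β) = t ^ (-(n * β)) * (t ^ β) ^ a := by
      rw [← Real.rpow_mul ht.le, ← Real.rpow_add ht]
      ring_nf
    rw [Real.mul_rpow hq.le hs.le, Real.inv_rpow (by positivity), e1, inv_mul_eq_div]
    field_simp
  have hi : IntegrableOn (fun s => C * t ^ ((a - n) * β) * k ((t ^ β)⁻¹ * s)) (Ioi 0) := by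
    refine Integrable.const_mul ?_ _
    refine (integrableOn_Ioi_comp_mul_left_iff k 0 hq).2 ?_
    rwa [mul_zero]
  have hint : IntegrableOn (fun s => s ^ a * |wrightScaled β n s t|) (Ioi 0) := by
    refine hi.mono' ?_ ?_
    · refine ContinuousOn.aestronglyMeasurable (ContinuousOn.mul (fun r hr => ?_)
        (continuous_wrightScaled_left h0 h1 hn t).abs.continuousOn) measurableSet_Ioi
      exact (Real.continuousAt_rpow_const _ _ (Or.inl (ne_of_gt hr))).continuousWithinAt
    · refine (ae_restrict_iff' measurableSet_Ioi).2 (Eventually.of_forall fun s hs => ?_)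
      rw [Real.norm_of_nonneg (mul_nonneg (Real.rpow_nonneg (le_of_lt hs) _) (abs_nonneg _))]
      exact hb s hs
  refine ⟨hint, (setIntegral_mono_on hint hi measurableSet_Ioi hb).trans_eq ?_⟩
  rw [integral_const_mul, integral_comp_mul_left_Ioi _ _ hq, mul_zero, inv_inv, smul_eq_mul,
    show (a + 1 - n) * β = (a - n) * β + β by ring, Real.rpow_add ht]
  ring

/-- This is Euler's relation: the function is homogeneous of degree `-1` in `s` and `t ^ β`. -/
theorem hasDerivAt_wrightScaled_right {β : ℝ} (h0 : 0 < β) (h1 : β < 1) (s : ℝ) {t : ℝ} (ht : 0 < t) :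
    HasDerivAt (wrightScaled β 1 s)
      (-(β / t) * (wrightScaled β 1 s t - s * wrightScaled β 2 s t)) t := by
  have hd : HasDerivAt (fun t : ℝ => s / t ^ β) (-(s * (β * t ^ (β - 1))) / (t ^ β) ^ 2) t := by
    refine ((hasDerivAt_const t s).div (Real.hasDerivAt_rpow_const (Or.inl ht.ne'))
      (by positivity)).congr_deriv ?_
    ring
  have h := (Real.hasDerivAt_rpow_const (x := t) (p := -(((1 : ℕ) : ℝ) * β)) (Or.inl ht.ne')).mul
    ((hasDerivAt_wrightM h0 h1 le_rfl (s / t ^ β)).comp t hd)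
  refine h.congr_deriv ?_
  have e1 : t ^ (-(((1 : ℕ) : ℝ) * β) - 1) = (t ^ β)⁻¹ / t := by
    rw [Real.rpow_sub_one ht.ne', ← Real.rpow_neg ht.le]; simp
  have e2 : t ^ (-(((1 : ℕ) : ℝ) * β)) = (t ^ β)⁻¹ := by
    rw [← Real.rpow_neg ht.le]; simp
  have e3 : t ^ (-(((2 : ℕ) : ℝ) * β)) = (t ^ β)⁻¹ * (t ^ β)⁻¹ := by
    rw [← Real.rpow_neg ht.le, ← Real.rpow_add ht]; push_cast; ring_nf
  have : t ^ β ≠ 0 := by positivity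
  simp only [wrightScaled, Function.comp]
  rw [e1, e2, e3, Real.rpow_sub_one ht.ne']
  push_cast
  field_simp
  ring

theorem integrableOn_exp_mul_rpow_neg {β p : ℝ} (h1 : β < 1) (hp : 0 < p) :
    IntegrableOn (fun t => Real.exp (-(p * t)) * t ^ (-β)) (Ioi 0) := by
  refine (integrableOn_rpow_mul_exp_neg_mul (a := 1 - β) (by linarith) hp).congr_fun (fun t _ => ?_)
    measurableSet_Ioi
  beta_reduce
  rw [mul_comm]
  ring_nf

theorem integrableOn_exp_mul_wrightScaled_one {β : ℝ} (h0 : 0 < β) (h1 : β < 1) {s p : ℝ} (hs : 0 ≤ s)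
    (hp : 0 < p) : IntegrableOn (fun t => Real.exp (-(p * t)) * wrightScaled β 1 s t) (Ioi 0) := by
  obtain ⟨C, hC0, hC⟩ := exists_abs_wrightScaled_le_rpow h0 h1 (n := 1) le_rfl
  refine ((integrableOn_exp_mul_rpow_neg h1 hp).const_mul C).mono'
    ((ContinuousOn.mul (by fun_prop) (continuousOn_wrightScaled_right h0 h1 le_rfl s)).aestronglyMeasurable
      measurableSet_Ioi) ((ae_restrict_iff' measurableSet_Ioi).2 (Eventually.of_forall fun t ht => ?_))
  rw [norm_mul, Real.norm_of_nonneg (Real.exp_pos _).le, Real.norm_eq_abs]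
  refine (mul_le_mul_of_nonneg_left (hC s hs t ht) (Real.exp_pos _).le).trans_eq ?_
  rw [Nat.cast_one, one_mul]
  ring

theorem integral_exp_mul_wrightScaled_zero {β : ℝ} (h1 : β < 1) :
    ∫ t in Ioi (0 : ℝ), Real.exp (-t) * wrightScaled β 1 0 t = 1 := by
  have hG := Real.Gamma_pos_of_pos (show 0 < 1 - β by linarith)
  have e : ∀ t ∈ Ioi (0 : ℝ), Real.exp (-t) * wrightScaled β 1 0 t =
      (Real.Gamma (1 - β))⁻¹ * (Real.exp (-t) * t ^ (1 - β - 1)) := by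
    intro t _
    rw [wrightScaled, zero_div, wrightM_one_zero, Nat.cast_one, one_mul]
    ring_nf
  rw [setIntegral_congr_fun measurableSet_Ioi e, integral_const_mul,
    ← Real.Gamma_eq_integral (by linarith), inv_mul_cancel₀ hG.ne']

/-- The difference of the two sides, multiplied by `π`, is the imaginary part of the line integral
that vanishes by `im_line_integral_eq_zero`. -/
theorem exp_mul_integral_wrightScaled_const {β : ℝ} (h0 : 0 < β) (h1 : β < 1) {q q' : ℝ} (hq : 0 < q)
    (hq' : 0 < q') :
    Real.exp q * ∫ t in Ioi (0 : ℝ), Real.exp (-t) * wrightScaled β 1 q t =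
      Real.exp q' * ∫ t in Ioi (0 : ℝ), Real.exp (-t) * wrightScaled β 1 q' t := by
  obtain ⟨θ, hθ, hθ', hα⟩ := exists_ray_angle h0 h1
  have hθ0 : 0 < θ := by linarith [Real.pi_pos]
  have hcosθ : Real.cos θ ≤ 0 := (Real.cos_neg_of_pi_div_two_lt_of_lt hθ (by linarith)).le
  have h := im_line_integral_eq_zero h0 h1 hθ0 hθ' (abs_lt.1 hα).2 hq hq'
  obtain ⟨e, hi⟩ := integral_ray_eq_line h0 hcosθ hα hq
  obtain ⟨e', hi'⟩ := integral_ray_eq_line h0 hcosθ hα hq'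
  have r := integral_wrightScaled_eq_ray h0 h1 hθ hθ' hα hq
  have r' := integral_wrightScaled_eq_ray h0 h1 hθ hθ' hα hq'
  rw [e] at r
  rw [e'] at r'
  have hsplit : ∀ x : ℝ, Complex.exp (β * (x + θ * Complex.I)) *
      (Real.exp q * Complex.exp (-(q * Complex.exp (β * (x + θ * Complex.I)))) -
        Real.exp q' * Complex.exp (-(q' * Complex.exp (β * (x + θ * Complex.I))))) /
      (1 - Complex.exp (x + θ * Complex.I)) =
      (Real.exp q : ℂ) * (Complex.exp (β * (x + θ * Complex.I)) *
          Complex.exp (-(q * Complex.exp (β * (x + θ * Complex.I)))) /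
            (1 - Complex.exp (x + θ * Complex.I))) -
      (Real.exp q' : ℂ) * (Complex.exp (β * (x + θ * Complex.I)) *
          Complex.exp (-(q' * Complex.exp (β * (x + θ * Complex.I)))) /
            (1 - Complex.exp (x + θ * Complex.I))) := fun x => by ring
  simp_rw [hsplit] at h
  rw [integral_sub (hi.const_mul _) (hi'.const_mul _), integral_const_mul, integral_const_mul,
    Complex.sub_im, Complex.im_ofReal_mul, Complex.im_ofReal_mul, ← r, ← r'] at h
  have hπ := Real.pi_pos
  refine mul_left_cancel₀ hπ.ne' ?_
  linarith

/-- By the preceding lemma `e^q` times the integral is independent of `q > 0`; its value is found by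
letting `q → 0`, where the integral becomes a Gamma integral. -/
theorem integral_exp_mul_wrightScaled_one {β : ℝ} (h0 : 0 < β) (h1 : β < 1) {q : ℝ} (hq : 0 ≤ q) :
    ∫ t in Ioi (0 : ℝ), Real.exp (-t) * wrightScaled β 1 q t = Real.exp (-q) := by
  rcases hq.eq_or_lt with rfl | hq
  · rw [integral_exp_mul_wrightScaled_zero h1]; simp
  obtain ⟨C, hC0, hC⟩ := exists_abs_wrightScaled_le_rpow h0 h1 (n := 1) le_rfl
  have ht : Tendsto (fun q' => ∫ t in Ioi (0 : ℝ), Real.exp (-t) * wrightScaled β 1 q' t) (𝓝[>] 0)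
      (𝓝 (∫ t in Ioi (0 : ℝ), Real.exp (-t) * wrightScaled β 1 0 t)) := by
    refine tendsto_integral_filter_of_dominated_convergence
      (fun t => C * (Real.exp (-(1 * t)) * t ^ (-β))) ?_ ?_
      ((integrableOn_exp_mul_rpow_neg h1 one_pos).const_mul C) ?_
    · exact Eventually.of_forall fun q' => (ContinuousOn.mul (by fun_prop)
        (continuousOn_wrightScaled_right h0 h1 le_rfl q')).aestronglyMeasurable measurableSet_Ioi
    · filter_upwards [self_mem_nhdsWithin] with q' hq'
      refine (ae_restrict_iff' measurableSet_Ioi).2 (Eventually.of_forall fun t ht => ?_)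
      rw [norm_mul, Real.norm_of_nonneg (Real.exp_pos _).le, Real.norm_eq_abs, one_mul]
      refine (mul_le_mul_of_nonneg_left (hC q' (le_of_lt hq') t ht) (Real.exp_pos _).le).trans_eq ?_
      rw [Nat.cast_one, one_mul]
      ring
    · refine Eventually.of_forall fun t => ?_
      exact (((continuous_wrightScaled_left h0 h1 le_rfl t).tendsto 0).mono_left
        nhdsWithin_le_nhds).const_mul _
  have h2 := ((Real.continuous_exp.tendsto 0).mono_left (nhdsWithin_le_nhds (s := Ioi 0))).mul ht
  rw [integral_exp_mul_wrightScaled_zero h1, Real.exp_zero, mul_one] at h2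
  have h3 := tendsto_nhds_unique ((tendsto_const_nhds (x := Real.exp q *
    ∫ t in Ioi (0 : ℝ), Real.exp (-t) * wrightScaled β 1 q t)).congr' (by
      filter_upwards [self_mem_nhdsWithin] with q' hq'
      exact exp_mul_integral_wrightScaled_const h0 h1 hq hq')) h2
  rw [Real.exp_neg, eq_inv_of_mul_eq_one_right h3]

theorem wrightScaled_div {β : ℝ} (n : ℕ) (s : ℝ) {t p : ℝ} (ht : 0 < t) (hp : 0 < p) :
    wrightScaled β n s (p⁻¹ * t) = p ^ (n * β) * wrightScaled β n (s * p ^ β) t := by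
  simp only [wrightScaled]
  rw [Real.mul_rpow (inv_pos.2 hp).le ht.le, Real.mul_rpow (inv_pos.2 hp).le ht.le,
    Real.inv_rpow hp.le, Real.inv_rpow hp.le, Real.rpow_neg hp.le, inv_inv]
  have : s / ((p ^ β)⁻¹ * t ^ β) = s * p ^ β / t ^ β := by
    have : p ^ β ≠ 0 := by positivity
    field_simp
  rw [this]
  ring

/-- The Laplace transform of the Wright density in time. -/
theorem laplace_wrightScaled_one {β : ℝ} (h0 : 0 < β) (h1 : β < 1) {s p : ℝ} (hs : 0 ≤ s)
    (hp : 0 < p) : ∫ t in Ioi (0 : ℝ), Real.exp (-(p * t)) * wrightScaled β 1 s t =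
      p ^ (β - 1) * Real.exp (-(s * p ^ β)) := by
  have h := integral_comp_mul_left_Ioi
    (fun t => Real.exp (-(p * t)) * wrightScaled β 1 s t) 0 (inv_pos.2 hp)
  rw [mul_zero, inv_inv, smul_eq_mul] at h
  have e : ∀ t ∈ Ioi (0 : ℝ), Real.exp (-(p * (p⁻¹ * t))) * wrightScaled β 1 s (p⁻¹ * t) =
      p ^ β * (Real.exp (-t) * wrightScaled β 1 (s * p ^ β) t) := by
    intro t ht
    rw [wrightScaled_div 1 s ht hp, mul_inv_cancel_left₀ hp.ne', Nat.cast_one, one_mul]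
    ring
  rw [setIntegral_congr_fun measurableSet_Ioi e, integral_const_mul,
    integral_exp_mul_wrightScaled_one h0 h1 (by positivity)] at h
  rw [Real.rpow_sub_one hp.ne', div_mul_eq_mul_div, eq_div_iff hp.ne', h]
  ring

/-- The formula for `n = 1` is differentiated with respect to `s`. -/
theorem laplace_wrightScaled_two {β : ℝ} (h0 : 0 < β) (h1 : β < 1) {s p : ℝ} (hs : 0 < s)
    (hp : 0 < p) : ∫ t in Ioi (0 : ℝ), Real.exp (-(p * t)) * wrightScaled β 2 s t =
      p ^ (2 * β - 1) * Real.exp (-(s * p ^ β)) := by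
  obtain ⟨C, hC0, hC⟩ := exists_abs_wrightScaled_le_inv_pow h0 h1 (n := 2) (by norm_num)
  have hmem : Ioi (s / 2) ∈ 𝓝 s := Ioi_mem_nhds (by linarith)
  have h2 := integrableOn_exp_mul_Ioi (neg_neg_of_pos hp) 0
  have hd := (hasDerivAt_integral_of_dominated_loc_of_deriv_le (μ := volume.restrict (Ioi 0))
    (F := fun s t => Real.exp (-(p * t)) * wrightScaled β 1 s t)
    (F' := fun s t => Real.exp (-(p * t)) * -wrightScaled β 2 s t)
    (bound := fun t => C * ((s / 2) ^ 2)⁻¹ * Real.exp (-p * t)) hmem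
    (Eventually.of_forall fun s => (ContinuousOn.mul (by fun_prop)
      (continuousOn_wrightScaled_right h0 h1 le_rfl s)).aestronglyMeasurable measurableSet_Ioi)
    (integrableOn_exp_mul_wrightScaled_one h0 h1 hs.le hp)
    ((ContinuousOn.mul (by fun_prop)
      (continuousOn_wrightScaled_right h0 h1 (by norm_num) s).neg).aestronglyMeasurable measurableSet_Ioi)
    ((ae_restrict_iff' measurableSet_Ioi).2 (Eventually.of_forall fun t ht x hx => by
      have hx : s / 2 < x := hx
      rw [norm_mul, Real.norm_of_nonneg (Real.exp_pos _).le, norm_neg, Real.norm_eq_abs, neg_mul, mul_comm]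
      refine mul_le_mul_of_nonneg_right ((hC x (by linarith) t ht).trans
        (mul_le_mul_of_nonneg_left ?_ hC0)) (Real.exp_pos _).le
      exact inv_anti₀ (by positivity) (by gcongr)))
    (h2.const_mul _)
    ((ae_restrict_iff' measurableSet_Ioi).2 (Eventually.of_forall fun t ht x hx =>
      (hasDerivAt_wrightScaled_left h0 h1 le_rfl x ht).const_mul _))).2
  have hd' : HasDerivAt (fun s => p ^ (β - 1) * Real.exp (-(s * p ^ β)))
      (p ^ (β - 1) * (Real.exp (-(s * p ^ β)) * -(1 * p ^ β))) s :=
    (((hasDerivAt_id s).mul_const (p ^ β)).neg.exp).const_mul _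
  have h3 := hd.unique (hd'.congr_of_eventuallyEq (by
    filter_upwards [lt_mem_nhds hs] with x hx
    exact laplace_wrightScaled_one h0 h1 hx.le hp))
  simp only [mul_neg, integral_neg] at h3
  rw [neg_inj] at h3
  rw [h3, show 2 * β - 1 = β - 1 + β by ring, Real.rpow_add hp]
  ring

theorem integrableOn_wrightScaled {β : ℝ} (h0 : 0 < β) (h1 : β < 1) {n : ℕ} (hn : 1 ≤ n) {t : ℝ}
    (ht : 0 < t) : IntegrableOn (fun s => wrightScaled β n s t) (Ioi 0) := by
  obtain ⟨C, -, hC⟩ := exists_integral_rpow_mul_wrightScaled_le h0 h1 hn le_rfl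
    (by exact_mod_cast hn)
  have := (hC t ht).1
  simp only [Real.rpow_zero, one_mul] at this
  exact (integrable_norm_iff (continuous_wrightScaled_left h0 h1 hn t).aestronglyMeasurable).1 this

theorem wrightScaled_integral_const {β : ℝ} (n : ℕ) {t : ℝ} (ht : 0 < t) :
    ∫ s in Ioi (0 : ℝ), wrightScaled β n s t =
      t ^ ((1 - n) * β) * ∫ r in Ioi (0 : ℝ), wrightM β n r := by
  simp only [wrightScaled]
  have hq : 0 < (t ^ β)⁻¹ := by positivity
  have h := integral_comp_mul_left_Ioi (wrightM β n) 0 hq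
  rw [mul_zero, inv_inv, smul_eq_mul] at h
  simp_rw [div_eq_inv_mul]
  rw [integral_const_mul, h, show (1 - (n : ℝ)) * β = -(n * β) + β by ring, Real.rpow_add ht]
  ring

/-- The Wright density has total mass one. -/
theorem integral_wrightScaled_one {β : ℝ} (h0 : 0 < β) (h1 : β < 1) {t : ℝ} (ht : 0 < t) :
    ∫ s in Ioi (0 : ℝ), wrightScaled β 1 s t = 1 := by
  -- By scaling, the mass does not depend on `t`. Averaging it against `e^{-t}` and exchanging the
  -- integrals gives `∫ e^{-s} ds = 1`.
  have hone : ∀ t > 0, ∫ s in Ioi (0 : ℝ), wrightScaled β 1 s t = ∫ r in Ioi (0 : ℝ), wrightM β 1 r :=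
    fun t ht => by rw [wrightScaled_integral_const 1 ht]; simp
  rw [hone t ht]
  obtain ⟨C, hC0, hC⟩ := exists_integral_rpow_mul_wrightScaled_le h0 h1 (n := 1) le_rfl le_rfl
    (by norm_num)
  simp only [Real.rpow_zero, one_mul, Nat.cast_one, zero_add, sub_self, zero_mul, mul_one] at hC
  have he : IntegrableOn (fun t : ℝ => Real.exp (-t)) (Ioi 0) := by
    simpa using exp_neg_integrableOn_Ioi 0 one_pos
  have hG : Integrable (fun z : ℝ × ℝ => Real.exp (-z.1) * wrightScaled β 1 z.2 z.1)
      ((volume.restrict (Ioi 0)).prod (volume.restrict (Ioi 0))) := by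
    have hm : AEStronglyMeasurable (fun z : ℝ × ℝ => Real.exp (-z.1) * wrightScaled β 1 z.2 z.1)
        ((volume.restrict (Ioi 0)).prod (volume.restrict (Ioi 0))) := by
      rw [Measure.prod_restrict]
      refine ContinuousOn.aestronglyMeasurable ?_ (measurableSet_Ioi.prod measurableSet_Ioi)
      exact ContinuousOn.mul (by fun_prop) ((continuousOn_wrightScaled h0 h1 le_rfl).comp
        (f := fun z : ℝ × ℝ => (z.2, z.1)) (by fun_prop) fun z hz => ⟨mem_univ _, hz.1⟩)
    refine (integrable_prod_iff hm).2 ⟨?_, ?_⟩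
    · refine (ae_restrict_iff' measurableSet_Ioi).2 (Eventually.of_forall fun t ht => ?_)
      exact (integrableOn_wrightScaled h0 h1 le_rfl ht).const_mul (Real.exp (-t))
    · refine (he.const_mul C).mono' hm.norm.integral_prod_right' ?_
      refine (ae_restrict_iff' measurableSet_Ioi).2 (Eventually.of_forall fun t ht => ?_)
      rw [Real.norm_of_nonneg (integral_nonneg fun _ => norm_nonneg _)]
      simp only [norm_mul, Real.norm_of_nonneg (Real.exp_pos _).le, Real.norm_eq_abs]
      rw [integral_const_mul, mul_comm]
      exact mul_le_mul_of_nonneg_right (hC t ht).2 (Real.exp_pos _).le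
  have hswap := integral_integral_swap (f := fun t s => Real.exp (-t) * wrightScaled β 1 s t) hG
  have e1 : ∫ t in Ioi (0 : ℝ), ∫ s in Ioi (0 : ℝ), Real.exp (-t) * wrightScaled β 1 s t =
      ∫ r in Ioi (0 : ℝ), wrightM β 1 r := by
    rw [setIntegral_congr_fun (g := fun t => Real.exp (-t) * ∫ r in Ioi (0 : ℝ), wrightM β 1 r)
      measurableSet_Ioi fun t ht => by simp only [integral_const_mul, hone t ht],
      integral_mul_const, integral_exp_neg_Ioi_zero, one_mul]
  have e2 : ∫ s in Ioi (0 : ℝ), ∫ t in Ioi (0 : ℝ), Real.exp (-t) * wrightScaled β 1 s t = 1 := by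
    rw [setIntegral_congr_fun (g := fun s => Real.exp (-s))
      measurableSet_Ioi fun s hs => integral_exp_mul_wrightScaled_one h0 h1 (le_of_lt hs),
      integral_exp_neg_Ioi_zero]
  rw [← e1, hswap, e2]

/-! ### Regularity in time of Wright transforms. -/

theorem integrableOn_rpow_one_add {r : ℝ} (hr : 1 < r) :
    IntegrableOn (fun s : ℝ => (1 + s) ^ (-r)) (Ioi 0) := by
  have h := (integrable_one_add_norm (E := ℝ) (μ := volume) (r := r) (by simpa using hr)).integrableOn
    (s := Ioi 0)
  refine h.congr_fun (fun s hs => ?_) measurableSet_Ioi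
  simp only [Real.norm_of_nonneg (le_of_lt hs)]

theorem rpow_mul_one_add_rpow_le {s a b : ℝ} (hs : 0 < s) (ha : 0 ≤ a) :
    s ^ a * (1 + s) ^ (-b) ≤ (1 + s) ^ (-(b - a)) := by
  rw [show -(b - a) = a + -b by ring, Real.rpow_add (by positivity)]
  gcongr
  linarith

theorem aestronglyMeasurable_mul_wrightScaled {β : ℝ} (h0 : 0 < β) (h1 : β < 1) {n : ℕ} (hn : 1 ≤ n)
    {ψ : ℝ → ℝ} (hψ : ContinuousOn ψ (Ioi 0)) (t : ℝ) :
    AEStronglyMeasurable (fun s => ψ s * wrightScaled β n s t) (volume.restrict (Ioi 0)) :=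
  (hψ.mul (continuous_wrightScaled_left h0 h1 hn t).continuousOn).aestronglyMeasurable measurableSet_Ioi

theorem integrableOn_mul_wrightScaled {β : ℝ} (h0 : 0 < β) (h1 : β < 1) {n : ℕ} (hn : 1 ≤ n)
    {ψ : ℝ → ℝ} (hψ : ContinuousOn ψ (Ioi 0)) {C a : ℝ} (ha : 0 ≤ a) (han : a < n)
    (hb : ∀ s > 0, |ψ s| ≤ C * s ^ a) :
    (∀ t > 0, IntegrableOn (fun s => ψ s * wrightScaled β n s t) (Ioi 0)) ∧
      ∃ K, 0 ≤ K ∧ ∀ t > 0, ∫ s in Ioi (0 : ℝ), |ψ s * wrightScaled β n s t| ≤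
        K * t ^ ((a + 1 - n) * β) := by
  obtain ⟨D, hD0, hD⟩ := exists_integral_rpow_mul_wrightScaled_le h0 h1 hn ha han
  have hC0 : 0 ≤ C := by simpa using (abs_nonneg _).trans (hb 1 one_pos)
  have hle : ∀ t, ∀ s ∈ Ioi (0 : ℝ), |ψ s * wrightScaled β n s t| ≤
      C * (s ^ a * |wrightScaled β n s t|) := fun t s hs => by
    rw [abs_mul, ← mul_assoc]
    exact mul_le_mul_of_nonneg_right (hb s hs) (abs_nonneg _)
  have hi : ∀ t > 0, IntegrableOn (fun s => ψ s * wrightScaled β n s t) (Ioi 0) := fun t ht =>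
    ((hD t ht).1.const_mul C).mono' (aestronglyMeasurable_mul_wrightScaled h0 h1 hn hψ t)
      ((ae_restrict_iff' measurableSet_Ioi).2 (Eventually.of_forall (hle t)))
  refine ⟨hi, C * D, by positivity, fun t ht => ?_⟩
  refine (setIntegral_mono_on (hi t ht).abs ((hD t ht).1.const_mul C) measurableSet_Ioi
    (hle t)).trans ?_
  rw [integral_const_mul, mul_assoc]
  exact mul_le_mul_of_nonneg_left (hD t ht).2 hC0

theorem exists_mul_wrightScaled_dominated {β : ℝ} (h0 : 0 < β) (h1 : β < 1) {n : ℕ} (hn : 1 ≤ n)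
    {ψ : ℝ → ℝ} {C a : ℝ} (ha : 0 ≤ a) (hb : ∀ s > 0, |ψ s| ≤ C * s ^ a) {c d : ℝ} (hc : 0 < c)
    (hd : 0 < d) : ∃ K, 0 ≤ K ∧ ∀ s > 0, ∀ t ∈ Icc c d,
      |ψ s * wrightScaled β n s t| ≤ K * (1 + s) ^ (-((n : ℝ) + 1 - a)) := by
  obtain ⟨D, hD0, hD⟩ := exists_abs_wrightScaled_le_on_Icc h0 h1 hn hc hd
  have hC0 : 0 ≤ C := by simpa using (abs_nonneg _).trans (hb 1 one_pos)
  refine ⟨C * D, by positivity, fun s hs t ht => ?_⟩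
  rw [abs_mul]
  calc |ψ s| * |wrightScaled β n s t| ≤ (C * s ^ a) * (D * (1 + s) ^ (-((n : ℝ) + 1))) :=
        mul_le_mul (hb s hs) (hD s hs.le t ht) (abs_nonneg _) (by positivity)
    _ = C * D * (s ^ a * (1 + s) ^ (-((n : ℝ) + 1))) := by ring
    _ ≤ _ := mul_le_mul_of_nonneg_left (rpow_mul_one_add_rpow_le hs ha) (by positivity)

theorem continuousOn_integral_mul_wrightScaled {β : ℝ} (h0 : 0 < β) (h1 : β < 1) {n : ℕ} (hn : 1 ≤ n)
    {ψ : ℝ → ℝ} (hψ : ContinuousOn ψ (Ioi 0)) {C a : ℝ} (ha : 0 ≤ a) (han : a < n)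
    (hb : ∀ s > 0, |ψ s| ≤ C * s ^ a) :
    ContinuousOn (fun t => ∫ s in Ioi (0 : ℝ), ψ s * wrightScaled β n s t) (Ioi 0) := by
  intro t ht
  have ht : 0 < t := ht
  refine ContinuousAt.continuousWithinAt ?_
  obtain ⟨K, -, hK⟩ := exists_mul_wrightScaled_dominated h0 h1 hn ha hb (half_pos ht)
    (show 0 < 2 * t by linarith)
  refine continuousAt_of_dominated (bound := fun s => K * (1 + s) ^ (-((n : ℝ) + 1 - a)))
    (Eventually.of_forall fun t => aestronglyMeasurable_mul_wrightScaled h0 h1 hn hψ t) ?_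
    ((integrableOn_rpow_one_add (by linarith)).const_mul K) ?_
  · filter_upwards [Icc_mem_nhds (show t / 2 < t by linarith) (show t < 2 * t by linarith)] with τ hτ
    exact (ae_restrict_iff' measurableSet_Ioi).2 (Eventually.of_forall fun s hs => hK s hs τ hτ)
  · refine Eventually.of_forall fun s => ContinuousAt.mul continuousAt_const ?_
    exact (continuousOn_wrightScaled_right h0 h1 hn s).continuousAt (Ioi_mem_nhds ht)

theorem hasDerivAt_integral_mul_wrightScaled {β : ℝ} (h0 : 0 < β) (h1 : β < 1) {ω : ℝ → ℝ}
    (hω : ContinuousOn ω (Ioi 0)) {C : ℝ} (hb : ∀ s > 0, |ω s| ≤ C * s ^ (1 / 2 : ℝ)) {t : ℝ}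
    (ht : 0 < t) :
    HasDerivAt (fun t => ∫ s in Ioi (0 : ℝ), ω s * wrightScaled β 1 s t)
      (-(β / t) * ((∫ s in Ioi (0 : ℝ), ω s * wrightScaled β 1 s t) -
        ∫ s in Ioi (0 : ℝ), ω s * s * wrightScaled β 2 s t)) t := by
  have hb2 : ∀ s > 0, |ω s * s| ≤ C * s ^ (3 / 2 : ℝ) := fun s hs => by
    rw [abs_mul, abs_of_pos hs, show (3 / 2 : ℝ) = 1 / 2 + 1 by norm_num, Real.rpow_add_one hs.ne',
      ← mul_assoc]
    exact mul_le_mul_of_nonneg_right (hb s hs) hs.le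
  have hω2 : ContinuousOn (fun s => ω s * s) (Ioi 0) := hω.mul continuousOn_id
  have h2t : 0 < 2 * t := by linarith
  obtain ⟨K₁, hK₁, hk₁⟩ := exists_mul_wrightScaled_dominated h0 h1 (n := 1) le_rfl (by norm_num) hb
    (half_pos ht) h2t
  obtain ⟨K₂, hK₂, hk₂⟩ := exists_mul_wrightScaled_dominated h0 h1 (n := 2) (by norm_num)
    (by norm_num) hb2 (half_pos ht) h2t
  have i₁ := (integrableOn_mul_wrightScaled h0 h1 (n := 1) le_rfl hω (by norm_num) (by norm_num) hb).1 t ht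
  have i₂ := (integrableOn_mul_wrightScaled h0 h1 (n := 2) (by norm_num) hω2 (by norm_num)
    (by norm_num) hb2).1 t ht
  have hmem : Icc (t / 2) (2 * t) ∈ 𝓝 t := Icc_mem_nhds (by linarith) (by linarith)
  have hd := (hasDerivAt_integral_of_dominated_loc_of_deriv_le (μ := volume.restrict (Ioi 0))
    (F := fun t s => ω s * wrightScaled β 1 s t)
    (F' := fun t s => -(β / t) * (ω s * wrightScaled β 1 s t - ω s * s * wrightScaled β 2 s t))
    (bound := fun s => β / (t / 2) * ((K₁ + K₂) * (1 + s) ^ (-(3 / 2 : ℝ)))) hmem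
    (Eventually.of_forall fun t => aestronglyMeasurable_mul_wrightScaled h0 h1 le_rfl hω t)
    i₁ ((i₁.sub i₂).const_mul _).aestronglyMeasurable ?_
    (((integrableOn_rpow_one_add (by norm_num)).const_mul _).const_mul _) ?_).2
  · rw [integral_const_mul, integral_sub i₁ i₂] at hd
    exact hd
  · refine (ae_restrict_iff' measurableSet_Ioi).2 (Eventually.of_forall fun s hs τ hτ => ?_)
    have hτ0 : 0 < τ := lt_of_lt_of_le (by linarith) hτ.1
    rw [norm_mul, norm_neg, Real.norm_of_nonneg (by positivity : 0 ≤ β / τ), Real.norm_eq_abs]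
    have e1 := hk₁ s hs τ hτ
    have e2 := hk₂ s hs τ hτ
    rw [show -(((1 : ℕ) : ℝ) + 1 - 1 / 2) = -(3 / 2 : ℝ) by norm_num] at e1
    rw [show -(((2 : ℕ) : ℝ) + 1 - 3 / 2) = -(3 / 2 : ℝ) by norm_num] at e2
    refine mul_le_mul (div_le_div_of_nonneg_left h0.le (by linarith) hτ.1) ?_ (abs_nonneg _)
      (by positivity)
    refine (abs_sub _ _).trans ?_
    rw [add_mul]
    exact add_le_add e1 e2
  · refine (ae_restrict_iff' measurableSet_Ioi).2 (Eventually.of_forall fun s hs τ hτ => ?_)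
    have hτ0 : 0 < τ := lt_of_lt_of_le (by linarith) hτ.1
    refine ((hasDerivAt_wrightScaled_right h0 h1 s hτ0).const_mul (ω s)).congr_deriv ?_
    ring

theorem integrableOn_exp_mul_rpow {p b : ℝ} (hp : 0 < p) (hb : -1 < b) :
    IntegrableOn (fun t => Real.exp (-(p * t)) * t ^ b) (Ioi 0) := by
  have := integrableOn_exp_mul_rpow_neg (β := -b) (by linarith) hp
  rwa [neg_neg] at this

theorem integrable_exp_mul_of_abs_le_rpow {g : ℝ → ℝ} (hg : ContinuousOn g (Ioi 0)) {K b p : ℝ}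
    (hp : 0 < p) (hb : -1 < b) (h : ∀ t > 0, |g t| ≤ K * t ^ b) :
    IntegrableOn (fun t => Real.exp (-(p * t)) * g t) (Ioi 0) := by
  refine ((integrableOn_exp_mul_rpow hp hb).const_mul K).mono'
    ((ContinuousOn.mul (by fun_prop) hg).aestronglyMeasurable measurableSet_Ioi)
    ((ae_restrict_iff' measurableSet_Ioi).2 (Eventually.of_forall fun t ht => ?_))
  rw [norm_mul, Real.norm_of_nonneg (Real.exp_pos _).le, Real.norm_eq_abs]
  refine (mul_le_mul_of_nonneg_left (h t ht) (Real.exp_pos _).le).trans_eq ?_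
  ring

theorem laplace_integral_mul_wrightScaled {β : ℝ} (h0 : 0 < β) (h1 : β < 1) {n : ℕ} (hn : 1 ≤ n)
    {ψ : ℝ → ℝ} (hψ : ContinuousOn ψ (Ioi 0)) {C a : ℝ} (ha : 0 ≤ a) (han : a < n)
    (hb : ∀ s > 0, |ψ s| ≤ C * s ^ a) (hexp : -1 < (a + 1 - n) * β) {p : ℝ} (hp : 0 < p) :
    ∫ t in Ioi (0 : ℝ), Real.exp (-(p * t)) * ∫ s in Ioi (0 : ℝ), ψ s * wrightScaled β n s t =
      ∫ s in Ioi (0 : ℝ), ψ s * ∫ t in Ioi (0 : ℝ), Real.exp (-(p * t)) * wrightScaled β n s t := by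
  obtain ⟨hi, K, hK0, hK⟩ := integrableOn_mul_wrightScaled h0 h1 hn hψ ha han hb
  have hG : Integrable (fun z : ℝ × ℝ => Real.exp (-(p * z.1)) * (ψ z.2 * wrightScaled β n z.2 z.1))
      ((volume.restrict (Ioi 0)).prod (volume.restrict (Ioi 0))) := by
    have hm : AEStronglyMeasurable
        (fun z : ℝ × ℝ => Real.exp (-(p * z.1)) * (ψ z.2 * wrightScaled β n z.2 z.1))
        ((volume.restrict (Ioi 0)).prod (volume.restrict (Ioi 0))) := by
      rw [Measure.prod_restrict]
      refine ContinuousOn.aestronglyMeasurable ?_ (measurableSet_Ioi.prod measurableSet_Ioi)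
      exact ContinuousOn.mul (by fun_prop) ((hψ.comp continuousOn_snd fun z hz => hz.2).mul
        ((continuousOn_wrightScaled h0 h1 hn).comp
          (f := fun z : ℝ × ℝ => (z.2, z.1)) (by fun_prop) fun z hz => ⟨mem_univ _, hz.1⟩))
    refine (integrable_prod_iff hm).2 ⟨?_, ?_⟩
    · refine (ae_restrict_iff' measurableSet_Ioi).2 (Eventually.of_forall fun t ht => ?_)
      exact (hi t ht).const_mul (Real.exp (-(p * t)))
    · refine ((integrableOn_exp_mul_rpow hp hexp).const_mul K).mono' hm.norm.integral_prod_right' ?_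
      refine (ae_restrict_iff' measurableSet_Ioi).2 (Eventually.of_forall fun t ht => ?_)
      rw [Real.norm_of_nonneg (integral_nonneg fun _ => norm_nonneg _)]
      simp only [norm_mul (Real.exp _), Real.norm_of_nonneg (Real.exp_pos _).le, Real.norm_eq_abs]
      rw [integral_const_mul]
      refine (mul_le_mul_of_nonneg_left (hK t ht) (Real.exp_pos _).le).trans_eq ?_
      ring
  have hswap := integral_integral_swap
    (f := fun t s => Real.exp (-(p * t)) * (ψ s * wrightScaled β n s t)) hG
  simp only [integral_const_mul] at hswap
  rw [hswap]
  refine integral_congr_ae (Eventually.of_forall fun s => ?_)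
  beta_reduce
  rw [← integral_const_mul]
  refine integral_congr_ae (Eventually.of_forall fun t => ?_)
  ring

/-! ### Abel integrals, Laplace transforms and the Caputo derivative. -/

theorem intervalIntegrable_beta {a b : ℝ} (ha : 0 < a) (hb : b < 1) :
    IntervalIntegrable (fun σ : ℝ => (1 - σ) ^ (-b) * σ ^ (a - 1)) volume 0 1 := by
  have h := (Complex.betaIntegral_convergent (u := (a : ℂ)) (v := ((1 - b : ℝ) : ℂ)) (by simpa)
    (by simp only [Complex.ofReal_re]; linarith)).norm
  refine h.congr fun σ hσ => ?_
  rw [uIoc_of_le zero_le_one] at hσ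
  have e1 : (σ : ℂ) ^ ((a : ℂ) - 1) = ((σ ^ (a - 1) : ℝ) : ℂ) := by
    rw [Complex.ofReal_cpow hσ.1.le]; push_cast; rfl
  have e2 : (1 - (σ : ℂ)) ^ (((1 - b : ℝ) : ℂ) - 1) = (((1 - σ) ^ (-b) : ℝ) : ℂ) := by
    rw [Complex.ofReal_cpow (by linarith [hσ.2])]; push_cast; ring_nf
  rw [e1, e2, norm_mul, Complex.norm_real, Complex.norm_real,
    Real.norm_of_nonneg (Real.rpow_nonneg hσ.1.le _),
    Real.norm_of_nonneg (Real.rpow_nonneg (by linarith [hσ.2]) _), mul_comm]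

/-- Convolution of a weakly singular function with a power, rescaled to the unit interval. -/
theorem abel_rescale {b : ℝ} {g : ℝ → ℝ} {t : ℝ} (ht : 0 < t) :
    ∫ τ in (0 : ℝ)..t, (t - τ) ^ (-b) * g τ =
      t ^ (1 - b) * ∫ σ in (0 : ℝ)..1, (1 - σ) ^ (-b) * g (t * σ) := by
  have h := intervalIntegral.integral_comp_mul_left (a := 0) (b := 1)
    (fun τ => (t - τ) ^ (-b) * g τ) ht.ne'
  rw [mul_zero, mul_one, smul_eq_mul] at h
  have e : ∫ σ in (0 : ℝ)..1, (t - t * σ) ^ (-b) * g (t * σ) =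
      t ^ (-b) * ∫ σ in (0 : ℝ)..1, (1 - σ) ^ (-b) * g (t * σ) := by
    rw [← intervalIntegral.integral_const_mul]
    refine intervalIntegral.integral_congr fun σ hσ => ?_
    rw [uIcc_of_le zero_le_one] at hσ
    rw [show t - t * σ = t * (1 - σ) by ring, Real.mul_rpow ht.le (by linarith [hσ.2]), mul_assoc]
  rw [e] at h
  rw [show 1 - b = -b + 1 by ring, Real.rpow_add_one ht.ne', mul_right_comm, h]
  field_simp

theorem abel_dominated {b a C : ℝ} {g : ℝ → ℝ} (hb : ∀ t > 0, |g t| ≤ C * t ^ (a - 1)) {t σ : ℝ}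
    (ht : 0 < t) (hσ : σ ∈ Ioc (0 : ℝ) 1) :
    ‖(1 - σ) ^ (-b) * g (t * σ)‖ ≤ C * t ^ (a - 1) * ((1 - σ) ^ (-b) * σ ^ (a - 1)) := by
  have h2 := hb (t * σ) (mul_pos ht hσ.1)
  have h3 : 0 ≤ (1 - σ) ^ (-b) := Real.rpow_nonneg (by linarith [hσ.2]) _
  rw [norm_mul, Real.norm_of_nonneg h3, Real.norm_eq_abs]
  refine (mul_le_mul_of_nonneg_left h2 h3).trans_eq ?_
  rw [Real.mul_rpow ht.le hσ.1.le]
  ring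

theorem abel_measurable {b : ℝ} {g : ℝ → ℝ} (hg : ContinuousOn g (Ioi 0)) {t : ℝ} (ht : 0 < t) :
    AEStronglyMeasurable (fun σ => (1 - σ) ^ (-b) * g (t * σ)) (volume.restrict (uIoc 0 1)) := by
  rw [uIoc_of_le zero_le_one]
  refine AEStronglyMeasurable.mul (Measurable.aestronglyMeasurable (by fun_prop)) ?_
  exact (hg.comp (by fun_prop) fun σ hσ => mul_pos ht hσ.1).aestronglyMeasurable measurableSet_Ioc

theorem abel_intervalIntegrable {b a C : ℝ} {g : ℝ → ℝ} (ha : 0 < a) (hb1 : b < 1)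
    (hg : ContinuousOn g (Ioi 0)) (hb : ∀ t > 0, |g t| ≤ C * t ^ (a - 1)) {t : ℝ} (ht : 0 < t) :
    IntervalIntegrable (fun τ => (t - τ) ^ (-b) * g τ) volume 0 t := by
  have h1 : IntervalIntegrable (fun σ => (1 - σ) ^ (-b) * g (t * σ)) volume 0 1 := by
    refine ((intervalIntegrable_beta ha hb1).const_mul (C * t ^ (a - 1))).mono_fun
      (abel_measurable hg ht) ?_
    refine (ae_restrict_iff' measurableSet_uIoc).2 (Eventually.of_forall fun σ hσ => ?_)
    rw [uIoc_of_le zero_le_one] at hσ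
    exact (abel_dominated hb ht hσ).trans (le_abs_self _)
  have h2 : IntervalIntegrable (fun σ => (t - t * σ) ^ (-b) * g (t * σ)) volume (0 / t) (t / t) := by
    rw [zero_div, div_self ht.ne']
    refine (h1.const_mul (t ^ (-b))).congr fun σ hσ => ?_
    rw [uIoc_of_le zero_le_one] at hσ
    rw [show t - t * σ = t * (1 - σ) by ring, Real.mul_rpow ht.le (by linarith [hσ.2]), mul_assoc]
  exact (IntervalIntegrable.comp_mul_left_iff (f := fun τ => (t - τ) ^ (-b) * g τ) ht.ne').1 h2

theorem abel_continuousOn {b a C : ℝ} {g : ℝ → ℝ} (ha : 0 < a) (ha1 : a ≤ 1) (hb1 : b < 1)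
    (hg : ContinuousOn g (Ioi 0)) (hb : ∀ t > 0, |g t| ≤ C * t ^ (a - 1)) :
    ContinuousOn (fun t => ∫ τ in (0 : ℝ)..t, (t - τ) ^ (-b) * g τ) (Ioi 0) := by
  have hC0 : 0 ≤ C := by simpa using (abs_nonneg _).trans (hb 1 one_pos)
  refine ContinuousOn.congr (f := fun t => t ^ (1 - b) * ∫ σ in (0 : ℝ)..1, (1 - σ) ^ (-b) * g (t * σ))
    ?_ fun t ht => abel_rescale ht
  refine ContinuousOn.mul (fun t ht =>
    (Real.continuousAt_rpow_const _ _ (Or.inl (ne_of_gt ht))).continuousWithinAt) fun t ht => ?_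
  have ht : 0 < t := ht
  refine ContinuousAt.continuousWithinAt ?_
  refine intervalIntegral.continuousAt_of_dominated_interval
    (bound := fun σ => C * (t / 2) ^ (a - 1) * ((1 - σ) ^ (-b) * σ ^ (a - 1))) ?_ ?_
    ((intervalIntegrable_beta ha hb1).const_mul _) ?_
  · filter_upwards [lt_mem_nhds ht] with τ hτ
    exact abel_measurable hg hτ
  · filter_upwards [lt_mem_nhds (show t / 2 < t by linarith)] with τ hτ
    refine Eventually.of_forall fun σ hσ => ?_
    rw [uIoc_of_le zero_le_one] at hσ
    refine (abel_dominated hb (show 0 < τ by linarith) hσ).trans ?_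
    have h3 : 0 ≤ (1 - σ) ^ (-b) := Real.rpow_nonneg (by linarith [hσ.2]) _
    have h4 : 0 ≤ σ ^ (a - 1) := Real.rpow_nonneg hσ.1.le _
    refine mul_le_mul_of_nonneg_right (mul_le_mul_of_nonneg_left ?_ hC0) (mul_nonneg h3 h4)
    exact Real.rpow_le_rpow_of_nonpos (by linarith) hτ.le (by linarith)
  · refine Eventually.of_forall fun σ hσ => ?_
    rw [uIoc_of_le zero_le_one] at hσ
    refine continuousAt_const.mul ?_
    exact (hg.continuousAt (Ioi_mem_nhds (mul_pos ht hσ.1))).comp (f := fun t => t * σ) (by fun_prop)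

/-- The factor `e^{-pt} = e^{-pτ} e^{-p(t-τ)}` distributes over the convolution, so the transform is
a product. -/
theorem laplace_abel {b a C : ℝ} {g : ℝ → ℝ} (ha : 0 < a) (hb1 : b < 1)
    (hg : ContinuousOn g (Ioi 0)) (hb : ∀ t > 0, |g t| ≤ C * t ^ (a - 1)) {p : ℝ} (hp : 0 < p) :
    IntegrableOn (fun t => Real.exp (-(p * t)) * ∫ τ in (0 : ℝ)..t, (t - τ) ^ (-b) * g τ) (Ioi 0) ∧
    ∫ t in Ioi (0 : ℝ), Real.exp (-(p * t)) * ∫ τ in (0 : ℝ)..t, (t - τ) ^ (-b) * g τ =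
      (∫ t in Ioi (0 : ℝ), Real.exp (-(p * t)) * g t) * (p ^ (b - 1) * Real.Gamma (1 - b)) := by
  have i1 := integrable_exp_mul_of_abs_le_rpow hg hp (by linarith) hb
  have i2 := integrableOn_exp_mul_rpow_neg hb1 hp
  have e : ∀ t : ℝ, (∫ τ in (0 : ℝ)..t, ContinuousLinearMap.mul ℝ ℝ (Real.exp (-(p * τ)) * g τ)
      (Real.exp (-(p * (t - τ))) * (t - τ) ^ (-b))) =
      Real.exp (-(p * t)) * ∫ τ in (0 : ℝ)..t, (t - τ) ^ (-b) * g τ := by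
    intro t
    rw [← intervalIntegral.integral_const_mul]
    refine intervalIntegral.integral_congr fun τ _ => ?_
    simp only [ContinuousLinearMap.mul_apply']
    rw [show -(p * t) = -(p * τ) + -(p * (t - τ)) by ring, Real.exp_add]
    ring
  have hc := integral_posConvolution i1 i2 (ContinuousLinearMap.mul ℝ ℝ)
  have hi := (integrable_posConvolution i1 i2 (ContinuousLinearMap.mul ℝ ℝ)).integrableOn (s := Ioi 0)
  simp only [e] at hc
  rw [ContinuousLinearMap.mul_apply'] at hc
  refine ⟨hi.congr_fun (fun t ht => ?_) measurableSet_Ioi, hc.trans ?_⟩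
  · rw [posConvolution, indicator_of_mem ht]
    exact e t
  · congr 1
    have := Real.integral_rpow_mul_exp_neg_mul_Ioi (a := 1 - b) (by linarith) hp
    rw [one_div, Real.inv_rpow hp.le, ← Real.rpow_neg hp.le, neg_sub] at this
    rw [← this]
    refine integral_congr_ae (Eventually.of_forall fun t => ?_)
    beta_reduce
    rw [mul_comm]
    ring_nf

/-- No boundary term arises at `0`, because the power bound with `a > 0` forces `V → 0` there. -/
theorem laplace_deriv {a C K : ℝ} {V V' : ℝ → ℝ} (ha : 0 < a) (hV : ∀ t > 0, HasDerivAt V (V' t) t)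
    (hb : ∀ t > 0, |V t| ≤ C * t ^ a) (hc : ContinuousOn V' (Ioi 0))
    (hb' : ∀ t > 0, |V' t| ≤ K * t ^ (a - 1)) {p : ℝ} (hp : 0 < p) :
    ∫ t in Ioi (0 : ℝ), Real.exp (-(p * t)) * V' t =
      p * ∫ t in Ioi (0 : ℝ), Real.exp (-(p * t)) * V t := by
  have hVc : ContinuousOn V (Ioi 0) := fun t ht => (hV t ht).continuousAt.continuousWithinAt
  have i0 := integrable_exp_mul_of_abs_le_rpow hVc hp (by linarith) hb
  have i1 := integrable_exp_mul_of_abs_le_rpow hc hp (by linarith) hb'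
  have hle : ∀ t > 0, ‖Real.exp (-(p * t)) * V t‖ ≤ C * (t ^ a * Real.exp (-p * t)) := by
    intro t ht
    rw [norm_mul, Real.norm_of_nonneg (Real.exp_pos _).le, Real.norm_eq_abs, neg_mul]
    refine (mul_le_mul_of_nonneg_left (hb t ht) (Real.exp_pos _).le).trans_eq ?_
    ring
  have hd : ∀ t : ℝ, HasDerivAt (fun t => Real.exp (-(p * t))) (-p * Real.exp (-(p * t))) t := by
    intro t
    refine ((hasDerivAt_id t).const_mul p).neg.exp.congr_deriv ?_
    simp only [Pi.neg_apply, id]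
    ring
  have h := integral_Ioi_mul_deriv_eq_deriv_mul (a := 0) (a' := 0) (b' := 0)
    (u := fun t => Real.exp (-(p * t))) (u' := fun t => -p * Real.exp (-(p * t))) (v := V) (v' := V')
    (fun t _ => hd t) (fun t ht => hV t ht) i1 ?_ ?_ ?_
  · rw [h]
    simp only [mul_assoc, integral_const_mul]
    ring
  · have : IntegrableOn (fun t => -p * (Real.exp (-(p * t)) * V t)) (Ioi 0) := i0.const_mul (-p)
    refine this.congr_fun (fun t _ => ?_) measurableSet_Ioi
    simp only [Pi.mul_apply]
    ring
  · refine squeeze_zero_norm' (a := fun t => C * (t ^ a * Real.exp (-p * t))) ?_ ?_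
    · filter_upwards [self_mem_nhdsWithin] with t ht using hle t ht
    · have h1 : Tendsto (fun t : ℝ => C * (t ^ a * Real.exp (-p * t))) (𝓝 0)
          (𝓝 (C * (0 ^ a * Real.exp (-p * 0)))) :=
        (((Real.continuousAt_rpow_const 0 a (Or.inr ha.le)).tendsto).mul
          ((by fun_prop : Continuous fun t => Real.exp (-p * t)).tendsto 0)).const_mul C
      rw [Real.zero_rpow ha.ne', zero_mul, mul_zero] at h1
      exact h1.mono_left nhdsWithin_le_nhds
  · refine squeeze_zero_norm' (a := fun t => C * (t ^ a * Real.exp (-p * t))) ?_ ?_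
    · filter_upwards [eventually_gt_atTop 0] with t ht using hle t ht
    · simpa using (tendsto_rpow_mul_exp_neg_mul_atTop_nhds_zero a p hp).const_mul C

/-- An equation for the Caputo derivative, verified on Laplace transforms. -/
theorem caputo_eq_of_laplace {β C K L : ℝ} {V V' G Λ : ℝ → ℝ} (h0 : 0 < β) (h1 : β < 1)
    (hV : ∀ t > 0, HasDerivAt V (V' t) t) (hb : ∀ t > 0, |V t| ≤ C * t ^ (β / 2))
    (hc : ContinuousOn V' (Ioi 0)) (hb' : ∀ t > 0, |V' t| ≤ K * t ^ (β / 2 - 1))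
    (hG : ContinuousOn G (Ioi 0)) (hGb : ∀ t > 0, |G t| ≤ L * t ^ (-(β / 2)))
    (hLV : ∀ p > 0, ∫ t in Ioi (0 : ℝ), Real.exp (-(p * t)) * V t = p ^ (β - 1) * Λ p)
    (hLG : ∀ p > 0, ∫ t in Ioi (0 : ℝ), Real.exp (-(p * t)) * G t = p ^ (2 * β - 1) * Λ p)
    {t : ℝ} (ht : 0 < t) :
    (1 / Real.Gamma (1 - β)) * ∫ τ in (0 : ℝ)..t, (t - τ) ^ (-β) * V' τ = G t := by
  have hΓ := Real.Gamma_pos_of_pos (show 0 < 1 - β by linarith)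
  have hβ2 : 0 < β / 2 := by linarith
  have iG : ∀ p > 0, IntegrableOn (fun t => Real.exp (-(p * t)) * G t) (Ioi 0) := fun p hp =>
    integrable_exp_mul_of_abs_le_rpow hG hp (by linarith) hGb
  have hA := fun (p : ℝ) (hp : 0 < p) => laplace_abel hβ2 h1 hc hb' hp
  -- The transform of the Caputo derivative is `p ^ (β - 1) · p · p ^ (β - 1) Λ p = p ^ (2 β - 1) Λ
  -- p`, the transform of `G`; uniqueness for continuous functions concludes.
  have hD := eq_zero_of_laplace_eq_zero
    (D := fun t => (1 / Real.Gamma (1 - β)) * (∫ τ in (0 : ℝ)..t, (t - τ) ^ (-β) * V' τ) - G t)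
    ((continuousOn_const.mul (abel_continuousOn hβ2 (by linarith) h1 hc hb')).sub hG) ?_ ?_ ht
  · exact sub_eq_zero.1 hD
  · have h2 := ((hA 1 one_pos).1.const_mul (1 / Real.Gamma (1 - β))).sub (iG 1 one_pos)
    refine h2.congr (Eventually.of_forall fun t => ?_)
    simp only [Pi.sub_apply, one_mul]
    ring
  · intro p hp1
    have hp : 0 < p := by linarith
    have e : ∀ t, Real.exp (-(p * t)) * ((1 / Real.Gamma (1 - β)) *
        (∫ τ in (0 : ℝ)..t, (t - τ) ^ (-β) * V' τ) - G t) = (1 / Real.Gamma (1 - β)) *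
        (Real.exp (-(p * t)) * ∫ τ in (0 : ℝ)..t, (t - τ) ^ (-β) * V' τ) -
        Real.exp (-(p * t)) * G t := fun t => by ring
    simp_rw [e]
    rw [integral_sub ((hA p hp).1.const_mul _) (iG p hp), integral_const_mul, (hA p hp).2, hLG p hp,
      laplace_deriv hβ2 hV hb hc hb' hp, hLV p hp]
    have e2 : p ^ (2 * β - 1) = p * p ^ (β - 1) * p ^ (β - 1) := by
      rw [mul_comm p, Real.rpow_sub_one hp.ne' β, div_mul_cancel₀ _ hp.ne',
        mul_div_assoc', ← Real.rpow_add hp, ← Real.rpow_sub_one hp.ne']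
      ring_nf
    rw [e2]
    field_simp
    ring

theorem tendsto_wrightScaled_atTop {β : ℝ} (h0 : 0 < β) (h1 : β < 1) {t : ℝ} (ht : 0 < t) :
    Tendsto (fun s => wrightScaled β 1 s t) atTop (𝓝 0) := by
  obtain ⟨C, -, hC⟩ := exists_abs_wrightScaled_le_inv_pow h0 h1 (n := 1) le_rfl
  refine squeeze_zero_norm' (a := fun s => C * (s ^ 1)⁻¹) ?_ ?_
  · filter_upwards [eventually_gt_atTop 0] with s hs using hC s hs t ht
  · simpa using (tendsto_inv_atTop_zero (𝕜 := ℝ)).const_mul C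

theorem integral_wrightScaled_two {β : ℝ} (h0 : 0 < β) (h1 : β < 1) {t : ℝ} (ht : 0 < t) :
    ∫ s in Ioi (0 : ℝ), wrightScaled β 2 s t = wrightScaled β 1 0 t := by
  have h := integral_Ioi_of_hasDerivAt_of_tendsto (a := 0)
    (continuous_wrightScaled_left h0 h1 le_rfl t).continuousWithinAt
    (fun s _ => hasDerivAt_wrightScaled_left h0 h1 le_rfl s ht)
    (integrableOn_wrightScaled h0 h1 (by norm_num) ht).neg (tendsto_wrightScaled_atTop h0 h1 ht)
  rw [integral_neg] at h
  linarith

/-- The Wright transform of a bounded continuous function with a square root modulus at `0`: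
regularity in time and the Caputo derivative. -/
theorem wright_transform_time {β : ℝ} (h0 : 0 < β) (h1 : β < 1) {u : ℝ → ℝ} {c C N : ℝ}
    (hu : ContinuousOn u (Ioi 0)) (hN : ∀ s > 0, |u s| ≤ N) (hC : ∀ s > 0, |u s - c| ≤ C * √s) :
    (∀ t > 0, IntegrableOn (fun s => u s * wrightScaled β 1 s t) (Ioi 0)) ∧
    (∃ K, ∀ t > 0, |(∫ s in Ioi (0 : ℝ), u s * wrightScaled β 1 s t) - c| ≤ K * t ^ (β / 2)) ∧
    ∃ v' : ℝ → ℝ, ContinuousOn v' (Ioi 0) ∧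
      (∀ t > 0, HasDerivAt (fun t => ∫ s in Ioi (0 : ℝ), u s * wrightScaled β 1 s t) (v' t) t) ∧
      (∀ t > 0, IntervalIntegrable (fun τ => (t - τ) ^ (-β) * v' τ) volume 0 t) ∧
      ∀ t > 0, (1 / Real.Gamma (1 - β)) * ∫ τ in (0 : ℝ)..t, (t - τ) ^ (-β) * v' τ =
        (∫ s in Ioi (0 : ℝ), u s * wrightScaled β 2 s t) - c * wrightScaled β 1 0 t := by
  -- Removing the initial value `c` leaves a function of size `√s`. Its transform then has a
  -- derivative of size `t ^ (β / 2 - 1)`, integrable at `0`, and the Laplace transform of that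
  -- derivative has no boundary term.
  set ω : ℝ → ℝ := fun s => u s - c with hωdef
  have hω : ContinuousOn ω (Ioi 0) := hu.sub continuousOn_const
  have hb : ∀ s > 0, |ω s| ≤ C * s ^ (1 / 2 : ℝ) := fun s hs => by
    rw [← Real.sqrt_eq_rpow]; exact hC s hs
  have hb2 : ∀ s > 0, |ω s * s| ≤ C * s ^ (3 / 2 : ℝ) := fun s hs => by
    rw [abs_mul, abs_of_pos hs, show (3 / 2 : ℝ) = 1 / 2 + 1 by norm_num, Real.rpow_add_one hs.ne',
      ← mul_assoc]
    exact mul_le_mul_of_nonneg_right (hb s hs) hs.le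
  have hω2 : ContinuousOn (fun s => ω s * s) (Ioi 0) := hω.mul continuousOn_id
  have hN' : ∀ s > 0, |u s| ≤ N * s ^ (0 : ℝ) := fun s hs => by
    rw [Real.rpow_zero, mul_one]; exact hN s hs
  have one_le_two' : 1 ≤ 2 := by norm_num
  obtain ⟨i₁, K₁, hK₁0, hK₁⟩ := integrableOn_mul_wrightScaled h0 h1 (n := 1) le_rfl hω (by norm_num)
    (by norm_num) hb
  obtain ⟨i₂, K₂, hK₂0, hK₂⟩ := integrableOn_mul_wrightScaled h0 h1 (n := 2) one_le_two' hω2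
    (by norm_num) (by norm_num) hb2
  obtain ⟨i₃, K₃, hK₃0, hK₃⟩ := integrableOn_mul_wrightScaled h0 h1 (n := 2) one_le_two' hω
    (by norm_num) (by norm_num) hb
  have iu := (integrableOn_mul_wrightScaled h0 h1 (n := 1) le_rfl hu le_rfl (by norm_num) hN').1
  have iu2 := (integrableOn_mul_wrightScaled h0 h1 (n := 2) one_le_two' hu le_rfl (by norm_num) hN').1
  have habs : ∀ g : ℝ → ℝ, |∫ s in Ioi (0 : ℝ), g s| ≤ ∫ s in Ioi (0 : ℝ), |g s| := fun g =>
    abs_integral_le_integral_abs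
  have ev : ∀ t > 0, (∫ s in Ioi (0 : ℝ), u s * wrightScaled β 1 s t) - c =
      ∫ s in Ioi (0 : ℝ), ω s * wrightScaled β 1 s t := by
    intro t ht
    have : ∀ s, ω s * wrightScaled β 1 s t = u s * wrightScaled β 1 s t - c * wrightScaled β 1 s t :=
      fun s => by rw [hωdef]; ring
    simp_rw [this]
    rw [integral_sub (iu t ht) ((integrableOn_wrightScaled h0 h1 le_rfl ht).const_mul c),
      integral_const_mul, integral_wrightScaled_one h0 h1 ht, mul_one]
  have e2 : ∀ t > 0, ∫ s in Ioi (0 : ℝ), ω s * wrightScaled β 2 s t =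
      (∫ s in Ioi (0 : ℝ), u s * wrightScaled β 2 s t) - c * wrightScaled β 1 0 t := by
    intro t ht
    have : ∀ s, ω s * wrightScaled β 2 s t = u s * wrightScaled β 2 s t - c * wrightScaled β 2 s t :=
      fun s => by rw [hωdef]; ring
    simp_rw [this]
    rw [integral_sub (iu2 t ht) ((integrableOn_wrightScaled h0 h1 one_le_two' ht).const_mul c),
      integral_const_mul, integral_wrightScaled_two h0 h1 ht]
  have b1 : ∀ t > 0, |∫ s in Ioi (0 : ℝ), ω s * wrightScaled β 1 s t| ≤ K₁ * t ^ (β / 2) :=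
    fun t ht => ((habs _).trans (hK₁ t ht)).trans_eq (by push_cast; ring_nf)
  have b2 : ∀ t > 0, |∫ s in Ioi (0 : ℝ), ω s * s * wrightScaled β 2 s t| ≤ K₂ * t ^ (β / 2) :=
    fun t ht => ((habs _).trans (hK₂ t ht)).trans_eq (by push_cast; ring_nf)
  have b3 : ∀ t > 0, |∫ s in Ioi (0 : ℝ), ω s * wrightScaled β 2 s t| ≤ K₃ * t ^ (-(β / 2)) :=
    fun t ht => ((habs _).trans (hK₃ t ht)).trans_eq (by push_cast; ring_nf)
  let v' : ℝ → ℝ := fun t => -(β / t) * ((∫ s in Ioi (0 : ℝ), ω s * wrightScaled β 1 s t) -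
        ∫ s in Ioi (0 : ℝ), ω s * s * wrightScaled β 2 s t)
  have hv'c : ContinuousOn v' (Ioi 0) := by
    refine ContinuousOn.mul (ContinuousOn.neg (ContinuousOn.div (by fun_prop) (by fun_prop)
      fun t ht => ne_of_gt ht)) (ContinuousOn.sub ?_ ?_)
    · exact continuousOn_integral_mul_wrightScaled h0 h1 le_rfl hω (by norm_num) (by norm_num) hb
    · exact continuousOn_integral_mul_wrightScaled h0 h1 one_le_two' hω2 (by norm_num) (by norm_num) hb2
  have hv'b : ∀ t > 0, |v' t| ≤ (β * (K₁ + K₂)) * t ^ (β / 2 - 1) := by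
    intro t ht
    simp only [v']
    rw [abs_mul, abs_neg, abs_of_nonneg (by positivity : 0 ≤ β / t), Real.rpow_sub_one ht.ne']
    calc _ ≤ β / t * (K₁ * t ^ (β / 2) + K₂ * t ^ (β / 2)) := by
          refine mul_le_mul_of_nonneg_left ((abs_sub _ _).trans (add_le_add (b1 t ht) (b2 t ht)))
            (by positivity)
      _ = _ := by ring
  have hV : ∀ t > 0, HasDerivAt (fun t => ∫ s in Ioi (0 : ℝ), ω s * wrightScaled β 1 s t) (v' t) t :=
    fun t ht => hasDerivAt_integral_mul_wrightScaled h0 h1 hω hb ht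
  refine ⟨iu, ⟨K₁, fun t ht => by rw [ev t ht]; exact b1 t ht⟩, v', hv'c, fun t ht => ?_,
    fun t ht => abel_intervalIntegrable (by linarith) h1 hv'c hv'b ht, fun t ht => ?_⟩
  · refine ((hV t ht).add_const c).congr_of_eventuallyEq ?_
    filter_upwards [lt_mem_nhds ht] with τ hτ
    rw [← ev τ hτ]
    ring
  · rw [← e2 t ht]
    refine caputo_eq_of_laplace (Λ := fun p => ∫ s in Ioi (0 : ℝ), ω s * Real.exp (-(s * p ^ β)))
      h0 h1 hV b1 hv'c hv'b
      (continuousOn_integral_mul_wrightScaled h0 h1 one_le_two' hω (by norm_num) (by norm_num) hb)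
      b3 (fun p hp => ?_) (fun p hp => ?_) ht
    · rw [laplace_integral_mul_wrightScaled h0 h1 le_rfl hω (by norm_num) (by norm_num) hb
        (by push_cast; nlinarith) hp, ← integral_const_mul]
      refine setIntegral_congr_fun measurableSet_Ioi fun s hs => ?_
      rw [laplace_wrightScaled_one h0 h1 (le_of_lt hs) hp]
      ring
    · rw [laplace_integral_mul_wrightScaled h0 h1 one_le_two' hω (by norm_num) (by norm_num) hb
        (by push_cast; nlinarith) hp, ← integral_const_mul]
      refine setIntegral_congr_fun measurableSet_Ioi fun s hs => ?_
      rw [laplace_wrightScaled_two h0 h1 hs hp]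
      ring

/-! ### The spatial operator under the Wright transform. -/

/-- A limit theorem for the operator `x w'' + f w'` in divergence form. -/
theorem exists_operator_limit {f F : ℝ → ℝ} (hF : ∀ x > 0, HasDerivAt F (f x / x) x)
    {w w₁ w₂ g : ℕ → ℝ → ℝ} {W G : ℝ → ℝ}
    (hw : ∀ n, ∀ x > 0, HasDerivAt (w n) (w₁ n x) x)
    (hw₁ : ∀ n, ∀ x > 0, HasDerivAt (w₁ n) (w₂ n x) x)
    (hLw : ∀ n, ∀ x > 0, x * w₂ n x + f x * w₁ n x = g n x)
    (hg : ∀ n, ContinuousOn (g n) (Ioi 0)) (hG : ContinuousOn G (Ioi 0))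
    {K : ℝ → ℝ} (hK : ContinuousOn K (Ioi 0)) (hgK : ∀ n, ∀ x > 0, |g n x| ≤ K x)
    (hgG : ∀ x > 0, Tendsto (fun n => g n x) atTop (𝓝 (G x)))
    (hwW : ∀ x > 0, Tendsto (fun n => w n x) atTop (𝓝 (W x))) :
    ∃ W₁ : ℝ → ℝ, ∀ x > 0, HasDerivAt W (W₁ x) x ∧
      HasDerivAt W₁ ((G x - f x * W₁ x) / x) x := by
  have hFc : ContinuousOn F (Ioi 0) := fun x hx => (hF x hx).continuousAt.continuousWithinAt
  have heF : ContinuousOn (fun x => Real.exp (F x)) (Ioi 0) := Real.continuous_exp.comp_continuousOn hFc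
  have heF' : ContinuousOn (fun x => Real.exp (-F x)) (Ioi 0) :=
    Real.continuous_exp.comp_continuousOn hFc.neg
  have hdiv : ∀ h : ℝ → ℝ, ContinuousOn h (Ioi 0) →
      ContinuousOn (fun x => Real.exp (F x) * (h x / x)) (Ioi 0) := fun h hh =>
    heF.mul (hh.div continuousOn_id fun x hx => ne_of_gt hx)
  have hprim : ∀ h : ℝ → ℝ, ContinuousOn h (Ioi 0) → ∀ x > 0,
      HasDerivAt (fun x => ∫ y in (1 : ℝ)..x, h y) (h x) x := fun h hh x hx =>
    intervalIntegral.integral_hasDerivAt_right (intervalIntegrable_of_continuousOn_Ioi hh one_pos hx)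
      (hh.stronglyMeasurableAtFilter isOpen_Ioi x hx) (hh.continuousAt (Ioi_mem_nhds hx))
  have huIoc : ∀ x > 0, uIoc 1 x ⊆ Ioi (0 : ℝ) := fun x hx y hy =>
    lt_of_le_of_lt (le_min zero_le_one (le_of_lt hx)) hy.1
  have huIcc : ∀ x > 0, uIcc 1 x ⊆ Ioi (0 : ℝ) := fun x hx y hy =>
    lt_of_lt_of_le (lt_min one_pos hx) hy.1
  let R : (ℝ → ℝ) → ℝ → ℝ := fun h x => ∫ y in (1 : ℝ)..x, Real.exp (F y) * (h y / y)
  have hR : ∀ h : ℝ → ℝ, ContinuousOn h (Ioi 0) → ∀ x > 0,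
      HasDerivAt (R h) (Real.exp (F x) * (h x / x)) x := fun h hh => hprim _ (hdiv h hh)
  have hRc : ∀ h : ℝ → ℝ, ContinuousOn h (Ioi 0) → ContinuousOn (R h) (Ioi 0) := fun h hh x hx =>
    (hR h hh x hx).continuousAt.continuousWithinAt
  let S : (ℝ → ℝ) → ℝ → ℝ := fun h x => ∫ y in (1 : ℝ)..x, Real.exp (-F y) * R h y
  have hS : ∀ h : ℝ → ℝ, ContinuousOn h (Ioi 0) → ∀ x > 0,
      HasDerivAt (S h) (Real.exp (-F x) * R h x) x := fun h hh => hprim _ (heF'.mul (hRc h hh))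
  let T : ℝ → ℝ := fun x => ∫ y in (1 : ℝ)..x, Real.exp (-F y)
  have hT : ∀ x > 0, HasDerivAt T (Real.exp (-F x)) x := hprim _ heF'
  -- The equation reads `(e^F w')' = e^F g / x`, so the flux `e^F w'` is a constant `P n` plus an
  -- integral of `g n`. No convergence of the derivatives `w₁ n` is assumed.
  let P : ℕ → ℝ := fun n => Real.exp (F 1) * w₁ n 1
  have hflux : ∀ n, ∀ x > 0, Real.exp (F x) * w₁ n x = P n + R (g n) x := by
    intro n x hx
    have hd : ∀ y ∈ uIcc 1 x, HasDerivAt (fun y => Real.exp (F y) * w₁ n y)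
        (Real.exp (F y) * (g n y / y)) y := fun y hy => by
      have hy := huIcc x hx hy
      have hy0 : (0 : ℝ) < y := hy
      refine ((hF y hy).exp.mul (hw₁ n y hy)).congr_deriv ?_
      rw [← hLw n y hy]
      field_simp
      ring
    have := intervalIntegral.integral_eq_sub_of_hasDerivAt hd
      (intervalIntegrable_of_continuousOn_Ioi (hdiv _ (hg n)) one_pos hx)
    simp only [R, P, this]
    ring
  have hrep : ∀ n, ∀ x > 0, w n x = w n 1 + P n * T x + S (g n) x := by
    intro n x hx
    have hd : ∀ y ∈ uIcc 1 x, HasDerivAt (w n)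
        (P n * Real.exp (-F y) + Real.exp (-F y) * R (g n) y) y := fun y hy => by
      have hy := huIcc x hx hy
      refine (hw n y hy).congr_deriv ?_
      rw [mul_comm (P n), ← mul_add, ← hflux n y hy, ← mul_assoc, ← Real.exp_add]
      simp
    have i1 := intervalIntegrable_of_continuousOn_Ioi heF' one_pos hx
    have i2 : IntervalIntegrable (fun y => Real.exp (-F y) * R (g n) y) volume 1 x :=
      intervalIntegrable_of_continuousOn_Ioi (heF'.mul (hRc _ (hg n))) one_pos hx
    have := intervalIntegral.integral_eq_sub_of_hasDerivAt hd ((i1.const_mul (P n)).add i2)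
    rw [intervalIntegral.integral_add (i1.const_mul (P n)) i2, intervalIntegral.integral_const_mul] at this
    simp only [T, S]
    linarith
  have hRlim : ∀ x > 0, Tendsto (fun n => R (g n) x) atTop (𝓝 (R G x)) := by
    intro x hx
    refine intervalIntegral.tendsto_integral_filter_of_dominated_convergence
      (fun y => Real.exp (F y) * (K y / y)) (Eventually.of_forall fun n =>
        ((hdiv _ (hg n)).mono (huIoc x hx)).aestronglyMeasurable measurableSet_uIoc)
      (Eventually.of_forall fun n => Eventually.of_forall fun y hy => ?_)
      (intervalIntegrable_of_continuousOn_Ioi (hdiv _ hK) one_pos hx)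
      (Eventually.of_forall fun y hy => ?_)
    · have hy0 : (0 : ℝ) < y := huIoc x hx hy
      rw [norm_mul, norm_div, Real.norm_of_nonneg (Real.exp_pos _).le, Real.norm_of_nonneg hy0.le,
        Real.norm_eq_abs]
      have := hgK n y hy0
      gcongr
    · exact ((hgG y (huIoc x hx hy)).div_const y).const_mul _
  have hRb : ∀ x > 0, ∃ M, ∀ n, ∀ y ∈ uIoc 1 x, |R (g n) y| ≤ M := by
    intro x hx
    have hKc := hdiv _ hK
    obtain ⟨M, hM⟩ := isCompact_uIcc.exists_bound_of_continuousOn (hKc.mono (huIcc x hx))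
    refine ⟨M * |x - 1|, fun n y hy => ?_⟩
    have hM0 : 0 ≤ M := (norm_nonneg _).trans (hM 1 left_mem_uIcc)
    have hsub : uIcc 1 y ⊆ uIcc 1 x := uIcc_subset_uIcc left_mem_uIcc (uIoc_subset_uIcc hy)
    have h1 : ‖R (g n) y‖ ≤ M * |y - 1| := by
      refine intervalIntegral.norm_integral_le_of_norm_le_const fun z hz => ?_
      have hz' := hsub (uIoc_subset_uIcc hz)
      have hz0 : (0 : ℝ) < z := huIcc x hx hz'
      refine le_trans ?_ ((le_abs_self _).trans (hM z hz'))
      rw [norm_mul, norm_div, Real.norm_of_nonneg (Real.exp_pos _).le, Real.norm_of_nonneg hz0.le,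
        Real.norm_eq_abs]
      have := hgK n z hz0
      gcongr
    refine h1.trans (mul_le_mul_of_nonneg_left ?_ hM0)
    have := abs_sub_left_of_mem_uIcc (uIoc_subset_uIcc hy)
    rwa [abs_sub_comm y, abs_sub_comm x] at *
  have hSlim : ∀ x > 0, Tendsto (fun n => S (g n) x) atTop (𝓝 (S G x)) := by
    intro x hx
    obtain ⟨M, hM⟩ := hRb x hx
    refine intervalIntegral.tendsto_integral_filter_of_dominated_convergence
      (fun y => Real.exp (-F y) * M) (Eventually.of_forall fun n =>
        ((heF'.mul (hRc _ (hg n))).mono (huIoc x hx)).aestronglyMeasurable measurableSet_uIoc)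
      (Eventually.of_forall fun n => Eventually.of_forall fun y hy => ?_)
      (intervalIntegrable_of_continuousOn_Ioi (heF'.mul continuousOn_const) one_pos hx)
      (Eventually.of_forall fun y hy => ?_)
    · rw [norm_mul, Real.norm_of_nonneg (Real.exp_pos _).le, Real.norm_eq_abs]
      exact mul_le_mul_of_nonneg_left (hM n y hy) (Real.exp_pos _).le
    · exact (hRlim y (huIoc x hx hy)).const_mul _
  -- As `T 2 ≠ 0`, the values of `w n` at `1` and `2` determine `P n`; hence `P n` converges, and
  -- the representation of `w n` passes to the limit.
  have hT2 : 0 < T 2 := by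
    refine intervalIntegral.intervalIntegral_pos_of_pos_on
      (intervalIntegrable_of_continuousOn_Ioi heF' one_pos two_pos) (fun y _ => Real.exp_pos _)
      (by norm_num)
  have hPlim : Tendsto P atTop (𝓝 ((W 2 - W 1 - S G 2) / T 2)) := by
    refine ((((hwW 2 two_pos).sub (hwW 1 one_pos)).sub (hSlim 2 two_pos)).div_const (T 2)).congr
      fun n => ?_
    rw [hrep n 2 two_pos]
    field_simp
    ring
  set p := (W 2 - W 1 - S G 2) / T 2 with hp
  have hWrep : ∀ x > 0, W x = W 1 + p * T x + S G x := fun x hx =>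
    tendsto_nhds_unique (hwW x hx) ((((hwW 1 one_pos).add (hPlim.mul_const (T x))).add
      (hSlim x hx)).congr fun n => (hrep n x hx).symm)
  refine ⟨fun x => Real.exp (-F x) * (p + R G x), fun x hx => ⟨?_, ?_⟩⟩
  · have h := (((hT x hx).const_mul p).const_add (W 1)).add (hS G hG x hx)
    refine (h.congr_of_eventuallyEq ?_).congr_deriv (by ring)
    filter_upwards [lt_mem_nhds hx] with y hy using hWrep y hy
  · refine ((hF x hx).neg.exp.mul ((hR G hG x hx).const_add p)).congr_deriv ?_
    have : Real.exp (-F x) * Real.exp (F x) = 1 := by rw [← Real.exp_add]; simp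
    simp only [Pi.neg_apply]
    have hx' : x ≠ 0 := ne_of_gt hx
    field_simp
    linear_combination G x * this

theorem SpaceC1.hasDerivAt_intervalIntegral_mul {K K' : ℝ → ℝ → ℝ} (hK : SpaceC1 K K') {h : ℝ → ℝ}
    (hh : Continuous h) {a b : ℝ} (ha : 0 < a) (hb : 0 < b) {x : ℝ} (hx : 0 < x) :
    HasDerivAt (fun x => ∫ s in a..b, K x s * h s) (∫ s in a..b, K' x s * h s) x := by
  have hpos : ∀ s ∈ uIcc a b, 0 < s := fun s hs => lt_of_lt_of_le (lt_min ha hb) hs.1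
  have hcomp : IsCompact (Icc (x / 2) (2 * x) ×ˢ uIcc a b) := isCompact_Icc.prod isCompact_uIcc
  obtain ⟨M, hM⟩ := hcomp.exists_bound_of_continuousOn
    (f := fun q : ℝ × ℝ => K' q.1 q.2 * h q.2)
    ((hK.cont'.mono fun q hq => ⟨lt_of_lt_of_le (half_pos hx) hq.1.1, hpos _ hq.2⟩).mul
      (hh.comp continuous_snd).continuousOn)
  have hmeas : ∀ {J : ℝ → ℝ → ℝ}, ContinuousOn (fun q : ℝ × ℝ => J q.1 q.2) (Ioi 0 ×ˢ Ioi 0) →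
      ∀ y > 0, ContinuousOn (fun s => J y s * h s) (Ioi 0) := fun hJ y hy =>
    (hJ.slice_snd hy).mul hh.continuousOn
  have hsub : uIoc a b ⊆ Ioi 0 := fun s hs => hpos s (uIoc_subset_uIcc hs)
  refine (intervalIntegral.hasDerivAt_integral_of_dominated_loc_of_deriv_le (bound := fun _ => M)
    (F := fun x s => K x s * h s) (F' := fun x s => K' x s * h s)
    (Icc_mem_nhds (show x / 2 < x by linarith) (show x < 2 * x by linarith)) ?_
    (intervalIntegrable_of_continuousOn_Ioi (hmeas hK.cont x hx) ha hb)
    (((hmeas hK.cont' x hx).mono hsub).aestronglyMeasurable measurableSet_uIoc) ?_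
    intervalIntegrable_const ?_).2
  · filter_upwards [lt_mem_nhds hx] with y hy
    exact ((hmeas hK.cont y hy).mono hsub).aestronglyMeasurable measurableSet_uIoc
  · exact Eventually.of_forall fun s hs y hy => hM (y, s) ⟨hy, uIoc_subset_uIcc hs⟩
  · exact Eventually.of_forall fun s hs y hy =>
      (hK.deriv y (lt_of_lt_of_le (half_pos hx) hy.1) s (hsub hs)).mul_const (h s)

theorem IsParabolic.tendsto_initial {f φ : ℝ → ℝ} {u u₁ u₂ : ℝ → ℝ → ℝ} (h : IsParabolic f φ u u₁ u₂)
    {x : ℝ} (hx : 0 < x) : Tendsto (u x) (𝓝[>] 0) (𝓝 (φ x)) := by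
  obtain ⟨C, hC⟩ := h.rate x hx
  rw [tendsto_iff_norm_sub_tendsto_zero]
  refine squeeze_zero' (Eventually.of_forall fun _ => norm_nonneg _)
    (by filter_upwards [self_mem_nhdsWithin] with t ht using hC t ht) ?_
  have := ((Real.continuous_sqrt.tendsto 0).const_mul C).mono_left (nhdsWithin_le_nhds (s := Ioi 0))
  simpa using this

/-- The spatial operator commutes with the Wright transform. -/
theorem IsParabolic.exists_wright_operator {f φ F : ℝ → ℝ} {u u₁ u₂ : ℝ → ℝ → ℝ}
    (h : IsParabolic f φ u u₁ u₂) (hF : ∀ x > 0, HasDerivAt F (f x / x) x)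
    (hφ : ContinuousOn φ (Ioi 0)) {β : ℝ} (h0 : 0 < β) (h1 : β < 1) {t : ℝ} (ht : 0 < t) :
    ContinuousOn (fun x => (∫ s in Ioi (0 : ℝ), u x s * wrightScaled β 2 s t) -
      φ x * wrightScaled β 1 0 t) (Ioi 0) ∧
    ∃ w' : ℝ → ℝ, ∀ x > 0,
      HasDerivAt (fun x => ∫ s in Ioi (0 : ℝ), u x s * wrightScaled β 1 s t) (w' x) x ∧
      HasDerivAt w' ((((∫ s in Ioi (0 : ℝ), u x s * wrightScaled β 2 s t) -
        φ x * wrightScaled β 1 0 t) - f x * w' x) / x) x := by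
  obtain ⟨N, hN, hb⟩ := h.bound
  have one_le_two' : 1 ≤ 2 := by norm_num
  have c1 := continuous_wrightScaled_left h0 h1 (n := 1) le_rfl t
  have c2 := continuous_wrightScaled_left h0 h1 (n := 2) one_le_two' t
  have j1 := integrableOn_wrightScaled h0 h1 (n := 1) le_rfl ht
  have j2 := integrableOn_wrightScaled h0 h1 (n := 2) one_le_two' ht
  have hu : ∀ x > 0, ContinuousOn (u x) (Ioi 0) := fun x hx => h.space₁.cont.slice_snd hx
  have hN0 : ∀ x > 0, 0 ≤ N x := fun x hx => (abs_nonneg _).trans (hb x hx 1 one_pos)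
  have hint : ∀ g : ℝ → ℝ, Continuous g → IntegrableOn g (Ioi 0) → ∀ x > 0,
      IntegrableOn (fun s => u x s * g s) (Ioi 0) := by
    intro g hg hgi x hx
    refine (hgi.norm.const_mul (N x)).mono' (((hu x hx).mul hg.continuousOn).aestronglyMeasurable
      measurableSet_Ioi) ((ae_restrict_iff' measurableSet_Ioi).2 (Eventually.of_forall fun s hs => ?_))
    rw [norm_mul]
    exact mul_le_mul_of_nonneg_right (hb x hx s hs) (norm_nonneg _)
  have hGc : ContinuousOn (fun x => ∫ s in Ioi (0 : ℝ), u x s * wrightScaled β 2 s t) (Ioi 0) := by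
    intro x hx
    have hx : 0 < x := hx
    refine ContinuousAt.continuousWithinAt ?_
    have hNx := (hN.continuousAt (Ioi_mem_nhds hx)).eventually (gt_mem_nhds (lt_add_one (N x)))
    refine continuousAt_of_dominated (bound := fun s => (N x + 1) * ‖wrightScaled β 2 s t‖) ?_ ?_
      (j2.norm.const_mul _) ?_
    · filter_upwards [lt_mem_nhds hx] with y hy
      exact (hint _ c2 j2 y hy).aestronglyMeasurable
    · filter_upwards [lt_mem_nhds hx, hNx] with y hy hy'
      refine (ae_restrict_iff' measurableSet_Ioi).2 (Eventually.of_forall fun s hs => ?_)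
      rw [norm_mul]
      exact mul_le_mul_of_nonneg_right ((hb y hy s hs).trans hy'.le) (norm_nonneg _)
    · refine (ae_restrict_iff' measurableSet_Ioi).2 (Eventually.of_forall fun s hs => ?_)
      exact ((h.space₁.cont.slice_fst hs).continuousAt (Ioi_mem_nhds hx)).mul continuousAt_const
  have hG := hGc.sub (hφ.mul (continuousOn_const (c := wrightScaled β 1 0 t)))
  refine ⟨hG, ?_⟩
  -- The bounds on `u` do not extend to `u₁` and `u₂` as `s → 0` or `s → ∞`, so the integral in `s`
  -- is truncated to `[a n, b n]`, where differentiation in `x` is unproblematic.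
  let a : ℕ → ℝ := fun n => 1 / ((n : ℝ) + 1)
  let b : ℕ → ℝ := fun n => (n : ℝ) + 1
  have ha : ∀ n, 0 < a n := fun n => by positivity
  have hbp : ∀ n, 0 < b n := fun n => by positivity
  have hab : ∀ n, a n ≤ b n := fun n => by
    have : (1 : ℝ) ≤ (n : ℝ) + 1 := by linarith [(Nat.cast_nonneg n : (0 : ℝ) ≤ n)]
    simp only [a, b]
    rw [div_le_iff₀ (by positivity)]
    nlinarith
  have hat : Tendsto a atTop (𝓝[>] 0) := tendsto_nhdsWithin_iff.2
    ⟨tendsto_one_div_add_atTop_nhds_zero_nat, Eventually.of_forall ha⟩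
  have hbt : Tendsto b atTop atTop := tendsto_natCast_atTop_atTop.atTop_add tendsto_const_nhds
  have hlim : ∀ g : ℝ → ℝ, IntegrableOn g (Ioi 0) →
      Tendsto (fun n => ∫ s in a n..b n, g s) atTop (𝓝 (∫ s in Ioi (0 : ℝ), g s)) := by
    intro g hg
    have hU : ⋃ n, Ioc (a n) (b n) = Ioi 0 := by
      refine Subset.antisymm (iUnion_subset fun n s hs => (ha n).trans hs.1) fun s hs => ?_
      have e1 := (tendsto_nhdsWithin_iff.1 hat).1.eventually (gt_mem_nhds (show 0 < s from hs))
      obtain ⟨n, hn, hn'⟩ := (e1.and (hbt.eventually_ge_atTop s)).exists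
      exact mem_iUnion.2 ⟨n, hn, hn'⟩
    have hm : Monotone fun n => Ioc (a n) (b n) := fun m n hmn => by
      have : (m : ℝ) ≤ n := by exact_mod_cast hmn
      exact Ioc_subset_Ioc (one_div_le_one_div_of_le (by positivity) (by linarith))
        (add_le_add_left this 1)
    have := tendsto_setIntegral_of_monotone (fun n => measurableSet_Ioc) hm (by rwa [hU])
    rw [hU] at this
    exact this.congr fun n => (intervalIntegral.integral_of_le (hab n)).symm
  obtain ⟨C, hC0, hC⟩ := exists_abs_wrightScaled_le_rpow h0 h1 (n := 1) le_rfl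
  set c := C * t ^ (-(((1 : ℕ) : ℝ) * β)) with hc
  set I₂ := ∫ s in Ioi (0 : ℝ), |wrightScaled β 2 s t| with hI₂
  refine exists_operator_limit hF
    (w := fun n x => ∫ s in a n..b n, u x s * wrightScaled β 1 s t)
    (w₁ := fun n x => ∫ s in a n..b n, u₁ x s * wrightScaled β 1 s t)
    (w₂ := fun n x => ∫ s in a n..b n, u₂ x s * wrightScaled β 1 s t)
    (g := fun n x => u x (b n) * wrightScaled β 1 (b n) t - u x (a n) * wrightScaled β 1 (a n) t +
      ∫ s in a n..b n, u x s * wrightScaled β 2 s t)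
    (fun n x hx => h.space₁.hasDerivAt_intervalIntegral_mul c1 (ha n) (hbp n) hx)
    (fun n x hx => h.space₂.hasDerivAt_intervalIntegral_mul c1 (ha n) (hbp n) hx)
    (fun n x hx => ?_) (fun n => ?_) hG (K := fun x => N x * (2 * c + I₂))
    (hN.mul continuousOn_const) (fun n x hx => ?_) (fun x hx => ?_)
    (fun x hx => hlim _ (hint _ c1 j1 x hx))
  · have i1 : IntervalIntegrable (fun s => u₁ x s * wrightScaled β 1 s t) volume (a n) (b n) :=
      intervalIntegrable_of_continuousOn_Ioi ((h.space₁.cont'.slice_snd hx).mul c1.continuousOn) (ha n) (hbp n)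
    have i2 : IntervalIntegrable (fun s => u₂ x s * wrightScaled β 1 s t) volume (a n) (b n) :=
      intervalIntegrable_of_continuousOn_Ioi ((h.space₂.cont'.slice_snd hx).mul c1.continuousOn) (ha n) (hbp n)
    have hsub : uIcc (a n) (b n) ⊆ Ioi 0 := fun s hs => lt_of_lt_of_le (lt_min (ha n) (hbp n)) hs.1
    have hop := intervalIntegrable_of_continuousOn_Ioi
      (h.space₂.continuousOn_operator hx x (f x)) (ha n) (hbp n)
    -- On the truncated interval the operator applied to `u` is `u_s`; integration by parts moves
    -- this derivative onto `w_1` and leaves only values of `u`, which are bounded uniformly in `n`.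
    have hp := intervalIntegral.integral_mul_deriv_eq_deriv_mul
      (u := fun s => wrightScaled β 1 s t) (u' := fun s => -wrightScaled β 2 s t) (v := u x)
      (v' := fun s => x * u₂ x s + f x * u₁ x s) (a := a n) (b := b n)
      (fun s _ => hasDerivAt_wrightScaled_left h0 h1 le_rfl s ht)
      (fun s hs => h.time x hx s (hsub hs)) (c2.neg.intervalIntegrable _ _) hop
    rw [← intervalIntegral.integral_const_mul, ← intervalIntegral.integral_const_mul,
      ← intervalIntegral.integral_add (i2.const_mul x) (i1.const_mul (f x))]
    have e1 : ∀ s, x * (u₂ x s * wrightScaled β 1 s t) + f x * (u₁ x s * wrightScaled β 1 s t) =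
        wrightScaled β 1 s t * (x * u₂ x s + f x * u₁ x s) := fun s => by ring
    have e2 : ∀ s, -wrightScaled β 2 s t * u x s = -(u x s * wrightScaled β 2 s t) := fun s => by ring
    simp_rw [e1]
    rw [hp]
    simp_rw [e2]
    rw [intervalIntegral.integral_neg]
    ring
  · refine ContinuousOn.add (ContinuousOn.sub ?_ ?_) ?_
    · exact (h.space₁.cont.slice_fst (hbp n)).mul continuousOn_const
    · exact (h.space₁.cont.slice_fst (ha n)).mul continuousOn_const
    · exact fun x hx => (h.space₁.hasDerivAt_intervalIntegral_mul c2 (ha n) (hbp n)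
        hx).continuousAt.continuousWithinAt
  · have hterm : ∀ s > 0, |u x s * wrightScaled β 1 s t| ≤ N x * c := fun s hs => by
      rw [abs_mul]
      exact mul_le_mul (hb x hx s hs) (hC s hs.le t ht) (abs_nonneg _) (hN0 x hx)
    have hI : |∫ s in a n..b n, u x s * wrightScaled β 2 s t| ≤ N x * I₂ := by
      have hsub : Ioc (a n) (b n) ⊆ Ioi 0 := fun s hs => (ha n).trans hs.1
      have h3 : IntegrableOn (fun s => N x * |wrightScaled β 2 s t|) (Ioi 0) := j2.abs.const_mul _
      rw [hI₂, ← integral_const_mul, ← Real.norm_eq_abs, intervalIntegral.integral_of_le (hab n)]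
      refine (norm_integral_le_of_norm_le (g := fun s => N x * |wrightScaled β 2 s t|)
        (h3.mono_set hsub) ((ae_restrict_iff' measurableSet_Ioc).2 (Eventually.of_forall fun s hs => ?_))).trans
        (setIntegral_mono_set h3 (Eventually.of_forall fun s => mul_nonneg (hN0 x hx) (abs_nonneg _))
          hsub.eventuallyLE)
      rw [norm_mul]
      exact mul_le_mul_of_nonneg_right (hb x hx s (hsub hs)) (norm_nonneg _)
    have e1 := hterm _ (hbp n)
    have e2 := hterm _ (ha n)
    calc _ ≤ |u x (b n) * wrightScaled β 1 (b n) t| + |u x (a n) * wrightScaled β 1 (a n) t| +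
          |∫ s in a n..b n, u x s * wrightScaled β 2 s t| :=
        (abs_add_le _ _).trans (add_le_add (abs_sub _ _) le_rfl)
      _ ≤ N x * c + N x * c + N x * I₂ := by linarith
      _ = _ := by ring
  · have t1 : Tendsto (fun n => u x (b n) * wrightScaled β 1 (b n) t) atTop (𝓝 0) := by
      refine squeeze_zero_norm (a := fun n => N x * |wrightScaled β 1 (b n) t|) (fun n => ?_) ?_
      · rw [norm_mul]
        exact mul_le_mul_of_nonneg_right (hb x hx _ (hbp n)) (norm_nonneg _)
      · simpa using (((tendsto_wrightScaled_atTop h0 h1 ht).comp hbt).abs).const_mul (N x)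
    have t2 : Tendsto (fun n => u x (a n) * wrightScaled β 1 (a n) t) atTop
        (𝓝 (φ x * wrightScaled β 1 0 t)) :=
      ((h.tendsto_initial hx).comp hat).mul
        ((c1.tendsto 0).comp (tendsto_nhdsWithin_iff.1 hat).1)
    have := (t1.sub t2).add (hlim _ (hint _ c2 j2 x hx))
    rw [show (0 : ℝ) - φ x * wrightScaled β 1 0 t + ∫ s in Ioi (0 : ℝ), u x s * wrightScaled β 2 s t =
      (∫ s in Ioi (0 : ℝ), u x s * wrightScaled β 2 s t) - φ x * wrightScaled β 1 0 t by ring] at this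
    exact this

/-! ### Assembling the solution. -/

theorem contDiffOn_one_of_hasDerivAt {w w' : ℝ → ℝ} (hw : ∀ x > 0, HasDerivAt w (w' x) x)
    (hc : ContinuousOn w' (Ioi 0)) : ContDiffOn ℝ 1 w (Ioi 0) := by
  rw [show (1 : WithTop ℕ∞) = 0 + 1 by rfl, contDiffOn_succ_iff_deriv_of_isOpen isOpen_Ioi]
  refine ⟨fun x hx => (hw x hx).differentiableAt.differentiableWithinAt, by simp, ?_⟩
  rw [contDiffOn_zero]
  exact hc.congr fun x hx => (hw x hx).deriv

theorem contDiffOn_two_of_hasDerivAt {w w' w'' : ℝ → ℝ} (hw : ∀ x > 0, HasDerivAt w (w' x) x)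
    (hw' : ∀ x > 0, HasDerivAt w' (w'' x) x) (hc : ContinuousOn w'' (Ioi 0)) :
    ContDiffOn ℝ 2 w (Ioi 0) := by
  rw [show (2 : WithTop ℕ∞) = 1 + 1 by norm_num, contDiffOn_succ_iff_deriv_of_isOpen isOpen_Ioi]
  exact ⟨fun x hx => (hw x hx).differentiableAt.differentiableWithinAt, by simp,
    (contDiffOn_one_of_hasDerivAt hw' hc).congr fun x hx => (hw x hx).deriv⟩

/-- A solution is recognised from explicit derivatives of a function that agrees with it on the
quadrant. -/
theorem isFracSolution_of_hasDerivAt {β : ℝ} {f φ : ℝ → ℝ} {V U U₁ U₂ U' : ℝ → ℝ → ℝ} (h1 : β ≤ 1)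
    (hVU : ∀ x > 0, ∀ t > 0, V x t = U x t)
    (hU : ∀ t > 0, ∀ x > 0, HasDerivAt (fun x => U x t) (U₁ x t) x)
    (hU₁ : ∀ t > 0, ∀ x > 0, HasDerivAt (fun x => U₁ x t) (U₂ x t) x)
    (hU₂ : ∀ t > 0, ContinuousOn (fun x => U₂ x t) (Ioi 0))
    (hU' : ∀ x > 0, ∀ t > 0, HasDerivAt (U x) (U' x t) t)
    (hU'c : ∀ x > 0, ContinuousOn (U' x) (Ioi 0))
    (hi : β < 1 → ∀ x > 0, ∀ t > 0,
      IntervalIntegrable (fun τ => (t - τ) ^ (-β) * U' x τ) volume 0 t)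
    (he : β = 1 → ∀ x > 0, ∀ t > 0, U' x t = x * U₂ x t + f x * U₁ x t)
    (he' : β < 1 → ∀ x > 0, ∀ t > 0, (1 / Real.Gamma (1 - β)) *
      ∫ τ in (0 : ℝ)..t, (t - τ) ^ (-β) * U' x τ = x * U₂ x t + f x * U₁ x t)
    (h0 : ∀ x > 0, Tendsto (U x) (𝓝[>] 0) (𝓝 (φ x))) : IsFracSolution β f φ V := by
  have hV : ∀ t > 0, ∀ x > 0, HasDerivAt (fun x => V x t) (U₁ x t) x := fun t ht x hx =>
    (hU t ht x hx).congr_of_eventuallyEq (by filter_upwards [lt_mem_nhds hx] with y hy using hVU y hy t ht)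
  have hV' : ∀ x > 0, ∀ t > 0, HasDerivAt (fun s => V x s) (U' x t) t := fun x hx t ht =>
    (hU' x hx t ht).congr_of_eventuallyEq (by filter_upwards [lt_mem_nhds ht] with y hy using hVU x hx y hy)
  have hVV : ∀ t > 0, ∀ x > 0, deriv (deriv fun z => V z t) x = U₂ x t := fun t ht x hx =>
    ((hU₁ t ht x hx).congr_of_eventuallyEq (by
      filter_upwards [lt_mem_nhds hx] with y hy using (hV t ht y hy).deriv)).deriv
  refine ⟨fun t ht => contDiffOn_two_of_hasDerivAt (hV t ht) (hU₁ t ht) (hU₂ t ht),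
    fun x hx => contDiffOn_one_of_hasDerivAt (hV' x hx) (hU'c x hx), fun hβ x hx t ht => ?_,
    fun x hx t ht => ?_, fun x hx => (h0 x hx).congr' ?_⟩
  · refine (hi hβ x hx t ht).congr fun τ hτ => ?_
    rw [uIoc_of_le ht.le] at hτ
    rw [(hV' x hx τ hτ.1).deriv]
  · rw [hVV t ht x hx, (hV t ht x hx).deriv, caputoDeriv]
    split_ifs with hβ
    · rw [(hV' x hx t ht).deriv, he hβ x hx t ht]
    · rw [← he' (lt_of_le_of_ne h1 hβ) x hx t ht]
      congr 1
      refine intervalIntegral.integral_congr_ae (Eventually.of_forall fun τ hτ => ?_)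
      rw [uIoc_of_le ht.le] at hτ
      rw [(hV' x hx τ hτ.1).deriv]
  · filter_upwards [self_mem_nhdsWithin] with t ht using (hVU x hx t ht).symm

/-- For `β < 1` the Caputo derivative and the spatial operator were both computed as `∫ u w_2 ds - φ
w_1 (0, t)`; the equation is the equality of the two results. -/
theorem IsParabolic.isFracSolution_wrightTransform {f φ F : ℝ → ℝ} {u u₁ u₂ v : ℝ → ℝ → ℝ}
    (h : IsParabolic f φ u u₁ u₂) (hF : ∀ x > 0, HasDerivAt F (f x / x) x)
    (hf : ContinuousOn f (Ioi 0)) (hφ : ContinuousOn φ (Ioi 0))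
    (hv : ∀ x > 0, ∀ t > 0, v x t = u x t) :
    (∀ β : ℝ, 0 < β → β < 1 → ∀ x > 0, ∀ t > 0,
      IntegrableOn (fun s => v x s * wrightDensity β s t) (Ioi 0)) ∧
    ∀ β : ℝ, 0 < β → β ≤ 1 → IsFracSolution β f φ (fun x t => wrightTransform β (v x) t) := by
  obtain ⟨N, -, hN⟩ := h.bound
  have hu : ∀ x > 0, ContinuousOn (u x) (Ioi 0) := fun x hx => h.space₁.cont.slice_snd hx
  have heq : ∀ β x t : ℝ, 0 < x → 0 < t → ∀ s ∈ Ioi (0 : ℝ),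
      v x s * wrightDensity β s t = u x s * wrightScaled β 1 s t := fun β x t hx ht s hs => by
    rw [hv x hx s hs, wrightDensity_eq_wrightScaled β s ht]
  refine ⟨fun β h0 h1 x hx t ht => ?_, fun β h0 h1 => ?_⟩
  · obtain ⟨C, hC⟩ := h.rate x hx
    exact ((wright_transform_time h0 h1 (hu x hx) (hN x hx) hC).1 t ht).congr_fun
      (fun s hs => (heq β x t hx ht s hs).symm) measurableSet_Ioi
  · rcases h1.eq_or_lt with rfl | hlt
    · refine isFracSolution_of_hasDerivAt (U := u) (U₁ := u₁) (U₂ := u₂)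
        (U' := fun x t => x * u₂ x t + f x * u₁ x t) le_rfl
        (fun x hx t ht => by rw [wrightTransform, if_pos rfl, hv x hx t ht])
        (fun t ht x hx => h.space₁.deriv x hx t ht) (fun t ht x hx => h.space₂.deriv x hx t ht)
        (fun t ht => h.space₂.cont'.slice_fst ht) (fun x hx t ht => h.time x hx t ht)
        (fun x hx => h.space₂.continuousOn_operator hx x (f x)) (fun hc => absurd hc (lt_irrefl _))
        (fun _ x _ t _ => rfl) (fun hc => absurd hc (lt_irrefl _)) fun x hx => h.tendsto_initial hx
    · choose! C hC using h.rate
      have htime := fun x hx => wright_transform_time h0 hlt (hu x hx) (hN x hx) (hC x hx)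
      choose! K hK using fun x hx => (htime x hx).2.1
      choose! U' hU'c hU' hU'i hU'e using fun x hx => (htime x hx).2.2
      have hspace := fun t (ht : 0 < t) => h.exists_wright_operator hF hφ h0 hlt ht
      choose! U₁ hU₁ using fun t (ht : 0 < t) => (hspace t ht).2
      refine isFracSolution_of_hasDerivAt
        (U := fun x t => ∫ s in Ioi (0 : ℝ), u x s * wrightScaled β 1 s t)
        (U₁ := fun x t => U₁ t x) (U' := U') hlt.le (fun x hx t ht => ?_)
        (fun t ht x hx => (hU₁ t ht x hx).1) (fun t ht x hx => (hU₁ t ht x hx).2) (fun t ht => ?_)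
        (fun x hx t ht => hU' x hx t ht) (fun x hx => hU'c x hx) (fun _ x hx t ht => hU'i x hx t ht)
        (fun hc => absurd hc hlt.ne) (fun _ x hx t ht => ?_) (fun x hx => ?_)
      · rw [wrightTransform, if_neg hlt.ne]
        exact setIntegral_congr_fun measurableSet_Ioi (heq β x t hx ht)
      · refine ((hspace t ht).1.sub (hf.mul fun x hx =>
          (hU₁ t ht x hx).2.continuousAt.continuousWithinAt)).div continuousOn_id fun x hx => ne_of_gt hx
      · rw [hU'e x hx t ht]
        have hx' : x ≠ 0 := ne_of_gt hx
        field_simp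
        ring
      · rw [tendsto_iff_norm_sub_tendsto_zero]
        refine squeeze_zero' (g := fun t => K x * t ^ (β / 2)) (Eventually.of_forall fun _ => norm_nonneg _)
          (by filter_upwards [self_mem_nhdsWithin] with t ht using hK x hx t ht) ?_
        have h2 := ((Real.continuousAt_rpow_const 0 (β / 2) (Or.inr (by linarith))).tendsto.const_mul
          (K x)).mono_left (nhdsWithin_le_nhds (s := Ioi 0))
        rwa [Real.zero_rpow (by linarith), mul_zero] at h2

/-- The integrand is dominated by `|g|`, which is integrable by the case `l = 0`, and tends to `0`
at every `y > 0`. -/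
theorem tendsto_zero_of_isInverseLaplace {G g : ℝ → ℝ} (h : IsInverseLaplace G g) :
    Tendsto G atTop (𝓝 0) := by
  have hi : IntegrableOn g (Ioi 0) := by simpa using (h 0 le_rfl).1
  have ht : Tendsto (fun l => ∫ y in Ioi (0 : ℝ), Real.exp (-l * y) * g y) atTop
      (𝓝 (∫ _ in Ioi (0 : ℝ), (0 : ℝ))) := by
    refine tendsto_integral_filter_of_dominated_convergence (fun y => ‖g y‖) ?_ ?_ hi.norm ?_
    · filter_upwards [eventually_ge_atTop 0] with l hl using (h l hl).1.aestronglyMeasurable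
    · filter_upwards [eventually_ge_atTop 0] with l hl
      refine (ae_restrict_iff' measurableSet_Ioi).2 (Eventually.of_forall fun y hy => ?_)
      have hy : 0 < y := hy
      rw [norm_mul, Real.norm_of_nonneg (Real.exp_pos _).le]
      exact mul_le_of_le_one_left (norm_nonneg _) (Real.exp_le_one_iff.2 (by nlinarith))
    · refine (ae_restrict_iff' measurableSet_Ioi).2 (Eventually.of_forall fun y hy => ?_)
      have h2 : Tendsto (fun l : ℝ => -l * y) atTop atBot :=
        tendsto_neg_atTop_atBot.atBot_mul_const hy
      simpa using (Real.tendsto_exp_atBot.comp h2).mul_const (g y)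
  rw [integral_zero] at ht
  refine ht.congr' ?_
  filter_upwards [eventually_ge_atTop 0] with l hl using (h l hl).2

/-- Choosing `l` with `(1 + l)² = 1 / x` puts the argument of `Y` at `x`. The exponential prefactor
stays bounded below by `exp (-|1 + A / 2|)`, so decay of the transform is decay of `Y`; the single
point `x = t = 1` suffices. -/
theorem tendsto_exp_of_tendsto_laplaceKernel {A : ℝ} {F : ℝ → ℝ}
    (h : Tendsto (fun l => laplaceKernel A F l 1 1) atTop (𝓝 0)) :
    Tendsto (fun x => Real.exp (F x / 2)) (𝓝[>] 0) (𝓝 0) := by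
  have hl : Tendsto (fun x : ℝ => (√x)⁻¹ - 1) (𝓝[>] 0) atTop := by
    have h1 : Tendsto (fun x : ℝ => √x) (𝓝[>] 0) (𝓝[>] 0) := by
      refine tendsto_nhdsWithin_iff.2 ⟨?_, ?_⟩
      · simpa using (Real.continuous_sqrt.tendsto 0).mono_left (nhdsWithin_le_nhds (s := Ioi 0))
      · filter_upwards [self_mem_nhdsWithin] with x hx using Real.sqrt_pos.2 hx
    exact tendsto_atTop_add_const_right _ (-1) (tendsto_inv_nhdsGT_zero.comp h1)
  have h2 := (h.comp hl).mul_const (Real.exp (F 1 / 2) * Real.exp |1 + A / 2|)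
  rw [zero_mul] at h2
  refine squeeze_zero' (Eventually.of_forall fun x => (Real.exp_pos _).le) ?_ h2
  filter_upwards [self_mem_nhdsWithin, hl.eventually_ge_atTop 0] with x hx hl0
  have hx : 0 < x := hx
  have hs : 0 < √x := Real.sqrt_pos.2 hx
  simp only [Function.comp]
  set l := (√x)⁻¹ - 1 with hldef
  have e1 : (1 : ℝ) / (1 + l * 1) ^ 2 = x := by
    rw [hldef, mul_one, add_sub_cancel, inv_pow, Real.sq_sqrt hx.le, one_div, inv_inv]
  rw [laplaceKernel_eq, e1]
  have e2 : -|1 + A / 2| ≤ -(l * (1 + A * 1 ^ 2 / 2)) / (1 + l * 1) := by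
    rw [le_div_iff₀ (by linarith)]
    have := abs_nonneg (1 + A / 2)
    have h3 := mul_le_mul_of_nonneg_left (le_abs_self (1 + A / 2)) hl0
    linarith
  have e3 : 1 ≤ Real.exp (-(l * (1 + A * 1 ^ 2 / 2)) / (1 + l * 1)) * Real.exp |1 + A / 2| := by
    rw [← Real.exp_add]
    exact Real.one_le_exp (by linarith)
  have e4 : Real.exp (F 1 / 2) ≠ 0 := (Real.exp_pos _).ne'
  calc Real.exp (F x / 2) ≤ Real.exp (F x / 2) *
        (Real.exp (-(l * (1 + A * 1 ^ 2 / 2)) / (1 + l * 1)) * Real.exp |1 + A / 2|) :=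
        le_mul_of_one_le_right (Real.exp_pos _).le e3
    _ = _ := by field_simp

theorem corollary4p4 (A B : ℝ) (f F : ℝ → ℝ)
    (hf : ∀ x > 0, DifferentiableAt ℝ f x)
    (hRiccati : ∀ x > 0, x * deriv f x - f x + (1 / 2) * f x ^ 2 = A * x + B)
    (hF : ∀ x > 0, HasDerivAt F (f x / x) x) :
    ((∃ p : ℝ → ℝ → ℝ → ℝ, IsGreenKernel A F p) ↔
      ∀ x > 0, ∀ t > 0, Tendsto (fun l => laplaceKernel A F l x t) atTop (𝓝 0)) ∧
    ∀ p : ℝ → ℝ → ℝ → ℝ, IsGreenKernel A F p →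
      ∀ φ : ℝ → ℝ, ContDiffOn ℝ 2 φ (Ioi 0) → (∃ M : ℝ, ∀ y > 0, |φ y| ≤ M) →
        (∀ x > 0, ∀ t > 0, IntegrableOn (fun y => p x y t * φ y) (Ioi 0)) ∧
        (∀ β : ℝ, 0 < β → β < 1 → ∀ x > 0, ∀ t > 0,
          IntegrableOn (fun s => greenIntegral p φ x s * wrightDensity β s t) (Ioi 0)) ∧
        ∀ β : ℝ, 0 < β → β ≤ 1 →
          IsFracSolution β f φ
            (fun x t => wrightTransform β (greenIntegral p φ x) t) := by
  have hK : (∀ x > 0, ∀ t > 0, Tendsto (fun l => laplaceKernel A F l x t) atTop (𝓝 0)) →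
      HasKernel (laplaceKernel A F) := fun h =>
    hasKernel_laplaceKernel hf hRiccati hF
      (tendsto_exp_of_tendsto_laplaceKernel (h 1 one_pos 1 one_pos))
  have hdecay : ∀ p : ℝ → ℝ → ℝ → ℝ, IsGreenKernel A F p →
      ∀ x > 0, ∀ t > 0, Tendsto (fun l => laplaceKernel A F l x t) atTop (𝓝 0) :=
    fun p hp x hx t ht => tendsto_zero_of_isInverseLaplace (hp x hx t ht)
  refine ⟨⟨fun ⟨p, hp⟩ => hdecay p hp, fun h => (hK h).exists_inverseLaplace⟩, ?_⟩
  rintro p hp φ hφ ⟨M, hM⟩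
  have hφb : IsBoundedCont φ M := ⟨hφ.continuousOn, hM⟩
  have hφd : ∀ x > 0, DifferentiableAt ℝ φ x := fun x hx =>
    (hφ.contDiffAt (Ioi_mem_nhds hx)).differentiableAt (by norm_num)
  obtain ⟨u, u₁, u₂, hu, hpu⟩ := (hK (hdecay p hp)).exists_parabolic
    (isSolutionFamily_laplaceKernel hf hRiccati hF) (fun x _ t _ => laplaceKernel_zero A F x t) hφb hφd
  refine ⟨fun x hx t ht => ?_, hu.isFracSolution_wrightTransform hF
    (fun x hx => (hf x hx).continuousAt.continuousWithinAt) hφ.continuousOn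
    fun x hx t ht => hpu _ x hx t ht (hp x hx t ht)⟩
  have hi : IntegrableOn (fun y => p x y t) (Ioi 0) := by
    simpa using (hp x hx t ht 0 le_rfl).1
  refine hi.mul_bdd (c := M) (hφ.continuousOn.aestronglyMeasurable measurableSet_Ioi)
    ((ae_restrict_iff' measurableSet_Ioi).2 (Eventually.of_forall fun y hy => hM y hy))
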